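/- Let $\Omega=\mathbb R^3$ or $\Omega=\mathbb T^3=(\mathbb R/2\pi\mathbb Z)^3$. For $\nu>0$ and $T^*>0$ let $u$ be a smooth solution on $\Omega\times[0,T^*)$, with finite energy initial data, of the incompressible Navier–Stokes equations $$\partial_t u+(u\cdot\nabla)u=-\nabla p+\nu\Delta u,\qquad \nabla\cdot u=0,\qquad u(\cdot,0)=u_0\in L^2(\Omega).$$ That is: $u$ and $p$ are $C^\infty$ on $\Omega\times(0,T^*)$ and satisfy the equations there, $u\in C((0,T^*);H^m(\Omega))$ for every integer $m\ge 0$, and $u(t)\to u_0$ in $L^2(\Omega)$ as $t\to0^+$. Suppose that $u$ loses regularity at time $T^*$, i.e. that there is no field $w\in\bigcap_{m}H^m(\Omega)$ such that $u(t)\to w$ in $H^m(\Omega)$, as $t\to T^{*-}$, for every $m$. Then $$\|u(t)\|_{\dot H^{3/2}(\Omega)}\ \ge\ \frac{c\,\sqrt{\nu}}{\sqrt{T^*-t}}\qquad\text{for all } 0\le t<T^*,$$ where $c>0$ is an absolute constant. In particular the bound is $c_\nu/\sqrt{T^*-t}$, with $c_\nu>0$ depending only on $\nu$. Here $\|f\|_{\dot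 H^s}^2=\int_{\mathbb R^3}|\xi|^{2s}|\hat f(\xi)|^2\,d\xi$ on $\mathbb R^3$, with $\hat f$ the Fourier transform normalised to be unitary on $L^2$, and $\|f\|_{\dot H^s}^2=(2\pi)^3\sum_{k\in\mathbb Z^3}|k|^{2s}|\hat f(k)|^2$ on $\mathbb T^3$, with $\hat f(k)$ the Fourier coefficients; the norm is $+\infty$ when the integral or sum diverges. -/

import Mathlib

open MeasureTheory Set Filter Topology
open scoped ENNReal ContDiff FourierTransform Gradient InnerProductSpace

noncomputable section

namespace NavierStokes

/-- Three-dimensional Euclidean space (Euclidean norm, Lebesgue measure). -/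
abbrev E3 : Type := EuclideanSpace ℝ (Fin 3)

/-- The two spatial domains: the whole space `ℝ³`, and the torus `𝕋³ = (ℝ / 2πℤ)³`. Fields on the
torus are fields on `ℝ³` that are `2π`-periodic in each coordinate. -/
inductive Domain : Type
  | space
  | torus

/-- The period cell `(0, 2π]³` of the torus. -/
def box : Set E3 := {x | ∀ i, x i ∈ Ioc (0 : ℝ) (2 * Real.pi)}

/-- Lebesgue measure on the domain: on `ℝ³`, or on one period cell. -/
def vol : Domain → Measure E3
  | Domain.space => volume
  | Domain.torus => volume.restrict box

/-- `f` is a function on the domain: no condition on `ℝ³`, periodicity on the torus. -/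
def IsFieldOn {X : Type*} : Domain → (E3 → X) → Prop
  | Domain.space, _ => True
  | Domain.torus, f => ∀ (i : Fin 3) (x : E3), f (x + EuclideanSpace.single i (2 * Real.pi)) = f x

/-! ### Sobolev norms -/

/-- The `i`-th component of a vector field, as a complex-valued function. -/
def comp (f : E3 → E3) (i : Fin 3) : E3 → ℂ := fun x => ((f x i : ℝ) : ℂ)

/-- An integer wave vector as a point of `ℝ³`. -/
def wave (k : Fin 3 → ℤ) : E3 := WithLp.toLp 2 (fun i => (k i : ℝ))

/-- The Fourier coefficient `(2π)⁻³ ∫ g(x) e^{-i k·x} dx` over one period cell. -/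
def fourierCoeffBox (g : E3 → ℂ) (k : Fin 3 → ℤ) : ℂ :=
  ((2 * Real.pi : ℝ) : ℂ)⁻¹ ^ 3 *
    ∫ x in box, g x * Complex.exp (-(Complex.I * ((inner ℝ (wave k) x : ℝ) : ℂ)))

/-- The Fourier transform on `L²(ℝ³)`, with kernel `e^{-2πi x·η}`. -/
def fourierL2 (g : E3 → ℂ) (hg : MemLp g 2 (volume : Measure E3)) : Lp ℂ 2 (volume : Measure E3) :=
  𝓕 (hg.toLp g)

open Classical in
/-- The spectral integral of `W(ξ) |f̂(ξ)|²` over all wave vectors `ξ`, where `W` is a weight; it is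
`∞` by convention if `f` is not square integrable. It is normalised so that `W = 1` gives the square
of the `L²` norm. On `ℝ³` the wave vector is `ξ = 2πη`,
because of the kernel `e^{-2πi x·η}` of the Fourier transform. -/
def spectralIntegral (Ω : Domain) (W : E3 → ℝ≥0∞) (f : E3 → E3) : ℝ≥0∞ :=
  match Ω with
  | Domain.space =>
      if h : ∀ i, MemLp (comp f i) 2 (volume : Measure E3) then
        ∑ i, ∫⁻ η : E3, W ((2 * Real.pi) • η) * ‖fourierL2 (comp f i) (h i) η‖ₑ ^ 2
      else ⊤
  | Domain.torus =>
      if ∀ i, MemLp (comp f i) 2 (volume.restrict box) then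
        ENNReal.ofReal ((2 * Real.pi) ^ 3) *
          ∑' k : Fin 3 → ℤ, W (wave k) * ∑ i, ‖fourierCoeffBox (comp f i) k‖ₑ ^ 2
      else ⊤

/-- The homogeneous Sobolev norm `‖f‖_{Ḣˢ} = (∫ |ξ|^{2s} |f̂(ξ)|²)^{1/2}` of a square
integrable field, for `s ≥ 0`, with values in `[0, ∞]`. -/
def homSobolevNorm (Ω : Domain) (s : ℝ) (f : E3 → E3) : ℝ≥0∞ :=
  spectralIntegral Ω (fun ξ => ENNReal.ofReal (‖ξ‖ ^ (2 * s))) f ^ (1 / 2 : ℝ)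

/-- The Sobolev norm `‖f‖_{Hᵐ} = (∫ (1 + |ξ|²)ᵐ |f̂(ξ)|²)^{1/2}`, with values in `[0, ∞]`. -/
def sobolevNorm (Ω : Domain) (m : ℕ) (f : E3 → E3) : ℝ≥0∞ :=
  spectralIntegral Ω (fun ξ => ENNReal.ofReal ((1 + ‖ξ‖ ^ 2) ^ m)) f ^ (1 / 2 : ℝ)

/-! ### The Navier–Stokes equations -/

/-- The divergence of a vector field on `ℝ³`. -/
def divergence (v : E3 → E3) (x : E3) : ℝ :=
  ∑ i, fderiv ℝ v x (EuclideanSpace.single i 1) i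

/-- `(u, p)` is a smooth solution, with finite energy initial data `u 0`, of the incompressible
Navier–Stokes equations with viscosity `ν` on `Ω × [0, T)`.

For positive times, velocity and pressure are `C^∞` in space-time, and the velocity is a continuous
curve in every `Hᵐ` (this is automatic on the torus). The initial velocity is only required to be
square integrable, and it is attained in `L²`. -/
structure IsSmoothSolution (Ω : Domain) (ν T : ℝ) (u : ℝ → E3 → E3) (p : ℝ → E3 → ℝ) : Prop where
  velocity_field : ∀ t ∈ Ico 0 T, IsFieldOn Ω (u t)
  pressure_field : ∀ t ∈ Ioo 0 T, IsFieldOn Ω (p t)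
  velocity_smooth : ContDiffOn ℝ ∞ (fun z : ℝ × E3 => u z.1 z.2) (Ioo 0 T ×ˢ univ)
  pressure_smooth : ContDiffOn ℝ ∞ (fun z : ℝ × E3 => p z.1 z.2) (Ioo 0 T ×ˢ univ)
  momentum : ∀ t ∈ Ioo 0 T, ∀ x,
    deriv (fun s => u s x) t + fderiv ℝ (u t) x (u t x) =
      -gradient (p t) x + ν • Laplacian.laplacian (u t) x
  incompressible : ∀ t ∈ Ioo 0 T, ∀ x, divergence (u t) x = 0
  sobolev_finite : ∀ t ∈ Ioo 0 T, ∀ m : ℕ, sobolevNorm Ω m (u t) < ⊤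
  sobolev_continuous : ∀ t ∈ Ioo 0 T, ∀ m : ℕ,
    Tendsto (fun s => sobolevNorm Ω m (u s - u t)) (𝓝 t) (𝓝 0)
  initial_energy : MemLp (u 0) 2 (vol Ω)
  initial_attained : Tendsto (fun s => eLpNorm (u s - u 0) 2 (vol Ω)) (𝓝[>] 0) (𝓝 0)

/-- The curve `u` stays regular up to the time `T`: it extends to time `T` by a field `w`, as a
curve that is continuous (from the left, at `T`) in every `Hᵐ`. -/
def StaysRegularUpTo (Ω : Domain) (u : ℝ → E3 → E3) (T : ℝ) : Prop :=
  ∃ w : E3 → E3, ∀ m : ℕ, sobolevNorm Ω m w < ⊤ ∧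
    Tendsto (fun t => sobolevNorm Ω m (u t - w)) (𝓝[<] T) (𝓝 0)

/-- `u` loses regularity at the time `T`: it does not stay regular up to `T`. -/
def LosesRegularityAt (Ω : Domain) (u : ℝ → E3 → E3) (T : ℝ) : Prop :=
  ¬ StaysRegularUpTo Ω u T

end NavierStokes

end

/-! Work on the Fourier side with the truncated energies `Y_n = ∫ min(|ξ|, R)ⁿ |û|²`. For each `R`
they obey a differential inequality whose constants do not depend on `R`, and the theorem is the
Riccati inequality for `n = 3`.

Write a triad of frequencies as `r = p + q`. Because transport by a divergence-free field is skew,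
the nonlinear term tested against the weight `w = min(|·|, R)ⁿ` only involves the difference `w(r) -
w(q)`. This difference gains a factor of the lowest frequency, so the symbol is at most a constant
times `|p|^{3/2} |p|^{-1/2} |q|^{n/2} |r|^{n/2}` when `p` is lowest (`symbol_le_low_first`,
`symbol_le_low_second`). Now `∫_{|p| ≤ |r|} |p|⁻¹ ≤ A |r|²`, so a Cauchy–Schwarz in both variables
needs only the `Ḣ^{3/2}` norm of the low factor, and the `|r|²` it produces is paid for by the
dissipation. No embedding of `Ḣ^{3/2}` into `L^∞` is used, and that embedding fails. The outcome
(`lintegral_symmetrised_le`, `two_mul_re_weakRHS_le`) is `Y_n' ≤ (2CA/ν) Y₃ Y_n` with `C = n²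
2^{n-2}`.

For `n = 3` this reads `Y' ≤ (36A/ν) Y²`. If the asserted lower bound failed at some time `t`, then
`Y₃(t) < ν / (36A(T - t))`, and the Riccati comparison would bound `Y₃` up to `T` uniformly in `R`.
With `Y₃` bounded, the inequality for `n = 2m` is linear, so every Sobolev norm stays bounded
(`exists_bounds`). The `H²` bound makes the curve Lipschitz in `L²`, hence it has a limit at `T`,
and interpolation upgrades the convergence to every `Hᵐ` (`staysRegularUpTo`). This contradicts the
loss of regularity.

Truncation is needed because the initial field is only square integrable: `min(|ξ|, R)ⁿ` is a
bounded multiplier, so `Y_n` is finite and continuous even at time `0`. The time derivative is only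
available weakly, against smooth divergence-free test fields, which eliminates the pressure. Density
of these fields (`dense_testSpectra`) and a Lipschitz estimate turn this into differentiability of
the quadratic quantities `Y_n` (`hasDerivAt_re_inner_of_weak`).

Both domains are treated at once through `IsFourierModel`, realised by `isFourierModel_space` and
`isFourierModel_torus`. The constant is the smaller of the two values of `√(lam / (36A))`. -/

namespace NavierStokes

/-! ### Weakly differentiable curves in a Hilbert space. -/

section WeakDerivative

variable {H : Type*} [NormedAddCommGroup H] [InnerProductSpace ℂ H]

/-- A weak derivative tested against `D` is a weak derivative tested against the closed span. -/
theorem hasDerivAt_inner_of_mem_closure_span {U : ℝ → H} {L : ℝ → H →L[ℂ] ℂ} {D : Set H}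
    {S : Set ℝ} (hS : IsOpen S) (hL : ∀ t ∈ S, ∃ C, ∀ᶠ s in 𝓝 t, ‖L s‖ ≤ C)
    (hD : ∀ φ ∈ D, ∀ t ∈ S, HasDerivAt (fun s => inner ℂ (U s) φ) (L t φ) t)
    {φ : H} (hφ : φ ∈ closure (Submodule.span ℂ D : Set H)) {t : ℝ} (ht : t ∈ S) :
    HasDerivAt (fun s => inner ℂ (U s) φ) (L t φ) t := by
  have hspan : ∀ ψ ∈ Submodule.span ℂ D, ∀ s ∈ S,
      HasDerivAt (fun r => inner ℂ (U r) ψ) (L s ψ) s := by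
    intro ψ hψ s hs
    induction hψ using Submodule.span_induction with
    | mem x hx => exact hD x hx s hs
    | zero => simpa using hasDerivAt_const s (0 : ℂ)
    | add x y _ _ hx hy => simpa only [inner_add_right, map_add] using hx.fun_add hy
    | smul c x _ hx => simpa [inner_smul_right] using hx.const_mul c
  obtain ⟨ψ, hψ, hlim⟩ := mem_closure_iff_seq_limit.1 hφ
  obtain ⟨C, hC⟩ := hL t ht
  obtain ⟨V, hV, hVo, htV⟩ := mem_nhds_iff.1 (inter_mem hC (hS.mem_nhds ht))
  -- The local bound on `L` makes the derivatives along `ψ n → φ` converge uniformly near `t`, so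
  -- limit and derivative commute.
  refine hasDerivAt_of_tendstoUniformlyOn (l := atTop) (s := V)
    (f := fun n s => inner ℂ (U s) (ψ n)) (f' := fun n s => L s (ψ n))
    (g' := fun s => L s φ) hVo ?_ ?_ ?_ htV
  · rw [Metric.tendstoUniformlyOn_iff]
    intro ε hε
    have h1 : Tendsto (fun n => (|C| + 1) * ‖φ - ψ n‖) atTop (𝓝 0) := by
      have := (tendsto_const_nhds (x := φ)).sub hlim
      simpa using this.norm.const_mul (|C| + 1)
    filter_upwards [h1.eventually (gt_mem_nhds hε)] with n hn s hs
    rw [dist_eq_norm, ← map_sub]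
    refine lt_of_le_of_lt ((L s).le_opNorm _) (lt_of_le_of_lt ?_ hn)
    have : ‖L s‖ ≤ C := (hV hs).1
    gcongr
    linarith [le_abs_self C]
  · exact Eventually.of_forall fun n s hs => hspan _ (hψ n) s (hV hs).2
  · intro s _
    exact (continuous_const.inner continuous_id).continuousAt.tendsto.comp hlim

/-- A curve whose weak derivative is bounded by `C` is `C`-Lipschitz. -/
theorem norm_sub_le_of_weak_hasDerivAt {U : ℝ → H} {L : ℝ → H →L[ℂ] ℂ} {Hσ : Submodule ℂ H}
    {S : Set ℝ} (hS : Convex ℝ S) {C : ℝ} (hL : ∀ t ∈ S, ‖L t‖ ≤ C) (hU : ∀ t ∈ S, U t ∈ Hσ)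
    (hD : ∀ φ ∈ Hσ, ∀ t ∈ S, HasDerivAt (fun s => inner ℂ (U s) φ) (L t φ) t)
    {s t : ℝ} (hs : s ∈ S) (ht : t ∈ S) : ‖U s - U t‖ ≤ C * |s - t| := by
  -- The increment itself serves as the test vector; the mean value inequality then bounds `‖q‖²` by
  -- `C |s - t| ‖q‖`.
  set q := U s - U t with hq
  have hqσ : q ∈ Hσ := Hσ.sub_mem (hU s hs) (hU t ht)
  have h1 := hS.norm_image_sub_le_of_norm_hasDerivWithin_le (C := C * ‖q‖)
    (fun r hr => (hD q hqσ r hr).hasDerivWithinAt)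
    (fun r hr => ((L r).le_opNorm q).trans (by gcongr; exact hL r hr)) ht hs
  rw [← inner_sub_left, ← hq, inner_self_eq_norm_sq_to_K] at h1
  have h2 : ‖q‖ * ‖q‖ ≤ (C * |s - t|) * ‖q‖ := by
    have : ‖((‖q‖ : ℂ)) ^ 2‖ = ‖q‖ * ‖q‖ := by simp [pow_two]
    rw [Real.norm_eq_abs] at h1
    calc ‖q‖ * ‖q‖ = _ := this.symm
      _ ≤ _ := h1
      _ = _ := by ring
  rcases (norm_nonneg q).eq_or_lt with h0 | h0
  · rw [← h0]
    have := (norm_nonneg _).trans (hL s hs)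
    positivity
  · exact le_of_mul_le_mul_right h2 h0

/-- The derivative of a quadratic form along a weakly differentiable curve. -/
theorem hasDerivAt_re_inner_of_weak {U : ℝ → H} {L : ℝ → H →L[ℂ] ℂ} {Hσ : Submodule ℂ H}
    {S : Set ℝ} (hS : IsOpen S) (hL : ∀ t ∈ S, ∃ C, ∀ᶠ s in 𝓝 t, ‖L s‖ ≤ C)
    (hU : ∀ t ∈ S, U t ∈ Hσ)
    (hD : ∀ φ ∈ Hσ, ∀ t ∈ S, HasDerivAt (fun s => inner ℂ (U s) φ) (L t φ) t)
    (M : H →L[ℂ] H) (hM : ∀ x y, inner ℂ (M x) y = inner ℂ x (M y)) (hMσ : ∀ x ∈ Hσ, M x ∈ Hσ)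
    {t : ℝ} (ht : t ∈ S) :
    HasDerivAt (fun s => (inner ℂ (U s) (M (U s))).re) (2 * (L t (M (U t))).re) t := by
  obtain ⟨C, hC⟩ := hL t ht
  obtain ⟨ε, hε, hball⟩ := Metric.mem_nhds_iff.1 (inter_mem hC (hS.mem_nhds ht))
  have hlip : ∀ s ∈ Metric.ball t ε, ‖U s - U t‖ ≤ C * |s - t| := fun s hs =>
    norm_sub_le_of_weak_hasDerivAt (convex_ball t ε) (fun r hr => (hball hr).1)
      (fun r hr => hU r (hball hr).2) (fun φ hφ r hr => hD φ hφ r (hball hr).2) hs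
      (Metric.mem_ball_self hε)
  have h1 : HasDerivAt (fun s => 2 * (inner ℂ (U s) (M (U t))).re) (2 * (L t (M (U t))).re) t :=
    (Complex.reCLM.hasFDerivAt.comp_hasDerivAt t
      (hD _ (hMσ _ (hU t ht)) t ht)).const_mul 2
  -- The quadratic remainder is `O(|s - t|²)` by the Lipschitz bound, so strong differentiability of
  -- `U` is not needed.
  have h2 : HasDerivAt (fun s => (inner ℂ (U s - U t) (M (U s - U t))).re) 0 t := by
    have hO : (fun s => (inner ℂ (U s - U t) (M (U s - U t))).re) =O[𝓝 t]
        fun s => ‖s - t‖ ^ 2 := by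
      refine Asymptotics.IsBigO.of_bound (C * (‖M‖ * C)) ?_
      filter_upwards [Metric.ball_mem_nhds t hε] with s hs
      have h3 := hlip s hs
      have h6 : 0 ≤ C * |s - t| := (norm_nonneg _).trans h3
      calc ‖(inner ℂ (U s - U t) (M (U s - U t))).re‖
          ≤ ‖inner ℂ (U s - U t) (M (U s - U t))‖ := Complex.abs_re_le_norm _
        _ ≤ ‖U s - U t‖ * ‖M (U s - U t)‖ := norm_inner_le_norm _ _
        _ ≤ ‖U s - U t‖ * (‖M‖ * ‖U s - U t‖) := by gcongr; exact M.le_opNorm _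
        _ ≤ (C * |s - t|) * (‖M‖ * (C * |s - t|)) := by gcongr
        _ = C * (‖M‖ * C) * ‖‖s - t‖ ^ 2‖ := by
            simp only [Real.norm_eq_abs, abs_pow, abs_abs]; ring
    have := hO.hasFDerivAt (𝕜 := ℝ) (x₀ := t) (n := 2) (by norm_num)
    simpa using this.hasDerivAt
  have h4 : (fun s => (inner ℂ (U s) (M (U s))).re) = fun s =>
      2 * (inner ℂ (U s) (M (U t))).re + (inner ℂ (U s - U t) (M (U s - U t))).re
        - (inner ℂ (U t) (M (U t))).re := by
    funext s
    have : (inner ℂ (U t) (M (U s))).re = (inner ℂ (U s) (M (U t))).re := by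
      rw [← hM, ← inner_conj_symm, Complex.conj_re]
    simp only [map_sub, inner_sub_left, inner_sub_right, Complex.sub_re, this]
    ring
  rw [h4]
  have h5 := (h1.fun_add h2).sub_const (inner ℂ (U t) (M (U t))).re
  rwa [add_zero] at h5

end WeakDerivative

/-! ### Bounds for the symbol of the symmetrised transport term. -/

section Symbol

/-- The triangle inequality survives truncation, `min z R ≤ min x R + min y R`, and the elementary
bound for a difference of `n`-th powers does the rest. Here and below `x`, `y`, `z` stand for `|p|`,
`|q|`, `|r|` in a triad `r = p + q`. -/
theorem abs_min_pow_sub_le {x y z R : ℝ} (hx : 0 ≤ x) (hy : 0 ≤ y) (hyz : y ≤ z)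
    (hz : z ≤ x + y) (hR : 0 ≤ R) (n : ℕ) :
    |min z R ^ n - min y R ^ n| ≤ n * min z R ^ (n - 1) * min x R := by
  have h0 : 0 ≤ min y R := le_min hy hR
  have h1 : min y R ≤ min z R := min_le_min_right R hyz
  have h2 : min z R - min y R ≤ min x R := by
    rcases le_total x R with h | h <;> rcases le_total y R with h' | h' <;>
    rcases le_total z R with h'' | h'' <;> simp only [min_eq_left, min_eq_right, h, h', h''] <;>
    linarith
  have h3 := abs_pow_sub_pow_le (min z R) (min y R) n
  rw [abs_of_nonneg (sub_nonneg.2 h1), abs_of_nonneg (h0.trans h1), abs_of_nonneg h0,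
    max_eq_left h1] at h3
  calc _ ≤ _ := h3
    _ ≤ min x R * n * min z R ^ (n - 1) := by
        have : 0 ≤ min z R := h0.trans h1
        gcongr
    _ = _ := by ring

/-- The symbol of the symmetrised nonlinear term, when the lowest frequency is that of the
transporting field. -/
theorem symbol_le_low_first {x y z R : ℝ} (hx : 0 ≤ x) (hxy : x ≤ y) (hyz : y ≤ z)
    (hz : z ≤ x + y) (hR : 0 < R) {n : ℕ} (hn : n ≠ 1) :
    (y * |min z R ^ n - min y R ^ n|) ^ 2 ≤
      (n : ℝ) ^ 2 * 2 ^ (n - 2) * (min x R ^ 3 * min y R ^ n * min z R ^ n * x⁻¹) := by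
  have hy : 0 ≤ y := hx.trans hxy
  have hmx : 0 ≤ min x R := le_min hx hR.le
  have hmy : 0 ≤ min y R := le_min hy hR.le
  have hmz : 0 ≤ min z R := le_min (hy.trans hyz) hR.le
  have hrhs : 0 ≤ (n : ℝ) ^ 2 * 2 ^ (n - 2) * (min x R ^ 3 * min y R ^ n * min z R ^ n * x⁻¹) := by
    positivity
  rcases Nat.lt_or_ge n 2 with h2 | h2
  · have : n = 0 := by omega
    subst this
    simp
  -- If `R ≤ y`, both truncated weights equal `Rⁿ` and cancel. Otherwise `y`, and with it `x`, is
  -- untouched by the truncation.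
  rcases le_or_gt R y with hRy | hRy
  · rw [min_eq_right hRy, min_eq_right (hRy.trans hyz)]
    simp only [sub_self, abs_zero, mul_zero, ne_eq, OfNat.ofNat_ne_zero, not_false_eq_true,
      zero_pow]
    rw [min_eq_right hRy, min_eq_right (hRy.trans hyz)] at hrhs
    exact hrhs
  obtain ⟨k, rfl⟩ := Nat.exists_eq_add_of_le h2
  have hxm : min x R = x := min_eq_left (hxy.trans hRy.le)
  have hym : min y R = y := min_eq_left hRy.le
  have h1 := abs_min_pow_sub_le hx hy hyz hz hR.le (2 + k)
  -- The two higher frequencies are comparable: `n - 2` of the powers of `z` are traded for powers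
  -- of `y`, which costs `2^{n-2}`.
  have hz2 : min z R ≤ 2 * y := (min_le_left _ _).trans (by linarith)
  rw [hxm] at h1 ⊢
  rw [hym] at h1 ⊢
  have hk : 2 + k - 1 = k + 1 := by omega
  have hk' : 2 + k - 2 = k := by omega
  rw [hk] at h1
  rw [hk']
  calc (y * |min z R ^ (2 + k) - y ^ (2 + k)|) ^ 2
      ≤ (y * ((2 + k : ℕ) * min z R ^ (k + 1) * x)) ^ 2 := by gcongr
    _ = ((2 + k : ℕ) : ℝ) ^ 2 * (min z R ^ k * (min z R ^ (2 + k) * y ^ 2 * x ^ 2)) := by ring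
    _ ≤ ((2 + k : ℕ) : ℝ) ^ 2 * ((2 * y) ^ k * (min z R ^ (2 + k) * y ^ 2 * x ^ 2)) := by
        gcongr
    _ = ((2 + k : ℕ) : ℝ) ^ 2 * 2 ^ k * (x ^ 2 * y ^ (2 + k) * min z R ^ (2 + k)) := by
        rw [mul_pow]; ring
    _ = _ := by
        rcases hx.eq_or_lt with h | h
        · rw [← h]; simp
        · have : x ^ 3 * y ^ (2 + k) * min z R ^ (2 + k) * x⁻¹
              = x ^ 2 * y ^ (2 + k) * min z R ^ (2 + k) := by field_simp
          rw [this]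

/-- The symbol of the symmetrised nonlinear term, when the lowest frequency is that of the
transported field. -/
theorem symbol_le_low_second {x y z R : ℝ} (hy : 0 ≤ y) (hyx : y ≤ x) (hyz : y ≤ z)
    (hz : z ≤ x + y) (hR : 0 < R) {n : ℕ} (hn : n ≠ 1) :
    (y * |min z R ^ n - min y R ^ n|) ^ 2 ≤
      (n : ℝ) ^ 2 * 2 ^ (n - 2) * (min y R ^ 3 * min x R ^ n * min z R ^ n * y⁻¹) := by
  have hx : 0 ≤ x := hy.trans hyx
  have hmx : 0 ≤ min x R := le_min hx hR.le
  have hmy : 0 ≤ min y R := le_min hy hR.le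
  have hmz : 0 ≤ min z R := le_min (hy.trans hyz) hR.le
  have hrhs : 0 ≤ (n : ℝ) ^ 2 * 2 ^ (n - 2) * (min y R ^ 3 * min x R ^ n * min z R ^ n * y⁻¹) := by
    positivity
  rcases Nat.lt_or_ge n 2 with h2 | h2
  · have : n = 0 := by omega
    subst this
    simp
  rcases le_or_gt R y with hRy | hRy
  · rw [min_eq_right hRy, min_eq_right (hRy.trans hyz)]
    simp only [sub_self, abs_zero, mul_zero, ne_eq, OfNat.ofNat_ne_zero, not_false_eq_true,
      zero_pow]
    rw [min_eq_right hRy, min_eq_right (hRy.trans hyz)] at hrhs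
    exact hrhs
  obtain ⟨k, rfl⟩ := Nat.exists_eq_add_of_le h2
  have hym : min y R = y := min_eq_left hRy.le
  have h1 := abs_min_pow_sub_le hx hy hyz hz hR.le (2 + k)
  -- Now `y` is lowest, so `z` is compared with `x`, and the comparison must be made between
  -- truncated values since `x` may exceed `R`.
  have hz2 : min z R ≤ 2 * min x R := by
    rcases le_total x R with h | h
    · rw [min_eq_left h]; exact (min_le_left _ _).trans (by linarith)
    · rw [min_eq_right h]; exact (min_le_right _ _).trans (by linarith)
  rw [hym] at h1 ⊢
  have hk : 2 + k - 1 = k + 1 := by omega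
  have hk' : 2 + k - 2 = k := by omega
  rw [hk] at h1
  rw [hk']
  calc (y * |min z R ^ (2 + k) - y ^ (2 + k)|) ^ 2
      ≤ (y * ((2 + k : ℕ) * min z R ^ (k + 1) * min x R)) ^ 2 := by gcongr
    _ = ((2 + k : ℕ) : ℝ) ^ 2 * (min z R ^ k * (min z R ^ (2 + k) * min x R ^ 2 * y ^ 2)) := by
        ring
    _ ≤ ((2 + k : ℕ) : ℝ) ^ 2 *
          ((2 * min x R) ^ k * (min z R ^ (2 + k) * min x R ^ 2 * y ^ 2)) := by
        gcongr
    _ = ((2 + k : ℕ) : ℝ) ^ 2 * 2 ^ k * (y ^ 2 * min x R ^ (2 + k) * min z R ^ (2 + k)) := by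
        rw [mul_pow]; ring
    _ = _ := by
        rcases hy.eq_or_lt with h | h
        · rw [← h]; simp
        · have : y ^ 3 * min x R ^ (2 + k) * min z R ^ (2 + k) * y⁻¹
              = y ^ 2 * min x R ^ (2 + k) * min z R ^ (2 + k) := by field_simp
          rw [this]

end Symbol

end NavierStokes

namespace NavierStokes

theorem sq_lintegral_mul_le {α : Type*} [MeasurableSpace α] (μ : Measure α) {f g : α → ℝ≥0∞}
    (hf : AEMeasurable f μ) (hg : AEMeasurable g μ) :
    (∫⁻ a, f a * g a ∂μ) ^ 2 ≤ (∫⁻ a, f a ^ 2 ∂μ) * ∫⁻ a, g a ^ 2 ∂μ := by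
  have h := ENNReal.lintegral_mul_le_Lp_mul_Lq μ (Real.HolderConjugate.two_two) hf hg
  have h2 := pow_le_pow_left₀ zero_le h 2
  refine h2.trans_eq ?_
  rw [mul_pow, ← ENNReal.rpow_natCast, ← ENNReal.rpow_natCast, ← ENNReal.rpow_mul,
    ← ENNReal.rpow_mul]
  norm_num

theorem le_ofReal_sqrt_of_sq_le {a : ℝ≥0∞} {x : ℝ} (h : a ^ 2 ≤ ENNReal.ofReal x) :
    a ≤ ENNReal.ofReal √x := by
  rcases le_or_gt x 0 with hx | hx
  · rw [ENNReal.ofReal_of_nonpos hx] at h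
    simp only [nonpos_iff_eq_zero, ne_eq, OfNat.ofNat_ne_zero, not_false_eq_true,
      pow_eq_zero_iff] at h
    simp [h]
  · rw [← Real.sq_sqrt hx.le, ENNReal.ofReal_pow (Real.sqrt_nonneg _)] at h
    exact (ENNReal.pow_right_strictMono two_ne_zero).le_iff_le.1 h

/-! ### The trilinear estimate. -/

section Trilinear

variable {K : Type*} [AddCommGroup K] [MeasurableSpace K] [MeasurableAdd₂ K] [MeasurableNeg K]
  (μ : Measure K) [SFinite μ] [μ.IsAddLeftInvariant]

/-- For a triad `r = p + q` this involution exchanges `r` with `q` and flips the sign of `p`. It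
carries the skew-symmetry of transport. -/
theorem measurePreserving_neg_sub [μ.IsNegInvariant] :
    MeasurePreserving (fun z : K × K => (-z.1, z.2 - z.1)) (μ.prod μ) (μ.prod μ) :=
  ((Measure.measurePreserving_neg μ).prod (MeasurePreserving.id μ)).comp
    (measurePreserving_prod_sub μ μ)

/-- For a triad `r = p + q` this involution exchanges `p` with `q`. -/
theorem measurePreserving_sub_snd :
    MeasurePreserving (fun z : K × K => (z.2 - z.1, z.2)) (μ.prod μ) (μ.prod μ) := by
  have := (measurePreserving_prod_add μ μ).comp
    ((Measure.measurePreserving_swap (μ := μ) (ν := μ)).comp (measurePreserving_prod_sub μ μ))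
  convert! this using 1
  ext z <;> simp

variable (κ : K →+ E3)

/-- The kernel of the trilinear estimate: `p` is the lowest frequency, `r` the highest. -/
noncomputable def lowHigh (α β γ : K → ℝ≥0∞) (z : K × K) : ℝ≥0∞ :=
  (α z.1 * β (z.2 - z.1)) *
    ({z : K × K | ‖κ z.1‖ ≤ ‖κ z.2‖}.indicator
      (fun z => ENNReal.ofReal √(‖κ z.1‖⁻¹) * γ z.2) z)

variable {κ} (hκ : Measurable κ)
include hκ

theorem measurable_lowHigh {α β γ : K → ℝ≥0∞} (hα : Measurable α) (hβ : Measurable β)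
    (hγ : Measurable γ) : Measurable (lowHigh κ α β γ) := by
  unfold lowHigh
  have : MeasurableSet {z : K × K | ‖κ z.1‖ ≤ ‖κ z.2‖} :=
    measurableSet_le (hκ.comp measurable_fst).norm (hκ.comp measurable_snd).norm
  refine Measurable.mul (by fun_prop) (Measurable.indicator (by fun_prop) this)

/-- Cauchy–Schwarz on the product space, with `α(p) β(r - p)` against `1_{|p| ≤ |r|} |p|^{-1/2}
γ(r)`. The first factor separates by translation invariance; in the second the integral over `p` is
at most `A |r|²`. This replaces a pointwise bound on the low-frequency field. -/
theorem sq_lintegral_lowHigh_le {A : ℝ}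
    (hA : ∀ r : ℝ, 0 ≤ r → ∫⁻ p in {p | ‖κ p‖ ≤ r}, ENNReal.ofReal ‖κ p‖⁻¹ ∂μ
      ≤ ENNReal.ofReal (A * r ^ 2))
    {α β γ : K → ℝ≥0∞} (hα : Measurable α) (hβ : Measurable β) (hγ : Measurable γ) :
    (∫⁻ z, lowHigh κ α β γ z ∂(μ.prod μ)) ^ 2 ≤
      ((∫⁻ p, α p ^ 2 ∂μ) * ∫⁻ p, β p ^ 2 ∂μ) *
        ∫⁻ r, ENNReal.ofReal (A * ‖κ r‖ ^ 2) * γ r ^ 2 ∂μ := by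
  have hS : MeasurableSet {z : K × K | ‖κ z.1‖ ≤ ‖κ z.2‖} :=
    measurableSet_le (hκ.comp measurable_fst).norm (hκ.comp measurable_snd).norm
  have hg : Measurable ({z : K × K | ‖κ z.1‖ ≤ ‖κ z.2‖}.indicator
      (fun z => ENNReal.ofReal √(‖κ z.1‖⁻¹) * γ z.2)) :=
    Measurable.indicator (by fun_prop) hS
  have hf : Measurable fun z : K × K => α z.1 * β (z.2 - z.1) := by fun_prop
  refine (sq_lintegral_mul_le (μ.prod μ) hf.aemeasurable hg.aemeasurable).trans ?_
  refine mul_le_mul' (le_of_eq ?_) ?_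
  · rw [lintegral_prod _ (by fun_prop)]
    simp only [mul_pow]
    rw [← lintegral_mul_const _ (by fun_prop)]
    refine lintegral_congr fun p => ?_
    rw [lintegral_const_mul _ (by fun_prop), lintegral_sub_right_eq_self (fun q => β q ^ 2) p]
  · rw [lintegral_prod_symm' _ (by fun_prop)]
    refine lintegral_mono fun r => ?_
    have h1 : ∀ p, ({z : K × K | ‖κ z.1‖ ≤ ‖κ z.2‖}.indicator
        (fun z => ENNReal.ofReal √(‖κ z.1‖⁻¹) * γ z.2) (p, r)) ^ 2 =
        ({p | ‖κ p‖ ≤ ‖κ r‖}.indicator (fun p => ENNReal.ofReal ‖κ p‖⁻¹) p) * γ r ^ 2 := by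
      intro p
      by_cases h : ‖κ p‖ ≤ ‖κ r‖
      · rw [indicator_of_mem (show (p, r) ∈ {z : K × K | ‖κ z.1‖ ≤ ‖κ z.2‖} from h),
          indicator_of_mem (show p ∈ {p | ‖κ p‖ ≤ ‖κ r‖} from h), mul_pow,
          ← ENNReal.ofReal_pow (Real.sqrt_nonneg _), Real.sq_sqrt (by positivity)]
      · rw [indicator_of_notMem (show (p, r) ∉ {z : K × K | ‖κ z.1‖ ≤ ‖κ z.2‖} from h),
          indicator_of_notMem (show p ∉ {p | ‖κ p‖ ≤ ‖κ r‖} from h)]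
        simp
    have hm : MeasurableSet {p | ‖κ p‖ ≤ ‖κ r‖} := measurableSet_le hκ.norm measurable_const
    simp only [h1]
    rw [lintegral_mul_const _ (Measurable.indicator (by fun_prop) hm),
      lintegral_indicator hm]
    gcongr
    exact hA _ (norm_nonneg _)

/-- The symmetrised nonlinear term is bounded by the `Ḣ^{3/2}` norm, a (truncated) Sobolev norm and
the corresponding dissipation. -/
theorem lintegral_symmetrised_le [μ.IsNegInvariant] {A : ℝ} (hA0 : 0 ≤ A)
    (hA : ∀ r : ℝ, 0 ≤ r → ∫⁻ p in {p | ‖κ p‖ ≤ r}, ENNReal.ofReal ‖κ p‖⁻¹ ∂μ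
      ≤ ENNReal.ofReal (A * r ^ 2))
    {e : K → ℝ} (he : Measurable e) (he0 : ∀ k, 0 ≤ e k) (hneg : ∀ k, e (-k) = e k)
    {R : ℝ} (hR : 0 < R) {n : ℕ} (hn : n ≠ 1) {Y₃ Y Z : ℝ} (hY₃0 : 0 ≤ Y₃) (hY0 : 0 ≤ Y)
    (hY₃ : ∫⁻ k, ENNReal.ofReal (min ‖κ k‖ R ^ 3 * e k ^ 2) ∂μ ≤ ENNReal.ofReal Y₃)
    (hY : ∫⁻ k, ENNReal.ofReal (min ‖κ k‖ R ^ n * e k ^ 2) ∂μ ≤ ENNReal.ofReal Y)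
    (hZ : ∫⁻ k, ENNReal.ofReal (‖κ k‖ ^ 2 * (min ‖κ k‖ R ^ n * e k ^ 2)) ∂μ
      ≤ ENNReal.ofReal Z) :
    ∫⁻ z : K × K, ENNReal.ofReal (e z.1 * min ‖κ z.2‖ ‖κ (z.2 - z.1)‖ * e (z.2 - z.1) * e z.2 *
        |min ‖κ z.2‖ R ^ n - min ‖κ (z.2 - z.1)‖ R ^ n|) ∂(μ.prod μ) ≤
      ENNReal.ofReal (4 * √((n : ℝ) ^ 2 * 2 ^ (n - 2)) * √(Y₃ * Y * (A * Z))) := by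
  set I : K × K → ℝ := fun z => e z.1 * min ‖κ z.2‖ ‖κ (z.2 - z.1)‖ * e (z.2 - z.1) * e z.2 *
        |min ‖κ z.2‖ R ^ n - min ‖κ (z.2 - z.1)‖ R ^ n| with hI
  set C : ℝ := (n : ℝ) ^ 2 * 2 ^ (n - 2) with hC
  set α : K → ℝ≥0∞ := fun k => ENNReal.ofReal (√(min ‖κ k‖ R ^ 3) * e k) with hαd
  set β : K → ℝ≥0∞ := fun k => ENNReal.ofReal (√(min ‖κ k‖ R ^ n) * e k) with hβd
  have hmeas : ∀ j : ℕ, Measurable fun k => √(min ‖κ k‖ R ^ j) * e k := by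
    intro j
    have : Measurable fun k => min ‖κ k‖ R := hκ.norm.min measurable_const
    fun_prop
  have hα : Measurable α := (hmeas 3).ennreal_ofReal
  have hβ : Measurable β := (hmeas n).ennreal_ofReal
  have hm0 : ∀ k, 0 ≤ min ‖κ k‖ R := fun k => le_min (norm_nonneg _) hR.le
  have hsq : ∀ (j : ℕ) k, ENNReal.ofReal (√(min ‖κ k‖ R ^ j) * e k) ^ 2 =
      ENNReal.ofReal (min ‖κ k‖ R ^ j * e k ^ 2) := by
    intro j k
    rw [← ENNReal.ofReal_pow (mul_nonneg (Real.sqrt_nonneg _) (he0 k)), mul_pow,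
      Real.sq_sqrt (pow_nonneg (hm0 k) _)]
  set T : K × K → ℝ≥0∞ := lowHigh κ α β β with hT
  have hTmeas : Measurable T := measurable_lowHigh hκ hα hβ hβ
  have hTint : ∫⁻ z, T z ∂(μ.prod μ) ≤ ENNReal.ofReal √(Y₃ * Y * (A * Z)) := by
    refine le_ofReal_sqrt_of_sq_le ((sq_lintegral_lowHigh_le μ hκ hA hα hβ hβ).trans ?_)
    rw [ENNReal.ofReal_mul (mul_nonneg hY₃0 hY0), ENNReal.ofReal_mul hY₃0, ENNReal.ofReal_mul hA0]
    refine mul_le_mul' (mul_le_mul' ?_ ?_) ?_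
    · simpa only [hαd, hsq] using hY₃
    · simpa only [hβd, hsq] using hY
    · calc ∫⁻ r, ENNReal.ofReal (A * ‖κ r‖ ^ 2) * β r ^ 2 ∂μ
          = ∫⁻ r, ENNReal.ofReal A *
              ENNReal.ofReal (‖κ r‖ ^ 2 * (min ‖κ r‖ R ^ n * e r ^ 2)) ∂μ := by
            refine lintegral_congr fun r => ?_
            rw [hβd]
            simp only [hsq]
            rw [← ENNReal.ofReal_mul (by positivity), ← ENNReal.ofReal_mul hA0, mul_assoc]
        _ = ENNReal.ofReal A *
              ∫⁻ r, ENNReal.ofReal (‖κ r‖ ^ 2 * (min ‖κ r‖ R ^ n * e r ^ 2)) ∂μ := by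
            rw [lintegral_const_mul]
            have : Measurable fun k => min ‖κ k‖ R := hκ.norm.min measurable_const
            fun_prop
        _ ≤ _ := by gcongr
  have hT2 : ∫⁻ z, T (z.2 - z.1, z.2) ∂(μ.prod μ) = ∫⁻ z, T z ∂(μ.prod μ) :=
    (measurePreserving_sub_snd μ).lintegral_comp hTmeas
  -- Triads with `|q| ≤ |r|`: the lowest frequency is `p` or `q`, and the two cases give the two
  -- summands, which are exchanged by `p ↔ q`.
  have key : ∀ z : K × K, ‖κ (z.2 - z.1)‖ ≤ ‖κ z.2‖ →
      ENNReal.ofReal (I z) ≤ ENNReal.ofReal √C * (T z + T (z.2 - z.1, z.2)) := by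
    rintro ⟨p, r⟩ hle
    have hz : ‖κ r‖ ≤ ‖κ p‖ + ‖κ (r - p)‖ := by
      calc ‖κ r‖ = ‖κ p + κ (r - p)‖ := by rw [← map_add]; simp
        _ ≤ _ := norm_add_le _ _
    simp only at hle
    have hIe : I (p, r) = (e p * e (r - p) * e r) *
        (‖κ (r - p)‖ * |min ‖κ r‖ R ^ n - min ‖κ (r - p)‖ R ^ n|) := by
      simp only [hI, min_eq_right hle]; ring
    have he3 : 0 ≤ e p * e (r - p) * e r :=
      mul_nonneg (mul_nonneg (he0 _) (he0 _)) (he0 _)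
    rw [hIe]
    rcases le_total ‖κ p‖ ‖κ (r - p)‖ with h | h
    · have h1 := Real.le_sqrt_of_sq_le
        (symbol_le_low_first (norm_nonneg _) h hle hz hR hn)
      have hp : ‖κ p‖ ≤ ‖κ r‖ := h.trans hle
      calc _ ≤ ENNReal.ofReal ((e p * e (r - p) * e r) * √((n : ℝ) ^ 2 * 2 ^ (n - 2) *
            (min ‖κ p‖ R ^ 3 * min ‖κ (r - p)‖ R ^ n * min ‖κ r‖ R ^ n * ‖κ p‖⁻¹))) := by
            gcongr
        _ = ENNReal.ofReal √C * T (p, r) := by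
            have hp' : (p, r) ∈ {z : K × K | ‖κ z.1‖ ≤ ‖κ z.2‖} := hp
            simp only [hT, lowHigh, indicator_of_mem hp', hαd, hβd]
            rw [← ENNReal.ofReal_mul (by have := he0 p; positivity),
              ← ENNReal.ofReal_mul (by positivity),
              ← ENNReal.ofReal_mul (by have := he0 p; have := he0 (r - p); positivity),
              ← ENNReal.ofReal_mul (by positivity)]
            congr 1
            rw [Real.sqrt_mul (by positivity), Real.sqrt_mul, Real.sqrt_mul, Real.sqrt_mul,
              Real.sqrt_mul]
            · ring
            all_goals have := hm0 p; have := hm0 r; have := hm0 (r - p); positivity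
        _ ≤ _ := by gcongr; exact le_self_add
    · have h1 := Real.le_sqrt_of_sq_le
        (symbol_le_low_second (norm_nonneg _) h hle hz hR hn)
      calc _ ≤ ENNReal.ofReal ((e p * e (r - p) * e r) * √((n : ℝ) ^ 2 * 2 ^ (n - 2) *
            (min ‖κ (r - p)‖ R ^ 3 * min ‖κ p‖ R ^ n * min ‖κ r‖ R ^ n * ‖κ (r - p)‖⁻¹))) := by
            gcongr
        _ = ENNReal.ofReal √C * T (r - p, r) := by
            have hp' : (r - p, r) ∈ {z : K × K | ‖κ z.1‖ ≤ ‖κ z.2‖} := hle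
            simp only [hT, lowHigh, indicator_of_mem hp', hαd, hβd, sub_sub_cancel]
            rw [← ENNReal.ofReal_mul (by have := he0 (r - p); positivity),
              ← ENNReal.ofReal_mul (by positivity),
              ← ENNReal.ofReal_mul (by have := he0 p; have := he0 (r - p); positivity),
              ← ENNReal.ofReal_mul (by positivity)]
            congr 1
            rw [Real.sqrt_mul (by positivity), Real.sqrt_mul, Real.sqrt_mul, Real.sqrt_mul,
              Real.sqrt_mul]
            · ring
            all_goals have := hm0 p; have := hm0 r; have := hm0 (r - p); positivity
        _ ≤ _ := by gcongr; exact le_add_self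
  set F : K × K → ℝ≥0∞ := fun z => ENNReal.ofReal √C * (T z + T (z.2 - z.1, z.2)) with hF
  have hFmeas : Measurable F := by
    have : Measurable fun z : K × K => T (z.2 - z.1, z.2) := by fun_prop
    fun_prop
  -- Triads with `|r| ≤ |q|` reduce to `key`, because the involution exchanging `q` and `r` leaves
  -- `I` unchanged.
  have hall : ∀ z, ENNReal.ofReal (I z) ≤ F z + F (-z.1, z.2 - z.1) := by
    intro z
    rcases le_total ‖κ (z.2 - z.1)‖ ‖κ z.2‖ with h | h
    · exact (key z h).trans le_self_add
    · have hIS : I (-z.1, z.2 - z.1) = I z := by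
        have h3 : z.2 - z.1 - -z.1 = z.2 := by abel
        simp only [hI, h3, hneg]
        rw [abs_sub_comm, min_comm ‖κ (z.2 - z.1)‖]
        ring
      rw [← hIS]
      refine (key (-z.1, z.2 - z.1) ?_).trans le_add_self
      have h3 : z.2 - z.1 - -z.1 = z.2 := by abel
      simpa only [h3] using h
  calc ∫⁻ z, ENNReal.ofReal (I z) ∂(μ.prod μ)
      ≤ ∫⁻ z, (F z + F (-z.1, z.2 - z.1)) ∂(μ.prod μ) := lintegral_mono hall
    _ = ∫⁻ z, F z ∂(μ.prod μ) + ∫⁻ z, F z ∂(μ.prod μ) := by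
        rw [lintegral_add_left hFmeas, (measurePreserving_neg_sub μ).lintegral_comp hFmeas]
    -- Each of the two involutions preserves the measure and contributes a factor `2`.
    _ = 4 * (ENNReal.ofReal √C * ∫⁻ z, T z ∂(μ.prod μ)) := by
        have : ∫⁻ z, F z ∂(μ.prod μ) = ENNReal.ofReal √C *
            (∫⁻ z, T z ∂(μ.prod μ) + ∫⁻ z, T z ∂(μ.prod μ)) := by
          rw [hF, lintegral_const_mul _ (by fun_prop), lintegral_add_left hTmeas, hT2]
        rw [this]; ring
    _ ≤ 4 * (ENNReal.ofReal √C * ENNReal.ofReal √(Y₃ * Y * (A * Z))) := by gcongr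
    _ = _ := by
        rw [ENNReal.ofReal_mul (by positivity), ENNReal.ofReal_mul (by norm_num)]
        norm_num [mul_assoc]

end Trilinear

end NavierStokes

/-! ### Amplitudes and the weak right-hand side on the Fourier side. -/

namespace NavierStokes

/-- Complex vectors, the values of the Fourier transforms of vector fields. -/
abbrev C3 : Type := EuclideanSpace ℂ (Fin 3)

/-- The inclusion of real vectors into complex vectors. -/
noncomputable def cpx (x : E3) : C3 := WithLp.toLp 2 fun i => ((x i : ℝ) : ℂ)

@[simp] theorem cpx_apply (x : E3) (i : Fin 3) : cpx x i = ((x i : ℝ) : ℂ) := rfl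

theorem cpx_add (x y : E3) : cpx (x + y) = cpx x + cpx y := by
  ext i; simp

@[simp] theorem norm_cpx (x : E3) : ‖cpx x‖ = ‖x‖ := by
  simp [EuclideanSpace.norm_eq]

theorem continuous_cpx : Continuous cpx := by
  unfold cpx
  fun_prop

theorem measurable_cpx : Measurable cpx := continuous_cpx.measurable

variable {K : Type*} [AddCommGroup K] [MeasurableSpace K]

/-- The Fourier side of a real, divergence-free vector field all of whose Sobolev norms are
finite. -/
structure IsAmplitude (μ : Measure K) (κ : K →+ E3) (a : K → C3) : Prop where
  measurable : Measurable a
  inner_eq_zero : ∀ k, inner ℂ (a k) (cpx (κ k)) = 0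
  conj_symm : ∀ k i, a (-k) i = (starRingEnd ℂ) (a k i)
  sobolev : ∀ m : ℕ, ∫⁻ k, ENNReal.ofReal ((1 + ‖κ k‖ ^ 2) ^ m) * ‖a k‖ₑ ^ 2 ∂μ < ⊤

/-- The integrand of the weak form of the transport term `(u · ∇) u` on the Fourier side. -/
noncomputable def transportIntegrand (κ : K →+ E3) (a φ : K → C3) (z : K × K) : ℂ :=
  Complex.I * (inner ℂ (a z.1) (cpx (κ z.2)) * inner ℂ (a (z.2 - z.1)) (φ z.2))

/-- The weak form of the right-hand side of the Navier–Stokes equations on the Fourier side,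
tested against a divergence-free field. -/
noncomputable def weakRHS (μ : Measure K) (κ : K →+ E3) (ν : ℝ) (a φ : K → C3) : ℂ :=
  ∫ z, transportIntegrand κ a φ z ∂(μ.prod μ) -
    ν * ∫ k, ((‖κ k‖ ^ 2 : ℝ) : ℂ) * inner ℂ (a k) (φ k) ∂μ

variable {μ : Measure K} {κ : K →+ E3} {a : K → C3}

namespace IsAmplitude

theorem norm_neg (ha : IsAmplitude μ κ a) (k : K) : ‖a (-k)‖ = ‖a k‖ := by
  simp [EuclideanSpace.norm_eq, ha.conj_symm]

/-- Since `a p` is orthogonal to `κ p`, the derivative may be taken at the frequency `r` or at `r -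
p`. The smaller of the two is used in the symbol bound. -/
theorem inner_eq (ha : IsAmplitude μ κ a) (p r : K) :
    inner ℂ (a p) (cpx (κ r)) = inner ℂ (a p) (cpx (κ (r - p))) := by
  have : κ r = κ p + κ (r - p) := by rw [← map_add]; simp
  rw [this, cpx_add, inner_add_right, ha.inner_eq_zero, zero_add]

theorem inner_neg (ha : IsAmplitude μ κ a) (p r : K) :
    inner ℂ (a (-p)) (cpx (κ r)) = (starRingEnd ℂ) (inner ℂ (a p) (cpx (κ r))) := by
  simp only [PiLp.inner_apply, map_sum, ha.conj_symm]
  refine Finset.sum_congr rfl fun i _ => ?_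
  simp [RCLike.inner_apply]

theorem memLp (ha : IsAmplitude μ κ a) : MemLp a 2 μ := by
  refine ⟨ha.measurable.aestronglyMeasurable, ?_⟩
  rw [eLpNorm_lt_top_iff_lintegral_rpow_enorm_lt_top two_ne_zero ENNReal.ofNat_ne_top]
  simpa using ha.sobolev 0

theorem integrable_mul_sq (ha : IsAmplitude μ κ a) {f : K → ℝ} (hf : Measurable f) {C : ℝ}
    {m : ℕ} (hle : ∀ k, |f k| ≤ C * (1 + ‖κ k‖ ^ 2) ^ m) :
    Integrable (fun k => f k * ‖a k‖ ^ 2) μ := by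
  have hm := ha.measurable
  refine ⟨by fun_prop, ?_⟩
  have h1 : ∀ k, ‖f k * ‖a k‖ ^ 2‖ₑ ≤
      ENNReal.ofReal C * (ENNReal.ofReal ((1 + ‖κ k‖ ^ 2) ^ m) * ‖a k‖ₑ ^ 2) := by
    intro k
    have hC : 0 ≤ C := by
      have h2 := (abs_nonneg _).trans (hle k)
      exact nonneg_of_mul_nonneg_left h2 (by positivity)
    rw [enorm_mul, enorm_pow, enorm_norm, ← mul_assoc, ← ENNReal.ofReal_mul hC]
    gcongr
    rw [Real.enorm_eq_ofReal_abs]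
    exact ENNReal.ofReal_le_ofReal (hle k)
  refine (lintegral_mono h1).trans_lt ?_
  by_cases hκ : Measurable κ
  · rw [lintegral_const_mul _ (by fun_prop)]
    exact ENNReal.mul_lt_top ENNReal.ofReal_lt_top (ha.sobolev m)
  · rw [lintegral_const_mul' _ _ ENNReal.ofReal_ne_top]
    exact ENNReal.mul_lt_top ENNReal.ofReal_lt_top (ha.sobolev m)

end IsAmplitude

/-- The derivative is placed on the transported field, so that `φ` carries no weight and may be
merely square integrable. -/
theorem enorm_transportIntegrand_le (ha : IsAmplitude μ κ a) (φ : K → C3) (z : K × K) :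
    ‖transportIntegrand κ a φ z‖ₑ ≤
      ‖a z.1‖ₑ * (‖κ (z.2 - z.1)‖ₑ * ‖a (z.2 - z.1)‖ₑ * ‖φ z.2‖ₑ) := by
  unfold transportIntegrand
  rw [ha.inner_eq, enorm_mul, enorm_mul]
  have h1 : ‖Complex.I‖ₑ = 1 := by simp [enorm_eq_nnnorm]
  have h2 : ∀ x y : C3, ‖(inner ℂ x y : ℂ)‖ₑ ≤ ‖x‖ₑ * ‖y‖ₑ := by
    intro x y
    simp only [← ofReal_norm]
    rw [← ENNReal.ofReal_mul (norm_nonneg _)]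
    exact ENNReal.ofReal_le_ofReal (norm_inner_le_norm x y)
  have h3 : ∀ x : E3, ‖cpx x‖ₑ = ‖x‖ₑ := fun x => by simp only [← ofReal_norm, norm_cpx]
  rw [h1, one_mul]
  calc _ ≤ (‖a z.1‖ₑ * ‖κ (z.2 - z.1)‖ₑ) * (‖a (z.2 - z.1)‖ₑ * ‖φ z.2‖ₑ) := by
        refine mul_le_mul' ((h2 _ _).trans_eq ?_) (h2 _ _)
        rw [h3]
    _ = _ := by ring

theorem lintegral_enorm_sq_eq {X : Type*} [MeasurableSpace X] {μ : Measure X} (φ : Lp C3 2 μ) :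
    ∫⁻ k, ‖φ k‖ₑ ^ 2 ∂μ = ENNReal.ofReal (‖φ‖ ^ 2) := by
  rw [Lp.norm_def, ENNReal.ofReal_pow ENNReal.toReal_nonneg,
    ENNReal.ofReal_toReal (Lp.eLpNorm_ne_top φ), eLpNorm_eq_lintegral_rpow_enorm_toReal
    two_ne_zero ENNReal.ofNat_ne_top, ← ENNReal.rpow_natCast, ← ENNReal.rpow_mul]
  norm_num

theorem lintegral_viscous_le (hκ : Measurable κ) (ha : IsAmplitude μ κ a)
    {φ : K → C3} (hφ : Measurable φ) {S N : ℝ} (hS0 : 0 ≤ S)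
    (hS : ∫⁻ k, ENNReal.ofReal ((1 + ‖κ k‖ ^ 2) ^ 2) * ‖a k‖ₑ ^ 2 ∂μ ≤ ENNReal.ofReal S)
    (hN0 : 0 ≤ N) (hN : ∫⁻ k, ‖φ k‖ₑ ^ 2 ∂μ ≤ ENNReal.ofReal (N ^ 2)) :
    ∫⁻ k, ‖((‖κ k‖ ^ 2 : ℝ) : ℂ) * inner ℂ (a k) (φ k)‖ₑ ∂μ ≤ ENNReal.ofReal (√S * N) := by
  have hm := ha.measurable
  have h1 : ∀ k, ‖((‖κ k‖ ^ 2 : ℝ) : ℂ) * inner ℂ (a k) (φ k)‖ₑ ≤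
      (ENNReal.ofReal (‖κ k‖ ^ 2) * ‖a k‖ₑ) * ‖φ k‖ₑ := by
    intro k
    rw [enorm_mul, mul_assoc]
    refine mul_le_mul' (le_of_eq ?_) ?_
    · rw [← ofReal_norm, Complex.norm_real, norm_pow, norm_norm]
    · simp only [← ofReal_norm]
      rw [← ENNReal.ofReal_mul (norm_nonneg _)]
      exact ENNReal.ofReal_le_ofReal (norm_inner_le_norm _ _)
  refine (lintegral_mono h1).trans ?_
  rw [← Real.sqrt_sq hN0, ← Real.sqrt_mul hS0]
  apply le_ofReal_sqrt_of_sq_le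
  refine (sq_lintegral_mul_le μ (by fun_prop) (by fun_prop)).trans ?_
  rw [ENNReal.ofReal_mul hS0]
  refine mul_le_mul' (le_trans (lintegral_mono fun k => ?_) hS) hN
  rw [mul_pow, ← ENNReal.ofReal_pow (by positivity)]
  gcongr
  linarith

section Functional

variable [MeasurableAdd₂ K] [MeasurableNeg K]

theorem measurable_transportIntegrand (hκ : Measurable κ) (ha : IsAmplitude μ κ a) {φ : K → C3}
    (hφ : Measurable φ) : Measurable (transportIntegrand κ a φ) := by
  have h1 := ha.measurable
  have h2 : Measurable fun z : K × K => cpx (κ z.2) := measurable_cpx.comp (by fun_prop)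
  unfold transportIntegrand
  have h3 : Measurable fun z : K × K => a (z.2 - z.1) := by fun_prop
  have h4 : Measurable fun z : K × K => a z.1 := by fun_prop
  have h5 : Measurable fun z : K × K => φ z.2 := by fun_prop
  exact ((h4.inner h2).mul (h3.inner h5)).const_mul _

variable [SFinite μ] [μ.IsAddLeftInvariant]

/-- This is the embedding of `H²` into bounded functions: `a` is integrable by Cauchy–Schwarz
against `(1 + |κ|²)⁻¹`, with norm at most `√(B S)`. The remaining factors `|κ| a` and `φ` are square
integrable. -/
theorem lintegral_transportIntegrand_le (hκ : Measurable κ) (ha : IsAmplitude μ κ a)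
    {φ : K → C3} (hφ : Measurable φ) {B S N : ℝ} (hB0 : 0 ≤ B) (hS0 : 0 ≤ S)
    (hB : ∫⁻ k, ENNReal.ofReal (((1 + ‖κ k‖ ^ 2) ^ 2)⁻¹) ∂μ ≤ ENNReal.ofReal B)
    (hS : ∫⁻ k, ENNReal.ofReal ((1 + ‖κ k‖ ^ 2) ^ 2) * ‖a k‖ₑ ^ 2 ∂μ ≤ ENNReal.ofReal S)
    (hN0 : 0 ≤ N) (hN : ∫⁻ k, ‖φ k‖ₑ ^ 2 ∂μ ≤ ENNReal.ofReal (N ^ 2)) :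
    ∫⁻ z, ‖transportIntegrand κ a φ z‖ₑ ∂(μ.prod μ) ≤ ENNReal.ofReal (√B * S * N) := by
  have hm := ha.measurable
  have h1 : ∫⁻ k, ‖a k‖ₑ ∂μ ≤ ENNReal.ofReal √(B * S) := by
    apply le_ofReal_sqrt_of_sq_le
    have := sq_lintegral_mul_le μ
      (f := fun k => ENNReal.ofReal ((1 + ‖κ k‖ ^ 2)⁻¹))
      (g := fun k => ENNReal.ofReal (1 + ‖κ k‖ ^ 2) * ‖a k‖ₑ) (by fun_prop) (by fun_prop)
    have h2 : ∀ k, ENNReal.ofReal ((1 + ‖κ k‖ ^ 2)⁻¹) *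
        (ENNReal.ofReal (1 + ‖κ k‖ ^ 2) * ‖a k‖ₑ) = ‖a k‖ₑ := by
      intro k
      rw [← mul_assoc, ← ENNReal.ofReal_mul (by positivity), inv_mul_cancel₀ (by positivity)]
      simp
    simp only [h2] at this
    refine this.trans ?_
    rw [ENNReal.ofReal_mul hB0]
    refine mul_le_mul' (le_trans (le_of_eq ?_) hB) (le_trans (le_of_eq ?_) hS)
    · refine lintegral_congr fun k => ?_
      rw [← ENNReal.ofReal_pow (by positivity), inv_pow]
    · refine lintegral_congr fun k => ?_
      rw [mul_pow, ← ENNReal.ofReal_pow (by positivity)]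
  have h2 : ∀ p, ∫⁻ r, ‖κ (r - p)‖ₑ * ‖a (r - p)‖ₑ * ‖φ r‖ₑ ∂μ ≤ ENNReal.ofReal √(S * N ^ 2) := by
    intro p
    apply le_ofReal_sqrt_of_sq_le
    refine (sq_lintegral_mul_le μ (f := fun r => ‖κ (r - p)‖ₑ * ‖a (r - p)‖ₑ)
      (g := fun r => ‖φ r‖ₑ) (by fun_prop) (by fun_prop)).trans ?_
    rw [ENNReal.ofReal_mul hS0, lintegral_sub_right_eq_self (fun q => (‖κ q‖ₑ * ‖a q‖ₑ) ^ 2) p]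
    refine mul_le_mul' (le_trans (lintegral_mono fun k => ?_) hS) hN
    rw [mul_pow]
    gcongr
    rw [← ofReal_norm, ← ENNReal.ofReal_pow (norm_nonneg _)]
    apply ENNReal.ofReal_le_ofReal
    nlinarith [sq_nonneg ‖κ k‖]
  calc ∫⁻ z, ‖transportIntegrand κ a φ z‖ₑ ∂(μ.prod μ)
      ≤ ∫⁻ z : K × K, ‖a z.1‖ₑ * (‖κ (z.2 - z.1)‖ₑ * ‖a (z.2 - z.1)‖ₑ * ‖φ z.2‖ₑ)
          ∂(μ.prod μ) := lintegral_mono fun z => enorm_transportIntegrand_le ha φ z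
    _ = ∫⁻ p, ‖a p‖ₑ * ∫⁻ r, ‖κ (r - p)‖ₑ * ‖a (r - p)‖ₑ * ‖φ r‖ₑ ∂μ ∂μ := by
        rw [lintegral_prod _ (by fun_prop)]
        refine lintegral_congr fun p => ?_
        dsimp only
        rw [lintegral_const_mul _ (by fun_prop)]
    _ ≤ ∫⁻ p, ‖a p‖ₑ * ENNReal.ofReal √(S * N ^ 2) ∂μ := by
        gcongr with p
        exact h2 p
    _ = (∫⁻ p, ‖a p‖ₑ ∂μ) * ENNReal.ofReal √(S * N ^ 2) :=
        lintegral_mul_const _ (by fun_prop)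
    _ ≤ ENNReal.ofReal √(B * S) * ENNReal.ofReal √(S * N ^ 2) := by gcongr
    _ = _ := by
        rw [← ENNReal.ofReal_mul (Real.sqrt_nonneg _), Real.sqrt_mul hB0, Real.sqrt_mul hS0,
          Real.sqrt_sq hN0]
        congr 1
        calc √B * √S * (√S * N) = √B * (√S * √S) * N := by ring
          _ = _ := by rw [Real.mul_self_sqrt hS0]

theorem integrable_transportIntegrand (hκ : Measurable κ) (ha : IsAmplitude μ κ a)
    (hB : ∫⁻ k, ENNReal.ofReal (((1 + ‖κ k‖ ^ 2) ^ 2)⁻¹) ∂μ < ⊤)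
    {φ : K → C3} (hφ : Measurable φ) (hφ2 : ∫⁻ k, ‖φ k‖ₑ ^ 2 ∂μ < ⊤) :
    Integrable (transportIntegrand κ a φ) (μ.prod μ) := by
  refine ⟨(measurable_transportIntegrand hκ ha hφ).aestronglyMeasurable, ?_⟩
  refine (lintegral_transportIntegrand_le hκ ha hφ ENNReal.toReal_nonneg ENNReal.toReal_nonneg
    (ENNReal.ofReal_toReal hB.ne).ge (ENNReal.ofReal_toReal (ha.sobolev 2).ne).ge
    (Real.sqrt_nonneg (∫⁻ k, ‖φ k‖ₑ ^ 2 ∂μ).toReal) ?_).trans_lt ENNReal.ofReal_lt_top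
  rw [Real.sq_sqrt ENNReal.toReal_nonneg, ENNReal.ofReal_toReal hφ2.ne]

/-- An `H²` field makes the right-hand side a bounded functional on `L²`. Its norm depends on `a`
only through `S`, so Sobolev bounds that are uniform in time give uniform Lipschitz bounds for the
curve. -/
theorem exists_weakRHS_functional (hκ : Measurable κ) (ha : IsAmplitude μ κ a)
    {B S ν : ℝ} (hB0 : 0 ≤ B) (hS0 : 0 ≤ S) (hν : 0 ≤ ν)
    (hB : ∫⁻ k, ENNReal.ofReal (((1 + ‖κ k‖ ^ 2) ^ 2)⁻¹) ∂μ ≤ ENNReal.ofReal B)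
    (hS : ∫⁻ k, ENNReal.ofReal ((1 + ‖κ k‖ ^ 2) ^ 2) * ‖a k‖ₑ ^ 2 ∂μ ≤ ENNReal.ofReal S) :
    ∃ L : Lp C3 2 μ →L[ℂ] ℂ, (∀ φ : Lp C3 2 μ, L φ = weakRHS μ κ ν a φ) ∧
      ‖L‖ ≤ √B * S + ν * √S := by
  have hmeas : ∀ φ : Lp C3 2 μ, Measurable φ := fun φ => (Lp.stronglyMeasurable φ).measurable
  have hfin : ∀ φ : Lp C3 2 μ, ∫⁻ k, ‖φ k‖ₑ ^ 2 ∂μ < ⊤ := fun φ => by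
    rw [lintegral_enorm_sq_eq]; exact ENNReal.ofReal_lt_top
  have hi1 : ∀ φ : Lp C3 2 μ, Integrable (transportIntegrand κ a φ) (μ.prod μ) := fun φ =>
    integrable_transportIntegrand hκ ha (hB.trans_lt ENNReal.ofReal_lt_top) (hmeas φ) (hfin φ)
  have hle2 : ∀ φ : Lp C3 2 μ, _ := fun φ =>
    lintegral_viscous_le hκ ha (hmeas φ) hS0 hS (norm_nonneg φ) (lintegral_enorm_sq_eq φ).le
  have hi2 : ∀ φ : Lp C3 2 μ,
      Integrable (fun k => ((‖κ k‖ ^ 2 : ℝ) : ℂ) * inner ℂ (a k) (φ k)) μ := fun φ =>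
    ⟨((by fun_prop : Measurable fun k => ((‖κ k‖ ^ 2 : ℝ) : ℂ)).mul
      (ha.measurable.inner (hmeas φ))).aestronglyMeasurable,
      (hle2 φ).trans_lt ENNReal.ofReal_lt_top⟩
  refine ⟨LinearMap.mkContinuous
    { toFun := fun φ => weakRHS μ κ ν a φ
      map_add' := ?_
      map_smul' := ?_ } (√B * S + ν * √S) ?_, fun φ => rfl,
    LinearMap.mkContinuous_norm_le _ (by positivity) _⟩
  · intro φ ψ
    have h1 : ∫ z, transportIntegrand κ a ((φ + ψ : Lp C3 2 μ) : K → C3) z ∂(μ.prod μ) =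
        ∫ z, transportIntegrand κ a φ z ∂(μ.prod μ) +
          ∫ z, transportIntegrand κ a ψ z ∂(μ.prod μ) := by
      rw [← integral_add (hi1 φ) (hi1 ψ)]
      refine integral_congr_ae ?_
      filter_upwards [Measure.quasiMeasurePreserving_snd.ae (Lp.coeFn_add φ ψ)] with z hz
      simp only [transportIntegrand, hz, Pi.add_apply, inner_add_right]
      ring
    have h2 : ∫ k, ((‖κ k‖ ^ 2 : ℝ) : ℂ) * inner ℂ (a k) ((φ + ψ : Lp C3 2 μ) k) ∂μ =
        ∫ k, ((‖κ k‖ ^ 2 : ℝ) : ℂ) * inner ℂ (a k) (φ k) ∂μ +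
          ∫ k, ((‖κ k‖ ^ 2 : ℝ) : ℂ) * inner ℂ (a k) (ψ k) ∂μ := by
      rw [← integral_add (hi2 φ) (hi2 ψ)]
      refine integral_congr_ae ?_
      filter_upwards [Lp.coeFn_add φ ψ] with z hz
      simp only [hz, Pi.add_apply, inner_add_right]
      ring
    simp only [weakRHS, h1, h2]
    ring
  · intro c φ
    have h1 : ∫ z, transportIntegrand κ a ((c • φ : Lp C3 2 μ) : K → C3) z ∂(μ.prod μ) =
        c * ∫ z, transportIntegrand κ a φ z ∂(μ.prod μ) := by
      rw [← integral_const_mul]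
      refine integral_congr_ae ?_
      filter_upwards [Measure.quasiMeasurePreserving_snd.ae (Lp.coeFn_smul c φ)] with z hz
      simp only [transportIntegrand, hz, Pi.smul_apply, inner_smul_right]
      ring
    have h2 : ∫ k, ((‖κ k‖ ^ 2 : ℝ) : ℂ) * inner ℂ (a k) ((c • φ : Lp C3 2 μ) k) ∂μ =
        c * ∫ k, ((‖κ k‖ ^ 2 : ℝ) : ℂ) * inner ℂ (a k) (φ k) ∂μ := by
      rw [← integral_const_mul]
      refine integral_congr_ae ?_
      filter_upwards [Lp.coeFn_smul c φ] with z hz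
      simp only [hz, Pi.smul_apply, inner_smul_right]
      ring
    simp only [weakRHS, h1, h2, RingHom.id_apply, smul_eq_mul]
    ring
  · intro φ
    have h1 : ‖∫ z, transportIntegrand κ a φ z ∂(μ.prod μ)‖ ≤ √B * S * ‖φ‖ := by
      rw [← ENNReal.ofReal_le_ofReal_iff (by positivity), ofReal_norm]
      exact (enorm_integral_le_lintegral_enorm _).trans (lintegral_transportIntegrand_le hκ ha
        (hmeas φ) hB0 hS0 hB hS (norm_nonneg φ) (lintegral_enorm_sq_eq φ).le)
    have h2 : ‖∫ k, ((‖κ k‖ ^ 2 : ℝ) : ℂ) * inner ℂ (a k) (φ k) ∂μ‖ ≤ √S * ‖φ‖ := by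
      rw [← ENNReal.ofReal_le_ofReal_iff (by positivity), ofReal_norm]
      exact (enorm_integral_le_lintegral_enorm _).trans (hle2 φ)
    calc ‖weakRHS μ κ ν a φ‖ ≤ ‖∫ z, transportIntegrand κ a φ z ∂(μ.prod μ)‖ +
          ‖(ν : ℂ) * ∫ k, ((‖κ k‖ ^ 2 : ℝ) : ℂ) * inner ℂ (a k) (φ k) ∂μ‖ := norm_sub_le _ _
      _ ≤ √B * S * ‖φ‖ + ν * (√S * ‖φ‖) := by
          rw [norm_mul, Complex.norm_real, Real.norm_of_nonneg hν]
          gcongr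
      _ = _ := by ring

end Functional

end NavierStokes

/-! ### The differential inequality for truncated energies. -/

namespace NavierStokes

variable {K : Type*} [AddCommGroup K] [MeasurableSpace K] {μ : Measure K} {κ : K →+ E3}
  {a : K → C3}

/-- The truncated energy `∫ min(|κ|, R)ⁿ |a|²`. -/
noncomputable def truncEnergy (μ : Measure K) (κ : K →+ E3) (R : ℝ) (n : ℕ) (a : K → C3) : ℝ :=
  ∫ k, min ‖κ k‖ R ^ n * ‖a k‖ ^ 2 ∂μ

theorem trunc_nonneg {R : ℝ} (hR : 0 < R) (x : E3) (n : ℕ) : 0 ≤ min ‖x‖ R ^ n :=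
  pow_nonneg (le_min (norm_nonneg _) hR.le) n

theorem trunc_le {R : ℝ} (hR : 0 < R) (x : E3) (n : ℕ) : min ‖x‖ R ^ n ≤ R ^ n :=
  pow_le_pow_left₀ (le_min (norm_nonneg _) hR.le) (min_le_right _ _) n

theorem truncEnergy_nonneg {R : ℝ} (hR : 0 < R) (n : ℕ) : 0 ≤ truncEnergy μ κ R n a :=
  integral_nonneg fun _ => mul_nonneg (trunc_nonneg hR _ _) (sq_nonneg _)

theorem measurable_trunc (hκ : Measurable κ) (R : ℝ) (n : ℕ) :
    Measurable fun k => min ‖κ k‖ R ^ n :=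
  (hκ.norm.min measurable_const).pow_const n

theorem IsAmplitude.integrable_trunc (ha : IsAmplitude μ κ a) (hκ : Measurable κ) {R : ℝ}
    (hR : 0 < R) (n : ℕ) : Integrable (fun k => min ‖κ k‖ R ^ n * ‖a k‖ ^ 2) μ :=
  ha.integrable_mul_sq (measurable_trunc hκ R n) (C := R ^ n) (m := 0) fun k => by
    rw [abs_of_nonneg (trunc_nonneg hR _ _)]
    simpa using trunc_le hR _ _

theorem IsAmplitude.integrable_dissipation (ha : IsAmplitude μ κ a) (hκ : Measurable κ) {R : ℝ}
    (hR : 0 < R) (n : ℕ) :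
    Integrable (fun k => ‖κ k‖ ^ 2 * (min ‖κ k‖ R ^ n * ‖a k‖ ^ 2)) μ := by
  have := ha.integrable_mul_sq (f := fun k => ‖κ k‖ ^ 2 * min ‖κ k‖ R ^ n)
    ((hκ.norm.pow_const 2).mul (measurable_trunc hκ R n)) (C := R ^ n) (m := 1) fun k => by
      have h1 := trunc_nonneg hR (κ k) n
      have h2 := trunc_le hR (κ k) n
      rw [abs_of_nonneg (by positivity), mul_comm, pow_one]
      gcongr
      linarith
  simpa only [mul_assoc] using this

variable [MeasurableAdd₂ K] [MeasurableNeg K] [SFinite μ] [μ.IsAddLeftInvariant]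
  [μ.IsNegInvariant]

/-- The transport term tested against a multiplier of the field itself, symmetrised. -/
theorem two_mul_re_integral_transportIntegrand (hκ : Measurable κ) (ha : IsAmplitude μ κ a)
    (hB : ∫⁻ k, ENNReal.ofReal (((1 + ‖κ k‖ ^ 2) ^ 2)⁻¹) ∂μ < ⊤)
    {w : K → ℝ} (hw : Measurable w) {M : ℝ} (hM : ∀ k, |w k| ≤ M) :
    2 * (∫ z, transportIntegrand κ a (fun k => (w k : ℂ) • a k) z ∂(μ.prod μ)).re =
      ∫ z, (transportIntegrand κ a a z).re * (w z.2 - w (z.2 - z.1)) ∂(μ.prod μ) := by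
  set τ : K × K → ℝ := fun z => (transportIntegrand κ a a z).re with hτ
  have hm := ha.measurable
  have hwa : Measurable fun k => (w k : ℂ) • a k := by fun_prop
  have h1 : ∀ z, (transportIntegrand κ a (fun k => (w k : ℂ) • a k) z).re = τ z * w z.2 := by
    intro z
    have : transportIntegrand κ a (fun k => (w k : ℂ) • a k) z =
        (w z.2 : ℂ) * transportIntegrand κ a a z := by
      simp only [transportIntegrand, inner_smul_right]
      ring
    rw [this, Complex.re_ofReal_mul, mul_comm]
  have hint0 : Integrable (transportIntegrand κ a (fun k => (w k : ℂ) • a k)) (μ.prod μ) := by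
    refine integrable_transportIntegrand hκ ha hB hwa ?_
    have h2 : ∀ k, ‖(w k : ℂ) • a k‖ₑ ^ 2 ≤ ENNReal.ofReal (M ^ 2) *
        (ENNReal.ofReal ((1 + ‖κ k‖ ^ 2) ^ 0) * ‖a k‖ₑ ^ 2) := by
      intro k
      rw [enorm_smul, mul_pow, ← ofReal_norm (w k : ℂ), Complex.norm_real, pow_zero,
        ENNReal.ofReal_one, one_mul, ← ENNReal.ofReal_pow (norm_nonneg _)]
      gcongr
      exact hM k
    refine (lintegral_mono h2).trans_lt ?_
    rw [lintegral_const_mul' _ _ ENNReal.ofReal_ne_top]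
    exact ENNReal.mul_lt_top ENNReal.ofReal_lt_top (ha.sobolev 0)
  have hint : Integrable (fun z => τ z * w z.2) (μ.prod μ) := by
    have := hint0.re
    simp only [RCLike.re_to_complex, h1] at this
    exact this
  have hS := measurePreserving_neg_sub μ
  -- Exchanging `r` and `r - p` conjugates the product of the two inner products, and `Re(i x̄) =
  -- -Re(i x)`. Reality and incompressibility of the field both enter here.
  have hτS : ∀ z : K × K, τ (-z.1, z.2 - z.1) = - τ z := by
    rintro ⟨p, r⟩
    have h3 : r - p - -p = r := by abel
    simp only [hτ, transportIntegrand, h3, ha.inner_neg, ← ha.inner_eq]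
    rw [← inner_conj_symm (a r), ← map_mul]
    set x := inner ℂ (a p) (cpx (κ r)) * inner ℂ (a (r - p)) (a r)
    simp
  have hcomp : ∀ z : K × K, (fun z : K × K => τ z * w z.2) (-z.1, z.2 - z.1) =
      -(τ z * w (z.2 - z.1)) := by
    intro z
    simp only [hτS]
    ring
  have hint2 : Integrable (fun z : K × K => τ z * w (z.2 - z.1)) (μ.prod μ) := by
    have := (hS.integrable_comp hint.aestronglyMeasurable).2 hint
    have h4 := this.neg
    refine h4.congr (Eventually.of_forall fun z => ?_)
    simp only [Pi.neg_apply, Function.comp_apply, hcomp, neg_neg]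
  have h5 : ∫ z : K × K, τ z * w (z.2 - z.1) ∂(μ.prod μ) = -∫ z, τ z * w z.2 ∂(μ.prod μ) := by
    have h6 : ∫ z : K × K, (fun z : K × K => τ z * w z.2) (-z.1, z.2 - z.1) ∂(μ.prod μ) =
        ∫ z, τ z * w z.2 ∂(μ.prod μ) := by
      have h7 := hS.map_eq
      have h9 := integral_map (φ := fun z : K × K => (-z.1, z.2 - z.1))
        (f := fun z : K × K => τ z * w z.2) hS.measurable.aemeasurable
        (by rw [h7]; exact hint.aestronglyMeasurable)
      rw [h7] at h9
      exact h9.symm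
    rw [← h6]
    simp only [hcomp, integral_neg, neg_neg]
  have h8 : (∫ z, transportIntegrand κ a (fun k => (w k : ℂ) • a k) z ∂(μ.prod μ)).re =
      ∫ z, τ z * w z.2 ∂(μ.prod μ) := by
    have := integral_re hint0
    simp only [RCLike.re_to_complex, h1] at this
    exact this.symm
  rw [h8]
  simp only [mul_sub]
  rw [integral_sub hint hint2, h5]
  ring

/-- The energy inequality for the truncated Sobolev norms. -/
theorem two_mul_re_weakRHS_le (hκ : Measurable κ) (ha : IsAmplitude μ κ a)
    (hB : ∫⁻ k, ENNReal.ofReal (((1 + ‖κ k‖ ^ 2) ^ 2)⁻¹) ∂μ < ⊤) {A : ℝ} (hA0 : 0 ≤ A)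
    (hA : ∀ r : ℝ, 0 ≤ r → ∫⁻ p in {p | ‖κ p‖ ≤ r}, ENNReal.ofReal ‖κ p‖⁻¹ ∂μ
      ≤ ENNReal.ofReal (A * r ^ 2))
    {ν : ℝ} (hν : 0 < ν) {R : ℝ} (hR : 0 < R) {n : ℕ} (hn : n ≠ 1) :
    2 * (weakRHS μ κ ν a fun k => ((min ‖κ k‖ R ^ n : ℝ) : ℂ) • a k).re ≤
      2 * ((n : ℝ) ^ 2 * 2 ^ (n - 2)) * A / ν *
        (truncEnergy μ κ R 3 a * truncEnergy μ κ R n a) := by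
  set w : K → ℝ := fun k => min ‖κ k‖ R ^ n with hw
  set Y₃ := truncEnergy μ κ R 3 a
  set Y := truncEnergy μ κ R n a
  set Z := ∫ k, ‖κ k‖ ^ 2 * (min ‖κ k‖ R ^ n * ‖a k‖ ^ 2) ∂μ with hZ
  set C : ℝ := (n : ℝ) ^ 2 * 2 ^ (n - 2) with hC
  have hm := ha.measurable
  have hwm : Measurable w := measurable_trunc hκ R n
  have hY₃0 : 0 ≤ Y₃ := truncEnergy_nonneg hR 3
  have hY0 : 0 ≤ Y := truncEnergy_nonneg hR n
  have hZ0 : 0 ≤ Z := integral_nonneg fun _ =>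
    mul_nonneg (sq_nonneg _) (mul_nonneg (trunc_nonneg hR _ _) (sq_nonneg _))
  have hlin : ∀ j, ∫⁻ k, ENNReal.ofReal (min ‖κ k‖ R ^ j * ‖a k‖ ^ 2) ∂μ =
      ENNReal.ofReal (truncEnergy μ κ R j a) := fun j =>
    (ofReal_integral_eq_lintegral_ofReal (ha.integrable_trunc hκ hR j)
      (Eventually.of_forall fun k => mul_nonneg (trunc_nonneg hR _ _) (sq_nonneg _))).symm
  have hlinZ : ∫⁻ k, ENNReal.ofReal (‖κ k‖ ^ 2 * (min ‖κ k‖ R ^ n * ‖a k‖ ^ 2)) ∂μ =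
      ENNReal.ofReal Z :=
    (ofReal_integral_eq_lintegral_ofReal (ha.integrable_dissipation hκ hR n)
      (Eventually.of_forall fun k => mul_nonneg (sq_nonneg _)
        (mul_nonneg (trunc_nonneg hR _ _) (sq_nonneg _)))).symm
  have hN : |2 * (∫ z, transportIntegrand κ a (fun k => (w k : ℂ) • a k) z ∂(μ.prod μ)).re| ≤
      4 * √C * √(Y₃ * Y * (A * Z)) := by
    rw [two_mul_re_integral_transportIntegrand hκ ha hB hwm (M := R ^ n) fun k => by
      rw [abs_of_nonneg (trunc_nonneg hR _ _)]; exact trunc_le hR _ _]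
    rw [← ENNReal.ofReal_le_ofReal_iff (by positivity), ← Real.norm_eq_abs, ofReal_norm]
    refine (enorm_integral_le_lintegral_enorm _).trans (le_trans (lintegral_mono fun z => ?_)
      (lintegral_symmetrised_le μ hκ hA0 hA hm.norm (fun k => norm_nonneg _) ha.norm_neg hR hn
        hY₃0 hY0 (hlin 3).le (hlin n).le hlinZ.le))
    rw [← ofReal_norm]
    apply ENNReal.ofReal_le_ofReal
    rw [norm_mul, Real.norm_eq_abs, Real.norm_eq_abs]
    gcongr
    refine (Complex.abs_re_le_norm _).trans ?_
    unfold transportIntegrand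
    rw [norm_mul, norm_mul, Complex.norm_I, one_mul]
    have h1 : ‖inner ℂ (a z.1) (cpx (κ z.2))‖ ≤ ‖a z.1‖ * min ‖κ z.2‖ ‖κ (z.2 - z.1)‖ := by
      rw [mul_min_of_nonneg _ _ (norm_nonneg _)]
      refine le_min ?_ ?_
      · simpa using norm_inner_le_norm (𝕜 := ℂ) (a z.1) (cpx (κ z.2))
      · rw [ha.inner_eq]
        simpa using norm_inner_le_norm (𝕜 := ℂ) (a z.1) (cpx (κ (z.2 - z.1)))
    calc _ ≤ (‖a z.1‖ * min ‖κ z.2‖ ‖κ (z.2 - z.1)‖) * (‖a (z.2 - z.1)‖ * ‖a z.2‖) := by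
          gcongr
          exact norm_inner_le_norm _ _
      _ = _ := by ring
  -- The factor `|κ|²` of the dissipation is not truncated, so it matches the factor `|r|²` left by
  -- the trilinear estimate.
  have hV : ∫ k, ((‖κ k‖ ^ 2 : ℝ) : ℂ) * inner ℂ (a k) ((w k : ℂ) • a k) ∂μ = (Z : ℂ) := by
    rw [hZ, ← integral_complex_ofReal]
    refine integral_congr_ae (Eventually.of_forall fun k => ?_)
    have h2 : inner ℂ (a k) (a k) = ((‖a k‖ ^ 2 : ℝ) : ℂ) := by
      rw [inner_self_eq_norm_sq_to_K]; push_cast; rfl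
    simp only [inner_smul_right, h2, hw]
    push_cast
    ring
  have hmain : 2 * (weakRHS μ κ ν a fun k => (w k : ℂ) • a k).re ≤
      4 * √C * √(Y₃ * Y * (A * Z)) - 2 * ν * Z := by
    rw [weakRHS, hV, ← Complex.ofReal_mul, Complex.sub_re, Complex.ofReal_re]
    have := (le_abs_self _).trans hN
    linarith
  refine hmain.trans ?_
  have hsq : √(Y₃ * Y * (A * Z)) = √(A * (Y₃ * Y)) * √Z := by
    rw [← Real.sqrt_mul (by positivity)]
    congr 1
    ring
  have h3 : √C ^ 2 = C := Real.sq_sqrt (by positivity)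
  have h4 : √(A * (Y₃ * Y)) ^ 2 = A * (Y₃ * Y) := Real.sq_sqrt (by positivity)
  have h5 : √Z ^ 2 = Z := Real.sq_sqrt hZ0
  rw [hsq]
  have h6 : 2 * C * A / ν * (Y₃ * Y) = 2 * (√C * √(A * (Y₃ * Y))) ^ 2 / ν := by
    rw [mul_pow, h3, h4]; ring
  rw [h6]
  set q := √C * √(A * (Y₃ * Y))
  have h7 : 4 * √C * (√(A * (Y₃ * Y)) * √Z) - 2 * ν * Z = 4 * q * √Z - 2 * ν * √Z ^ 2 := by
    rw [h5]; ring
  rw [h7, le_div_iff₀ hν]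
  -- Completing the square: `4q√Z - 2νZ = 2q²/ν - (2/ν)(q - ν√Z)²`.
  nlinarith [sq_nonneg (q - ν * √Z)]

end NavierStokes

namespace NavierStokes

/-! ### Comparison lemmas for differential inequalities. -/

section Comparison

/-- The function `-(y + ε)⁻¹ - B r` is nonincreasing; the shift by `ε` allows `y` to vanish. The
derivative is required only in the open interval, which is essential when `s` is the initial time.
The bound involves only `δ`, and so will be uniform in the truncation. -/
theorem riccati_bound {y y' : ℝ → ℝ} {s t B ε q δ : ℝ} (hst : s ≤ t)
    (hc : ContinuousOn y (Icc s t)) (hd : ∀ r ∈ Ioo s t, HasDerivAt y (y' r) r)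
    (hy0 : ∀ r ∈ Icc s t, 0 ≤ y r) (hy' : ∀ r ∈ Ioo s t, y' r ≤ B * (y r * y r)) (hB : 0 ≤ B)
    (hε : 0 < ε) (hq : y s + ε ≤ q) (hδ : 0 < δ) (hqδ : δ ≤ q⁻¹ - B * (t - s)) :
    y t ≤ δ⁻¹ := by
  set h : ℝ → ℝ := fun r => -(y r + ε)⁻¹ - B * r with hh
  have hpos : ∀ r ∈ Icc s t, 0 < y r + ε := fun r hr => by linarith [hy0 r hr]
  have hanti : AntitoneOn h (Icc s t) := by
    refine antitoneOn_of_hasDerivWithinAt_nonpos (convex_Icc s t)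
      (f' := fun r => y' r / (y r + ε) ^ 2 - B) ?_ ?_ ?_
    · exact ((((hc.add continuousOn_const).inv₀ fun r hr => (hpos r hr).ne').neg).sub
        (by fun_prop))
    · intro r hr
      rw [interior_Icc] at hr
      have h1 := ((hd r hr).add_const ε).fun_inv (hpos r (Ioo_subset_Icc_self hr)).ne'
      have h2 := (h1.fun_neg).fun_sub ((hasDerivAt_id r).const_mul B)
      refine HasDerivAt.hasDerivWithinAt ?_
      convert! h2 using 1
      simp only [mul_one]
      ring
    · intro r hr
      rw [interior_Icc] at hr
      have h0 := hy0 r (Ioo_subset_Icc_self hr)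
      have h1 := hpos r (Ioo_subset_Icc_self hr)
      rw [sub_nonpos, div_le_iff₀ (by positivity)]
      refine (hy' r hr).trans ?_
      gcongr
      nlinarith
  have h1 := hanti (left_mem_Icc.2 hst) (right_mem_Icc.2 hst) hst
  have h2 : q⁻¹ ≤ (y s + ε)⁻¹ := inv_anti₀ (hpos s (left_mem_Icc.2 hst)) hq
  have h3 : δ ≤ (y t + ε)⁻¹ := by
    simp only [hh] at h1
    linarith
  have h4 := hpos t (right_mem_Icc.2 hst)
  have h5 : y t + ε ≤ δ⁻¹ := by
    rw [le_inv_comm₀ h4 hδ]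
    exact h3
  linarith

/-- Grönwall's inequality, by the integrating factor `exp(-k r)`. -/
theorem exponential_bound {y y' : ℝ → ℝ} {s t k : ℝ} (hst : s ≤ t)
    (hd : ∀ r ∈ Icc s t, HasDerivAt y (y' r) r) (hy' : ∀ r ∈ Icc s t, y' r ≤ k * y r) :
    y t ≤ y s * Real.exp (k * (t - s)) := by
  have hderiv : ∀ r ∈ Icc s t, HasDerivAt (fun r => y r * Real.exp (-(k * r)))
      (y' r * Real.exp (-(k * r)) + y r * (Real.exp (-(k * r)) * -(k * 1))) r := fun r hr =>
    (hd r hr).fun_mul (((hasDerivAt_id r).const_mul k).fun_neg.exp)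
  have hanti : AntitoneOn (fun r => y r * Real.exp (-(k * r))) (Icc s t) := by
    refine antitoneOn_of_hasDerivWithinAt_nonpos (convex_Icc s t)
      (fun r hr => (hderiv r hr).continuousAt.continuousWithinAt)
      (fun r hr => (hderiv r (interior_subset hr)).hasDerivWithinAt) ?_
    intro r hr
    have h1 := hy' r (interior_subset hr)
    have h2 := Real.exp_pos (-(k * r))
    nlinarith
  have h1 := hanti (left_mem_Icc.2 hst) (right_mem_Icc.2 hst) hst
  simp only at h1
  have h2 : y t = y t * Real.exp (-(k * t)) * Real.exp (k * t) := by
    rw [mul_assoc, ← Real.exp_add]; simp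
  calc y t = y t * Real.exp (-(k * t)) * Real.exp (k * t) := h2
    _ ≤ y s * Real.exp (-(k * s)) * Real.exp (k * t) := by gcongr
    _ = _ := by rw [mul_assoc, ← Real.exp_add]; congr 2; ring

end Comparison

/-! ### Fourier multipliers on square integrable fields. -/

section Multiplier

variable {X : Type*} [MeasurableSpace X] {μ : Measure X}

/-- The element of `L²` defined by a square integrable function (and `0` otherwise). -/
noncomputable def toL2 (μ : Measure X) (f : X → C3) : Lp C3 2 μ :=
  open Classical in if h : MemLp f 2 μ then h.toLp f else 0

theorem coeFn_toL2 {f : X → C3} (hf : MemLp f 2 μ) : toL2 μ f =ᵐ[μ] f := by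
  rw [toL2, dif_pos hf]; exact hf.coeFn_toLp

theorem toL2_sub {f g : X → C3} (hf : MemLp f 2 μ) (hg : MemLp g 2 μ) :
    toL2 μ f - toL2 μ g = toL2 μ (f - g) := by
  rw [toL2, toL2, toL2, dif_pos hf, dif_pos hg, dif_pos (hf.sub hg), MemLp.toLp_sub]

theorem norm_toL2_sq {f : X → C3} (hf : MemLp f 2 μ) :
    ENNReal.ofReal (‖toL2 μ f‖ ^ 2) = ∫⁻ k, ‖f k‖ₑ ^ 2 ∂μ := by
  rw [← lintegral_enorm_sq_eq]
  refine lintegral_congr_ae ?_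
  filter_upwards [coeFn_toL2 hf] with k hk
  rw [hk]

theorem memLp_multiplier {w : X → ℝ} (hw : Measurable w) {M : ℝ} (hM : ∀ k, |w k| ≤ M)
    {f : X → C3} (hf : MemLp f 2 μ) : MemLp (fun k => (w k : ℂ) • f k) 2 μ := by
  refine hf.of_le_mul (c := M) ?_ (Eventually.of_forall fun k => ?_)
  · exact (by fun_prop : Measurable fun k => (w k : ℂ)).aestronglyMeasurable.smul
      hf.aestronglyMeasurable
  · rw [norm_smul, Complex.norm_real]
    gcongr
    exact hM k

/-- Multiplication by a bounded real function as an operator on `L²`. -/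
theorem exists_multiplier {w : X → ℝ} (hw : Measurable w) {M : ℝ}
    (hM : ∀ k, |w k| ≤ M) :
    ∃ P : Lp C3 2 μ →L[ℂ] Lp C3 2 μ, ∀ f : Lp C3 2 μ, P f =ᵐ[μ] fun k => (w k : ℂ) • f k := by
  have hmem : ∀ f : Lp C3 2 μ, MemLp (fun k => (w k : ℂ) • f k) 2 μ := fun f =>
    memLp_multiplier hw hM (Lp.memLp f)
  refine ⟨LinearMap.mkContinuous
    { toFun := fun f => (hmem f).toLp _
      map_add' := ?_
      map_smul' := ?_ } M ?_, fun f => (hmem f).coeFn_toLp⟩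
  · intro f g
    rw [← MemLp.toLp_add, MemLp.toLp_eq_toLp_iff]
    filter_upwards [Lp.coeFn_add f g] with k hk
    simp only [hk, Pi.add_apply, smul_add]
  · intro c f
    rw [RingHom.id_apply, ← MemLp.toLp_const_smul, MemLp.toLp_eq_toLp_iff]
    filter_upwards [Lp.coeFn_smul c f] with k hk
    simp only [hk, Pi.smul_apply]
    exact smul_comm _ _ _
  · intro f
    refine Lp.norm_le_mul_norm_of_ae_le_mul ?_
    filter_upwards [(hmem f).coeFn_toLp] with k hk
    simp only [LinearMap.coe_mk, AddHom.coe_mk]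
    rw [hk, norm_smul, Complex.norm_real]
    gcongr
    exact hM k

end Multiplier

/-! ### The evolution equation on the Fourier side. -/

variable {K : Type*} [AddCommGroup K] [MeasurableSpace K]

/-- Divergence-free square integrable fields on the Fourier side. -/
noncomputable def divFree (μ : Measure K) (κ : K →+ E3) : Submodule ℂ (Lp C3 2 μ) where
  carrier := {f | ∀ᵐ k ∂μ, inner ℂ (f k) (cpx (κ k)) = 0}
  zero_mem' := by
    filter_upwards [Lp.coeFn_zero C3 2 μ] with k hk
    rw [hk]; simp
  add_mem' := by
    intro f g hf hg
    change ∀ᵐ k ∂μ, _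
    filter_upwards [Lp.coeFn_add f g, hf, hg] with k hk h1 h2
    rw [hk, Pi.add_apply, inner_add_left, h1, h2, add_zero]
  smul_mem' := by
    intro c f hf
    change ∀ᵐ k ∂μ, _
    filter_upwards [Lp.coeFn_smul c f, hf] with k hk h1
    rw [hk, Pi.smul_apply, inner_smul_left, h1, mul_zero]

/-- A solution of the weak form of the Navier–Stokes equations on the Fourier side, tested against
a dense family `D` of divergence-free fields. -/
structure IsEvolution (μ : Measure K) (κ : K →+ E3) (ν T : ℝ) (D : Set (Lp C3 2 μ))
    (a : ℝ → K → C3) : Prop where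
  memLp : ∀ t ∈ Ico 0 T, MemLp (a t) 2 μ
  amplitude : ∀ t ∈ Ioo 0 T, IsAmplitude μ κ (a t)
  bounded : ∀ t ∈ Ioo 0 T, ∃ S : ℝ, ∀ᶠ s in 𝓝 t,
    ∫⁻ k, ENNReal.ofReal ((1 + ‖κ k‖ ^ 2) ^ 2) * ‖a s k‖ₑ ^ 2 ∂μ ≤ ENNReal.ofReal S
  continuousOn : ContinuousOn (fun t => toL2 μ (a t)) (Ico 0 T)
  weak : ∀ φ ∈ D, ∀ t ∈ Ioo 0 T,
    HasDerivAt (fun s => inner ℂ (toL2 μ (a s)) φ) (weakRHS μ κ ν (a t) φ) t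
  dense : ∀ f ∈ divFree μ κ, f ∈ closure (Submodule.span ℂ D : Set (Lp C3 2 μ))

variable {μ : Measure K} {κ : K →+ E3}

theorem weakRHS_congr [SFinite μ] {ν : ℝ} {a φ ψ : K → C3} (h : φ =ᵐ[μ] ψ) :
    weakRHS μ κ ν a φ = weakRHS μ κ ν a ψ := by
  unfold weakRHS
  congr 1
  · refine integral_congr_ae ?_
    filter_upwards [Measure.quasiMeasurePreserving_snd.ae h] with z hz
    simp only [transportIntegrand, hz]
  · congr 1
    refine integral_congr_ae ?_
    filter_upwards [h] with k hk
    rw [hk]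

theorem IsAmplitude.toL2_mem_divFree {a : K → C3} (ha : IsAmplitude μ κ a) :
    toL2 μ a ∈ divFree μ κ := by
  change ∀ᵐ k ∂μ, _
  filter_upwards [coeFn_toL2 ha.memLp] with k hk
  rw [hk, ha.inner_eq_zero]

/-- This presents a truncated energy as the quadratic form of a bounded operator, to which the
results on weakly differentiable curves apply. -/
theorem re_inner_multiplier {X : Type*} [MeasurableSpace X] {μ : Measure X} {w : X → ℝ}
    {P : Lp C3 2 μ →L[ℂ] Lp C3 2 μ}
    (hP : ∀ f : Lp C3 2 μ, P f =ᵐ[μ] fun k => (w k : ℂ) • f k) {a : X → C3}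
    (ha : MemLp a 2 μ) :
    (inner ℂ (toL2 μ a) (P (toL2 μ a))).re = ∫ k, w k * ‖a k‖ ^ 2 ∂μ := by
  rw [L2.inner_def, ← RCLike.re_to_complex, ← integral_re (L2.integrable_inner _ _)]
  refine integral_congr_ae ?_
  filter_upwards [hP (toL2 μ a), coeFn_toL2 ha] with k h1 h2
  have h3 : inner ℂ (a k) (a k) = ((‖a k‖ ^ 2 : ℝ) : ℂ) := by
    rw [inner_self_eq_norm_sq_to_K]; push_cast; rfl
  rw [h1, h2, inner_smul_right, h3, ← Complex.ofReal_mul, RCLike.re_to_complex, Complex.ofReal_re]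

namespace IsEvolution

variable {ν T : ℝ} {D : Set (Lp C3 2 μ)} {a : ℝ → K → C3}

/-- A bounded quadratic form is continuous along an `L²`-continuous curve. The initial time is
included, although the untruncated energy may be infinite there. -/
theorem continuousOn_truncEnergy (h : IsEvolution μ κ ν T D a) (hκ : Measurable κ) {R : ℝ}
    (hR : 0 < R) (n : ℕ) : ContinuousOn (fun s => truncEnergy μ κ R n (a s)) (Ico 0 T) := by
  have hw := measurable_trunc hκ R n
  have hM : ∀ k, |min ‖κ k‖ R ^ n| ≤ R ^ n := fun k => by
    rw [abs_of_nonneg (trunc_nonneg hR _ _)]; exact trunc_le hR _ _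
  obtain ⟨P, hP⟩ := exists_multiplier (μ := μ) hw hM
  have h1 : ContinuousOn (fun s => (inner ℂ (toL2 μ (a s)) (P (toL2 μ (a s)))).re) (Ico 0 T) :=
    Complex.continuous_re.comp_continuousOn
      (h.continuousOn.inner (P.continuous.comp_continuousOn h.continuousOn))
  exact h1.congr fun s hs => (re_inner_multiplier hP (h.memLp s hs)).symm

variable [MeasurableAdd₂ K] [MeasurableNeg K] [SFinite μ] [μ.IsAddLeftInvariant]

/-- The right-hand sides form a locally bounded family of functionals, so the weak equation passes
from the family `D` to the whole divergence-free space. In particular it may be tested with a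
multiplier applied to the solution itself. -/
theorem weak_divFree (h : IsEvolution μ κ ν T D a) (hκ : Measurable κ) (hν : 0 ≤ ν)
    {B : ℝ} (hB0 : 0 ≤ B)
    (hB : ∫⁻ k, ENNReal.ofReal (((1 + ‖κ k‖ ^ 2) ^ 2)⁻¹) ∂μ ≤ ENNReal.ofReal B) :
    ∃ L : ℝ → Lp C3 2 μ →L[ℂ] ℂ,
      (∀ t ∈ Ioo 0 T, ∀ φ : Lp C3 2 μ, L t φ = weakRHS μ κ ν (a t) φ) ∧
      (∀ t ∈ Ioo 0 T, ∀ S : ℝ, 0 ≤ S →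
        ∫⁻ k, ENNReal.ofReal ((1 + ‖κ k‖ ^ 2) ^ 2) * ‖a t k‖ₑ ^ 2 ∂μ ≤ ENNReal.ofReal S →
          ‖L t‖ ≤ √B * S + ν * √S) ∧
      (∀ t ∈ Ioo 0 T, ∃ C, ∀ᶠ s in 𝓝 t, ‖L s‖ ≤ C) ∧
      ∀ φ ∈ divFree μ κ, ∀ t ∈ Ioo 0 T,
        HasDerivAt (fun s => inner ℂ (toL2 μ (a s)) φ) (L t φ) t := by
  have hex : ∀ t : ℝ, ∃ L : Lp C3 2 μ →L[ℂ] ℂ, t ∈ Ioo 0 T →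
      (∀ φ : Lp C3 2 μ, L φ = weakRHS μ κ ν (a t) φ) ∧
      ∀ S : ℝ, 0 ≤ S →
        ∫⁻ k, ENNReal.ofReal ((1 + ‖κ k‖ ^ 2) ^ 2) * ‖a t k‖ₑ ^ 2 ∂μ ≤ ENNReal.ofReal S →
          ‖L‖ ≤ √B * S + ν * √S := by
    intro t
    by_cases ht : t ∈ Ioo 0 T
    · have ha := h.amplitude t ht
      set I := ∫⁻ k, ENNReal.ofReal ((1 + ‖κ k‖ ^ 2) ^ 2) * ‖a t k‖ₑ ^ 2 ∂μ
      have hI : I ≠ ⊤ := (ha.sobolev 2).ne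
      obtain ⟨L, hL, hL2⟩ := exists_weakRHS_functional hκ ha hB0
        (ENNReal.toReal_nonneg (a := I)) hν hB (ENNReal.ofReal_toReal hI).ge
      refine ⟨L, fun _ => ⟨hL, fun S hS0 hS => hL2.trans ?_⟩⟩
      have : I.toReal ≤ S := ENNReal.toReal_le_of_le_ofReal hS0 hS
      gcongr
    · exact ⟨0, fun h => absurd h ht⟩
  choose L hL using hex
  have hLb : ∀ t ∈ Ioo 0 T, ∃ C, ∀ᶠ s in 𝓝 t, ‖L s‖ ≤ C := by
    intro t ht
    obtain ⟨S, hS⟩ := h.bounded t ht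
    refine ⟨√B * |S| + ν * √|S|, ?_⟩
    filter_upwards [hS, Ioo_mem_nhds ht.1 ht.2] with s hs hs2
    exact (hL s hs2).2 _ (abs_nonneg S) (hs.trans (ENNReal.ofReal_le_ofReal (le_abs_self S)))
  refine ⟨L, fun t ht => (hL t ht).1, fun t ht => (hL t ht).2, hLb, fun φ hφ t ht => ?_⟩
  refine hasDerivAt_inner_of_mem_closure_span isOpen_Ioo hLb ?_ (h.dense φ hφ) ht
  intro ψ hψ s hs
  rw [(hL s hs).1]
  exact h.weak ψ hψ s hs

theorem hasDerivAt_truncEnergy (h : IsEvolution μ κ ν T D a) (hκ : Measurable κ) (hν : 0 ≤ ν)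
    (hB : ∫⁻ k, ENNReal.ofReal (((1 + ‖κ k‖ ^ 2) ^ 2)⁻¹) ∂μ < ⊤) {R : ℝ} (hR : 0 < R) (n : ℕ)
    {t : ℝ} (ht : t ∈ Ioo 0 T) :
    HasDerivAt (fun s => truncEnergy μ κ R n (a s))
      (2 * (weakRHS μ κ ν (a t) fun k => ((min ‖κ k‖ R ^ n : ℝ) : ℂ) • a t k).re) t := by
  obtain ⟨L, hL, -, hLb, hweak⟩ := h.weak_divFree hκ hν ENNReal.toReal_nonneg
    (ENNReal.ofReal_toReal hB.ne).ge
  have hw := measurable_trunc hκ R n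
  have hM : ∀ k, |min ‖κ k‖ R ^ n| ≤ R ^ n := fun k => by
    rw [abs_of_nonneg (trunc_nonneg hR _ _)]; exact trunc_le hR _ _
  obtain ⟨P, hP⟩ := exists_multiplier (μ := μ) hw hM
  have hsymm : ∀ f g, inner ℂ (P f) g = inner ℂ f (P g) := by
    intro f g
    rw [L2.inner_def, L2.inner_def]
    refine integral_congr_ae ?_
    filter_upwards [hP f, hP g] with k h1 h2
    rw [h1, h2, inner_smul_left, inner_smul_right, Complex.conj_ofReal]
  -- A scalar multiplier acts by the same factor on all components, so the constraint is preserved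
  -- and `P` of the solution is an admissible test field.
  have hdiv : ∀ f ∈ divFree μ κ, P f ∈ divFree μ κ := by
    intro f hf
    change ∀ᵐ k ∂μ, _
    filter_upwards [hP f, hf] with k h1 h2
    rw [h1, inner_smul_left, h2, mul_zero]
  have h1 := hasDerivAt_re_inner_of_weak isOpen_Ioo hLb
    (fun s hs => (h.amplitude s hs).toL2_mem_divFree) hweak P hsymm hdiv ht
  have h2 : L t (P (toL2 μ (a t))) =
      weakRHS μ κ ν (a t) fun k => ((min ‖κ k‖ R ^ n : ℝ) : ℂ) • a t k := by
    rw [hL t ht]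
    refine weakRHS_congr ?_
    filter_upwards [hP (toL2 μ (a t)), coeFn_toL2 (h.amplitude t ht).memLp] with k h3 h4
    rw [h3, h4]
  rw [h2] at h1
  refine h1.congr_of_eventuallyEq ?_
  filter_upwards [Ioo_mem_nhds ht.1 ht.2] with s hs
  exact (re_inner_multiplier hP (h.memLp s (Ioo_subset_Ico_self hs))).symm

end IsEvolution

end NavierStokes

/-! ### A priori bounds up to the time `T`. -/

namespace NavierStokes

variable {K : Type*} [AddCommGroup K] [MeasurableSpace K] {μ : Measure K} {κ : K →+ E3}

theorem lintegral_trunc_eq {a : K → C3} (ha : MemLp a 2 μ) (hκ : Measurable κ) {R : ℝ}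
    (hR : 0 < R) (n : ℕ) :
    ∫⁻ k, ENNReal.ofReal (min ‖κ k‖ R ^ n) * ‖a k‖ₑ ^ 2 ∂μ =
      ENNReal.ofReal (truncEnergy μ κ R n a) := by
  have hint : Integrable (fun k => min ‖κ k‖ R ^ n * ‖a k‖ ^ 2) μ := by
    have h1 := (memLp_two_iff_integrable_sq_norm ha.aestronglyMeasurable).1 ha
    refine h1.bdd_mul (c := R ^ n) (measurable_trunc hκ R n).aestronglyMeasurable
      (Eventually.of_forall fun k => ?_)
    rw [Real.norm_of_nonneg (trunc_nonneg hR _ _)]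
    exact trunc_le hR _ _
  rw [truncEnergy, ofReal_integral_eq_lintegral_ofReal hint
    (Eventually.of_forall fun k => mul_nonneg (trunc_nonneg hR _ _) (sq_nonneg _))]
  refine lintegral_congr fun k => ?_
  rw [ENNReal.ofReal_mul (trunc_nonneg hR _ _), ← ofReal_norm, ENNReal.ofReal_pow (norm_nonneg _)]

theorem truncEnergy_le {a : K → C3} (ha : MemLp a 2 μ) (hκ : Measurable κ) {R : ℝ}
    (hR : 0 < R) (n : ℕ) {Y : ℝ} (hY0 : 0 ≤ Y)
    (hY : ∫⁻ k, ENNReal.ofReal (‖κ k‖ ^ n) * ‖a k‖ₑ ^ 2 ∂μ ≤ ENNReal.ofReal Y) :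
    truncEnergy μ κ R n a ≤ Y := by
  rw [← ENNReal.ofReal_le_ofReal_iff hY0, ← lintegral_trunc_eq ha hκ hR]
  refine (lintegral_mono fun k => ?_).trans hY
  gcongr
  exact min_le_left _ _

/-- Fatou's lemma along `R = j + 1`: at each frequency the truncation is eventually inactive. -/
theorem lintegral_le_of_truncEnergy_le {a : K → C3} (ha : Measurable a) (ha2 : MemLp a 2 μ)
    (hκ : Measurable κ) (n : ℕ) {Y : ℝ} (hY : ∀ R : ℝ, 0 < R → truncEnergy μ κ R n a ≤ Y) :
    ∫⁻ k, ENNReal.ofReal (‖κ k‖ ^ n) * ‖a k‖ₑ ^ 2 ∂μ ≤ ENNReal.ofReal Y := by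
  have hlim : ∀ k, Tendsto (fun j : ℕ =>
      ENNReal.ofReal (min ‖κ k‖ ((j : ℝ) + 1) ^ n) * ‖a k‖ₑ ^ 2) atTop
      (𝓝 (ENNReal.ofReal (‖κ k‖ ^ n) * ‖a k‖ₑ ^ 2)) := by
    intro k
    refine tendsto_const_nhds.congr' ?_
    filter_upwards [eventually_ge_atTop ⌈‖κ k‖⌉₊] with j hj
    have : ‖κ k‖ ≤ (j : ℝ) + 1 := (Nat.ceil_le.1 hj).trans (by linarith)
    rw [min_eq_left this]
  have hmeas : ∀ j : ℕ, Measurable fun k =>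
      ENNReal.ofReal (min ‖κ k‖ ((j : ℝ) + 1) ^ n) * ‖a k‖ₑ ^ 2 := fun j =>
    (measurable_trunc hκ _ n).ennreal_ofReal.mul (by fun_prop)
  calc ∫⁻ k, ENNReal.ofReal (‖κ k‖ ^ n) * ‖a k‖ₑ ^ 2 ∂μ
      = ∫⁻ k, liminf (fun j : ℕ =>
          ENNReal.ofReal (min ‖κ k‖ ((j : ℝ) + 1) ^ n) * ‖a k‖ₑ ^ 2) atTop ∂μ :=
        lintegral_congr fun k => (hlim k).liminf_eq.symm
    _ ≤ liminf (fun j : ℕ => ∫⁻ k,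
          ENNReal.ofReal (min ‖κ k‖ ((j : ℝ) + 1) ^ n) * ‖a k‖ₑ ^ 2 ∂μ) atTop :=
        lintegral_liminf_le hmeas
    _ ≤ liminf (fun _ : ℕ => ENNReal.ofReal Y) atTop := by
        refine liminf_le_liminf (Eventually.of_forall fun j => ?_)
        rw [lintegral_trunc_eq ha2 hκ (by positivity)]
        exact ENNReal.ofReal_le_ofReal (hY _ (by positivity))
    _ = _ := liminf_const _

theorem one_add_sq_pow_le (x : ℝ) (m : ℕ) : (1 + x ^ 2) ^ m ≤ 2 ^ m * (1 + x ^ (2 * m)) := by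
  have h0 : 0 ≤ x ^ (2 * m) := by rw [pow_mul]; positivity
  rcases le_total (x ^ 2) 1 with h | h
  · calc (1 + x ^ 2) ^ m ≤ 2 ^ m := by
          apply pow_le_pow_left₀ (by positivity); linarith
      _ ≤ _ := by nlinarith [pow_pos (two_pos (α := ℝ)) m]
  · calc (1 + x ^ 2) ^ m ≤ (2 * x ^ 2) ^ m := by
          apply pow_le_pow_left₀ (by positivity); linarith
      _ = 2 ^ m * x ^ (2 * m) := by rw [mul_pow, pow_mul]
      _ ≤ _ := by nlinarith [pow_pos (two_pos (α := ℝ)) m]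

theorem lintegral_sobolev_le {a : K → C3} (ha : Measurable a) (ha2 : MemLp a 2 μ)
    (hκ : Measurable κ) (m : ℕ) {Y₀ Y : ℝ} (h0 : ∀ R : ℝ, 0 < R → truncEnergy μ κ R 0 a ≤ Y₀)
    (hY : ∀ R : ℝ, 0 < R → truncEnergy μ κ R (2 * m) a ≤ Y) :
    ∫⁻ k, ENNReal.ofReal ((1 + ‖κ k‖ ^ 2) ^ m) * ‖a k‖ₑ ^ 2 ∂μ ≤
      ENNReal.ofReal (2 ^ m * (Y₀ + Y)) := by
  have h1 := lintegral_le_of_truncEnergy_le ha ha2 hκ 0 h0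
  have h2 := lintegral_le_of_truncEnergy_le ha ha2 hκ (2 * m) hY
  have hY₀0 : 0 ≤ Y₀ := (truncEnergy_nonneg one_pos 0).trans (h0 1 one_pos)
  have hY0 : 0 ≤ Y := (truncEnergy_nonneg one_pos (2 * m)).trans (hY 1 one_pos)
  calc ∫⁻ k, ENNReal.ofReal ((1 + ‖κ k‖ ^ 2) ^ m) * ‖a k‖ₑ ^ 2 ∂μ
      ≤ ∫⁻ k, ENNReal.ofReal (2 ^ m) * (ENNReal.ofReal (‖κ k‖ ^ 0) * ‖a k‖ₑ ^ 2 +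
          ENNReal.ofReal (‖κ k‖ ^ (2 * m)) * ‖a k‖ₑ ^ 2) ∂μ := by
        refine lintegral_mono fun k => ?_
        rw [← add_mul, ← mul_assoc, pow_zero, ← ENNReal.ofReal_add (by positivity) (by positivity),
          ← ENNReal.ofReal_mul (by positivity)]
        gcongr
        exact one_add_sq_pow_le _ _
    _ = ENNReal.ofReal (2 ^ m) * (∫⁻ k, ENNReal.ofReal (‖κ k‖ ^ 0) * ‖a k‖ₑ ^ 2 ∂μ +
          ∫⁻ k, ENNReal.ofReal (‖κ k‖ ^ (2 * m)) * ‖a k‖ₑ ^ 2 ∂μ) := by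
        rw [lintegral_const_mul _ (by fun_prop), lintegral_add_left (by fun_prop)]
    _ ≤ ENNReal.ofReal (2 ^ m) * (ENNReal.ofReal Y₀ + ENNReal.ofReal Y) := by gcongr
    _ = _ := by
        rw [← ENNReal.ofReal_add hY₀0 hY0, ← ENNReal.ofReal_mul (by positivity)]

namespace IsEvolution

variable [MeasurableAdd₂ K] [MeasurableNeg K] [SFinite μ] [μ.IsAddLeftInvariant]
  [μ.IsNegInvariant] {ν T : ℝ} {D : Set (Lp C3 2 μ)} {a : ℝ → K → C3}

/-- If the `Ḣ^{3/2}` norm at the time `t₀` is small compared with the distance to the time `T`, its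
truncations stay bounded up to `T`. -/
theorem exists_bound_truncEnergy_three (h : IsEvolution μ κ ν T D a) (hκ : Measurable κ)
    (hν : 0 < ν) (hB : ∫⁻ k, ENNReal.ofReal (((1 + ‖κ k‖ ^ 2) ^ 2)⁻¹) ∂μ < ⊤)
    {A : ℝ} (hA0 : 0 < A)
    (hA : ∀ r : ℝ, 0 ≤ r → ∫⁻ p in {p | ‖κ p‖ ≤ r}, ENNReal.ofReal ‖κ p‖⁻¹ ∂μ
      ≤ ENNReal.ofReal (A * r ^ 2)) {t₀ : ℝ} (ht₀ : t₀ ∈ Ico 0 T)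
    (hsmall : ∫⁻ k, ENNReal.ofReal (‖κ k‖ ^ 3) * ‖a t₀ k‖ₑ ^ 2 ∂μ <
      ENNReal.ofReal (ν / (36 * A * (T - t₀)))) :
    ∃ M : ℝ, 0 ≤ M ∧ ∀ R : ℝ, 0 < R → ∀ t ∈ Ico t₀ T, truncEnergy μ κ R 3 (a t) ≤ M := by
  have hT : 0 < T - t₀ := sub_pos.2 ht₀.2
  -- For `n = 3` the constant of the energy inequality is `2 · 3² · 2 · A / ν`.
  set b : ℝ := 36 * A / ν with hb
  have hb0 : 0 < b := by positivity
  set I := ∫⁻ k, ENNReal.ofReal (‖κ k‖ ^ 3) * ‖a t₀ k‖ₑ ^ 2 ∂μ with hI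
  have hItop : I ≠ ⊤ := ne_top_of_lt hsmall
  have hI1 : I.toReal < (b * (T - t₀))⁻¹ := by
    have h1 := (ENNReal.lt_ofReal_iff_toReal_lt hItop).1 hsmall
    refine h1.trans_eq ?_
    rw [hb]; field_simp
  -- The strict inequality leaves room for `ε = q - I`, while `q⁻¹` still exceeds `b (T - t₀)`.
  -- Neither `q` nor `δ` depends on `R`.
  obtain ⟨q, hq1, hq2⟩ := exists_between hI1
  have hq0 : 0 < q := ENNReal.toReal_nonneg.trans_lt hq1
  set δ : ℝ := q⁻¹ - b * (T - t₀) with hδ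
  have hδ0 : 0 < δ := by
    rw [hδ, sub_pos, lt_inv_comm₀ (by positivity) hq0]
    exact hq2
  refine ⟨δ⁻¹, by positivity, fun R hR t ht => ?_⟩
  refine riccati_bound (ε := q - I.toReal) (q := q) (B := b)
    (y' := fun s => 2 * (weakRHS μ κ ν (a s) fun k => ((min ‖κ k‖ R ^ 3 : ℝ) : ℂ) • a s k).re)
    (y := fun s => truncEnergy μ κ R 3 (a s)) ht.1
    ((h.continuousOn_truncEnergy hκ hR 3).mono fun s hs => ⟨ht₀.1.trans hs.1, hs.2.trans_lt ht.2⟩)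
    (fun s hs => h.hasDerivAt_truncEnergy hκ hν.le hB hR 3
      ⟨ht₀.1.trans_lt hs.1, hs.2.trans ht.2⟩)
    (fun s _ => truncEnergy_nonneg hR 3) (fun s hs => ?_) hb0.le (sub_pos.2 hq1) ?_ hδ0 ?_
  · refine (two_mul_re_weakRHS_le hκ (h.amplitude s ⟨ht₀.1.trans_lt hs.1, hs.2.trans ht.2⟩) hB
      hA0.le hA hν hR (by norm_num)).trans_eq ?_
    rw [hb]; norm_num
  · have := truncEnergy_le (h.memLp t₀ ht₀) hκ hR 3 ENNReal.toReal_nonneg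
      (ENNReal.ofReal_toReal hItop).ge
    linarith
  · rw [hδ]
    have := ht.2
    gcongr

/-- Regularity up to the time `T` in all Sobolev norms. -/
theorem exists_bounds (h : IsEvolution μ κ ν T D a) (hκ : Measurable κ)
    (hν : 0 < ν) (hB : ∫⁻ k, ENNReal.ofReal (((1 + ‖κ k‖ ^ 2) ^ 2)⁻¹) ∂μ < ⊤)
    {A : ℝ} (hA0 : 0 < A)
    (hA : ∀ r : ℝ, 0 ≤ r → ∫⁻ p in {p | ‖κ p‖ ≤ r}, ENNReal.ofReal ‖κ p‖⁻¹ ∂μ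
      ≤ ENNReal.ofReal (A * r ^ 2)) {t₀ : ℝ} (ht₀ : t₀ ∈ Ico 0 T)
    (hsmall : ∫⁻ k, ENNReal.ofReal (‖κ k‖ ^ 3) * ‖a t₀ k‖ₑ ^ 2 ∂μ <
      ENNReal.ofReal (ν / (36 * A * (T - t₀)))) :
    ∃ t₁ ∈ Ioo 0 T,
      (∀ m : ℕ, ∃ S : ℝ, ∀ t ∈ Ioo t₁ T,
        ∫⁻ k, ENNReal.ofReal ((1 + ‖κ k‖ ^ 2) ^ m) * ‖a t k‖ₑ ^ 2 ∂μ ≤ ENNReal.ofReal S) ∧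
      ∃ C : ℝ, ∀ s ∈ Ioo t₁ T, ∀ t ∈ Ioo t₁ T,
        ‖toL2 μ (a s) - toL2 μ (a t)‖ ≤ C * |s - t| := by
  obtain ⟨M, hM0, hM⟩ := h.exists_bound_truncEnergy_three hκ hν hB hA0 hA ht₀ hsmall
  -- The time `t₀` may be `0`, where higher norms can be infinite; at the later time `t₁` all
  -- Sobolev norms are finite.
  obtain ⟨t₁, ht₁, ht₁T⟩ := exists_between ht₀.2
  have ht₁0 : 0 < t₁ := ht₀.1.trans_lt ht₁
  have hmem : ∀ t ∈ Ico t₁ T, t ∈ Ioo 0 T := fun t ht => ⟨ht₁0.trans_le ht.1, ht.2⟩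
  have hbound : ∀ m : ℕ, ∃ Y : ℝ, ∀ R : ℝ, 0 < R → ∀ t ∈ Ico t₁ T,
      truncEnergy μ κ R (2 * m) (a t) ≤ Y := by
    intro m
    set n := 2 * m with hn
    have hamp := h.amplitude t₁ ⟨ht₁0, ht₁T⟩
    set C : ℝ := (n : ℝ) ^ 2 * 2 ^ (n - 2) with hC
    set k₀ : ℝ := 2 * C * A / ν * M with hk₀
    have hk₀0 : 0 ≤ k₀ := by positivity
    -- The full norm at `t₁` dominates all truncated ones, so the Grönwall bound does not depend on
    -- `R`.
    set Y₁ : ℝ := ∫ k, ‖κ k‖ ^ n * ‖a t₁ k‖ ^ 2 ∂μ with hY₁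
    have hint : Integrable (fun k => ‖κ k‖ ^ n * ‖a t₁ k‖ ^ 2) μ :=
      hamp.integrable_mul_sq (hκ.norm.pow_const n) (C := 1) (m := m) fun k => by
        rw [abs_of_nonneg (by positivity), hn, pow_mul, one_mul]
        gcongr
        linarith
    have hY₁0 : 0 ≤ Y₁ := integral_nonneg fun k => by positivity
    refine ⟨Y₁ * Real.exp (k₀ * (T - t₁)), fun R hR t ht => ?_⟩
    have h1 := exponential_bound (k := k₀) (y := fun s => truncEnergy μ κ R n (a s)) ht.1
      (y' := fun s => 2 * (weakRHS μ κ ν (a s) fun k => ((min ‖κ k‖ R ^ n : ℝ) : ℂ) • a s k).re)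
      (fun s hs => h.hasDerivAt_truncEnergy hκ hν.le hB hR n (hmem s ⟨hs.1, hs.2.trans_lt ht.2⟩))
      (fun s hs => by
        have hs' : s ∈ Ico t₁ T := ⟨hs.1, hs.2.trans_lt ht.2⟩
        refine (two_mul_re_weakRHS_le hκ (h.amplitude s (hmem s hs')) hB
          hA0.le hA hν hR (by omega)).trans ?_
        have h2 := hM R hR s ⟨ht₁.le.trans hs'.1, hs'.2⟩
        have h3 : 0 ≤ truncEnergy μ κ R n (a s) := truncEnergy_nonneg hR n
        calc _ ≤ 2 * C * A / ν * (M * truncEnergy μ κ R n (a s)) := by gcongr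
          _ = _ := by rw [hk₀]; ring)
    have h4 : truncEnergy μ κ R n (a t₁) ≤ Y₁ := by
      refine integral_mono (hamp.integrable_trunc hκ hR n) hint fun k => ?_
      simp only
      gcongr
      exact min_le_left _ _
    refine h1.trans ?_
    have := ht.2.le
    gcongr
  have hsob : ∀ m : ℕ, ∃ S : ℝ, ∀ t ∈ Ioo t₁ T,
      ∫⁻ k, ENNReal.ofReal ((1 + ‖κ k‖ ^ 2) ^ m) * ‖a t k‖ₑ ^ 2 ∂μ ≤ ENNReal.ofReal S := by
    intro m
    -- The case `n = 0` is the energy bound: there the growth rate `k₀` is zero.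
    obtain ⟨Y₀, hY₀⟩ := hbound 0
    obtain ⟨Y, hY⟩ := hbound m
    refine ⟨2 ^ m * (Y₀ + Y), fun t ht => ?_⟩
    have hamp := h.amplitude t (hmem t (Ioo_subset_Ico_self ht))
    exact lintegral_sobolev_le hamp.measurable hamp.memLp hκ m
      (fun R hR => hY₀ R hR t (Ioo_subset_Ico_self ht))
      (fun R hR => hY R hR t (Ioo_subset_Ico_self ht))
  refine ⟨t₁, ⟨ht₁0, ht₁T⟩, hsob, ?_⟩
  obtain ⟨L, -, hLS, -, hweak⟩ := h.weak_divFree hκ hν.le ENNReal.toReal_nonneg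
    (ENNReal.ofReal_toReal hB.ne).ge
  obtain ⟨S, hS⟩ := hsob 2
  have hmem' : ∀ t ∈ Ioo t₁ T, t ∈ Ioo 0 T := fun t ht => hmem t (Ioo_subset_Ico_self ht)
  refine ⟨_, fun s hs t ht => norm_sub_le_of_weak_hasDerivAt (convex_Ioo t₁ T)
    (fun r hr => hLS r (hmem' r hr) |S| (abs_nonneg S)
      ((hS r hr).trans (ENNReal.ofReal_le_ofReal (le_abs_self S))))
    (fun r hr => (h.amplitude r (hmem' r hr)).toL2_mem_divFree)
    (fun φ hφ r hr => hweak φ hφ r (hmem' r hr)) hs ht⟩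

end IsEvolution

end NavierStokes

/-! ### Test functions and integration by parts on both domains. -/

namespace NavierStokes

/-- The partial derivative in the `i`-th coordinate direction. -/
noncomputable def pd {F : Type*} [NormedAddCommGroup F] [NormedSpace ℝ F] (i : Fin 3) (f : E3 → F)
    (x : E3) : F :=
  fderiv ℝ f x (EuclideanSpace.single i 1)

section PartialDerivative

variable {F : Type*} [NormedAddCommGroup F] [NormedSpace ℝ F] {f g : E3 → F} {i : Fin 3}

theorem contDiff_pd (hf : ContDiff ℝ ∞ f) (i : Fin 3) : ContDiff ℝ ∞ (pd i f) :=
  (hf.fderiv_right (m := ∞) (by simp)).clm_apply contDiff_const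

theorem pd_mul {f g : E3 → ℂ} (hf : ContDiff ℝ ∞ f) (hg : ContDiff ℝ ∞ g) (i : Fin 3) (x : E3) :
    pd i (fun x => f x * g x) x = pd i f x * g x + f x * pd i g x := by
  unfold pd
  rw [fderiv_fun_mul (hf.differentiable (by simp) x) (hg.differentiable (by simp) x)]
  simp only [add_apply, smul_apply, smul_eq_mul]
  ring

theorem pd_clm_comp {G : Type*} [NormedAddCommGroup G] [NormedSpace ℝ G] (l : F →L[ℝ] G)
    (hf : ContDiff ℝ ∞ f) (i : Fin 3) (x : E3) : pd i (fun x => l (f x)) x = l (pd i f x) := by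
  unfold pd
  have h := ((l.hasFDerivAt).comp x (hf.differentiable (by simp) x).hasFDerivAt).fderiv
  exact congrArg (fun L => L (EuclideanSpace.single i 1)) h

theorem pd_periodic (hf : IsFieldOn Domain.torus f) (i : Fin 3) :
    IsFieldOn Domain.torus (pd i f) := by
  intro j x
  unfold pd
  rw [← fderiv_comp_add_right]
  have h : (fun y => f (y + EuclideanSpace.single j (2 * Real.pi))) = f := funext (hf j)
  rw [h]

end PartialDerivative

instance instIsFiniteMeasureOnCompactsVol (Ω : Domain) : IsFiniteMeasureOnCompacts (vol Ω) := by
  cases Ω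
  · change IsFiniteMeasureOnCompacts (volume : Measure E3)
    infer_instance
  · change IsFiniteMeasureOnCompacts ((volume : Measure E3).restrict box)
    infer_instance

theorem measurableSet_box : MeasurableSet box := by
  have : box = ⋂ i : Fin 3, (fun x : E3 => x i) ⁻¹' Ioc (0 : ℝ) (2 * Real.pi) := by
    ext x; simp [box]
  rw [this]
  refine MeasurableSet.iInter fun i => ?_
  have h : Measurable fun x : E3 => x i := by fun_prop
  exact h measurableSet_Ioc

theorem exists_isCompact_box : ∃ Q : Set E3, IsCompact Q ∧ box ⊆ Q := by
  refine ⟨Metric.closedBall 0 (√3 * (2 * Real.pi)), isCompact_closedBall _ _, fun x hx => ?_⟩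
  rw [mem_closedBall_zero_iff, EuclideanSpace.norm_eq]
  have h2 : (0 : ℝ) ≤ 2 * Real.pi := by positivity
  rw [← Real.sqrt_sq h2, ← Real.sqrt_mul (by norm_num)]
  apply Real.sqrt_le_sqrt
  calc ∑ i, ‖x i‖ ^ 2 ≤ ∑ _i : Fin 3, (2 * Real.pi) ^ 2 := by
        refine Finset.sum_le_sum fun i _ => ?_
        have := hx i
        rw [Real.norm_of_nonneg this.1.le]
        exact pow_le_pow_left₀ this.1.le this.2 2
    _ = _ := by simp

/-- Smooth test functions on the domain: compactly supported on the whole space, periodic on the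
torus. -/
structure IsTest (Ω : Domain) (φ : E3 → ℂ) : Prop where
  contDiff : ContDiff ℝ ∞ φ
  field : IsFieldOn Ω φ
  compact : Ω = Domain.space → HasCompactSupport φ

namespace IsTest

variable {Ω : Domain} {φ ψ : E3 → ℂ}

theorem mul_left (hφ : IsTest Ω φ) {f : E3 → ℂ} (hf : ContDiff ℝ ∞ f) (hfΩ : IsFieldOn Ω f) :
    IsTest Ω fun x => f x * φ x where
  contDiff := hf.mul hφ.contDiff
  field := by
    cases Ω
    · trivial
    · intro i x
      simp only [hfΩ i x, hφ.field i x]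
  compact h := (hφ.compact h).mul_left

theorem pd (hφ : IsTest Ω φ) (i : Fin 3) : IsTest Ω (pd i φ) where
  contDiff := contDiff_pd hφ.contDiff i
  field := by
    cases Ω
    · trivial
    · exact pd_periodic hφ.field i
  compact h := (hφ.compact h).fderiv_apply (𝕜 := ℝ) _

/-- On the torus the measure lives on one period cell, so any compact set containing the cell works
and the condition off it holds vacuously almost everywhere. -/
theorem exists_isCompact (hφ : IsTest Ω φ) :
    ∃ Q : Set E3, IsCompact Q ∧ ∀ᵐ x ∂(vol Ω), x ∉ Q → φ x = 0 := by
  cases Ω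
  · exact ⟨tsupport φ, hφ.compact rfl,
      Eventually.of_forall fun x hx => image_eq_zero_of_notMem_tsupport hx⟩
  · obtain ⟨Q, hQ, hsub⟩ := exists_isCompact_box
    refine ⟨Q, hQ, ?_⟩
    filter_upwards [ae_restrict_mem measurableSet_box] with x hx hxQ
    exact absurd (hsub hx) hxQ

theorem integrable_mul (hφ : IsTest Ω φ) {f : E3 → ℂ} (hf : Continuous f) :
    Integrable (fun x => f x * φ x) (vol Ω) := by
  obtain ⟨Q, hQ, h0⟩ := hφ.exists_isCompact
  have h1 : IntegrableOn (fun x => f x * φ x) Q (vol Ω) :=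
    (hf.mul hφ.contDiff.continuous).continuousOn.integrableOn_compact hQ
  refine h1.integrable_of_ae_notMem_eq_zero ?_
  filter_upwards [h0] with x hx hxQ
  rw [hx hxQ, mul_zero]

theorem integrable (hφ : IsTest Ω φ) : Integrable φ (vol Ω) := by
  simpa using hφ.integrable_mul (f := fun _ => 1) continuous_const

theorem memLp_two (hφ : IsTest Ω φ) : MemLp φ 2 (vol Ω) := by
  rw [memLp_two_iff_integrable_sq_norm hφ.contDiff.continuous.aestronglyMeasurable]
  have := (hφ.integrable_mul (f := fun x => (starRingEnd ℂ) (φ x))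
    (Complex.continuous_conj.comp hφ.contDiff.continuous)).norm
  refine this.congr (Eventually.of_forall fun x => ?_)
  simp [pow_two]

end IsTest

theorem preimage_toLp_box :
    WithLp.toLp 2 ⁻¹' box = Set.pi univ fun _ : Fin 3 => Ioc (0 : ℝ) (2 * Real.pi) := by
  ext x; simp [box]

theorem integral_box_eq {F : Type*} [NormedAddCommGroup F] [NormedSpace ℝ F] (f : E3 → F) :
    ∫ x in box, f x =
      ∫ y in Set.pi univ fun _ : Fin 3 => Ioc (0 : ℝ) (2 * Real.pi), f (WithLp.toLp 2 y) := by
  rw [← preimage_toLp_box]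
  exact ((PiLp.volume_preserving_toLp (Fin 3)).setIntegral_preimage_emb
    (MeasurableEquiv.toLp 2 (Fin 3 → ℝ)).measurableEmbedding f box).symm

/-- On the whole space this is integration by parts against the constant `1`. On the torus it is the
divergence theorem on the period cell, where opposite faces cancel. -/
theorem integral_pd_eq_zero {Ω : Domain} {φ : E3 → ℂ} (hφ : IsTest Ω φ) (i : Fin 3) :
    ∫ x, pd i φ x ∂(vol Ω) = 0 := by
  cases Ω
  · change ∫ x, fderiv ℝ φ x (EuclideanSpace.single i 1) = 0
    have hi1 : Integrable φ (volume : Measure E3) := hφ.integrable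
    have hi2 : Integrable (fun x => fderiv ℝ φ x (EuclideanSpace.single i 1))
      (volume : Measure E3) := (hφ.pd i).integrable
    have h1 := integral_mul_fderiv_eq_neg_fderiv_mul_of_integrable (μ := (volume : Measure E3))
      (f := fun _ : E3 => (1 : ℂ)) (g := φ) (v := EuclideanSpace.single i 1)
      (by simp) (by simpa using hi2) (by simpa using hi1)
      (fun _ _ => by fun_prop) (fun x _ => hφ.contDiff.differentiable (by simp) x)
    simpa using h1
  · change ∫ x in box, pd i φ x = 0
    rw [integral_box_eq, volume_pi, setIntegral_congr_set Measure.univ_pi_Ioc_ae_eq_Icc,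
      ← volume_pi]
    set L := (EuclideanSpace.equiv (Fin 3) ℝ).symm with hL
    have hLx : ∀ y, L y = WithLp.toLp 2 y := fun y => rfl
    -- The vector field with `φ` as its only nonzero component, in the direction `i`: its divergence
    -- is the derivative to be integrated.
    set G : Fin 3 → (Fin 3 → ℝ) → ℂ := fun j y => if j = i then φ (L y) else 0 with hG
    set G' : Fin 3 → (Fin 3 → ℝ) → (Fin 3 → ℝ) →L[ℝ] ℂ := fun j y =>
      if j = i then (fderiv ℝ φ (L y)).comp (L : (Fin 3 → ℝ) →L[ℝ] E3) else 0 with hG'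
    have hderiv : ∀ j y, HasFDerivAt (G j) (G' j y) y := by
      intro j y
      by_cases h : j = i
      · simp only [hG, hG', h, if_true]
        exact (hφ.contDiff.differentiable (by simp) (L y)).hasFDerivAt.comp y
          (L : (Fin 3 → ℝ) →L[ℝ] E3).hasFDerivAt
      · simp only [hG, hG', h, if_false]
        exact hasFDerivAt_const _ _
    have hsum : ∀ y, ∑ j, G' j y (Pi.single j 1) = pd i φ (WithLp.toLp 2 y) := by
      intro y
      rw [Finset.sum_eq_single i]
      · simp only [hG', if_true, pd]
        rfl
      · intro j _ hj; simp [hG', hj]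
      · simp
    have hcont : Continuous fun y : Fin 3 → ℝ => pd i φ (WithLp.toLp 2 y) :=
      (contDiff_pd hφ.contDiff i).continuous.comp (L : (Fin 3 → ℝ) →L[ℝ] E3).continuous
    have h1 := integral_divergence_of_hasFDerivAt_off_countable' (E := ℂ)
      (fun _ : Fin 3 => (0 : ℝ)) (fun _ => 2 * Real.pi)
      (fun _ => by positivity) G G' ∅ countable_empty
      (fun j y _ => (hderiv j y).continuousAt.continuousWithinAt)
      (fun y _ j => hderiv j y) (by
        simp only [hsum]
        exact hcont.continuousOn.integrableOn_compact isCompact_Icc)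
    simp only [hsum] at h1
    rw [h1]
    refine Finset.sum_eq_zero fun j _ => ?_
    rw [sub_eq_zero]
    refine integral_congr_ae (Eventually.of_forall fun y => ?_)
    by_cases h : j = i
    · subst h
      simp only [hG, if_true]
      -- Periodicity identifies the values on the two faces orthogonal to the direction `j`.
      have := hφ.field j (L (j.insertNth (0 : ℝ) y))
      rw [← this]
      congr 1
      ext k
      simp only [hLx, PiLp.add_apply]
      rcases eq_or_ne k j with rfl | hk
      · simp
      · obtain ⟨l, rfl⟩ := Fin.exists_succAbove_eq hk
        simp
    · simp [hG, h]

/-- Integration by parts against a test function. -/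
theorem integral_pd_mul_eq_neg {Ω : Domain} {f φ : E3 → ℂ} (hf : ContDiff ℝ ∞ f)
    (hfΩ : IsFieldOn Ω f) (hφ : IsTest Ω φ) (i : Fin 3) :
    ∫ x, pd i f x * φ x ∂(vol Ω) = -∫ x, f x * pd i φ x ∂(vol Ω) := by
  have h1 := integral_pd_eq_zero (hφ.mul_left hf hfΩ) i
  simp only [pd_mul hf hφ.contDiff] at h1
  rw [integral_add (hφ.integrable_mul (contDiff_pd hf i).continuous)
    ((hφ.pd i).integrable_mul hf.continuous)] at h1
  exact eq_neg_of_add_eq_zero_left h1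

end NavierStokes

/-! ### The weak form of the equations in physical space. -/

namespace NavierStokes

/-- The `j`-th coordinate of a real vector, as a complex number. -/
noncomputable def coordC (j : Fin 3) : E3 →L[ℝ] ℂ :=
  Complex.ofRealCLM.comp (EuclideanSpace.proj j)

theorem coordC_apply (j : Fin 3) (x : E3) : coordC j x = ((x j : ℝ) : ℂ) := rfl

theorem contDiff_comp {v : E3 → E3} (hv : ContDiff ℝ ∞ v) (j : Fin 3) :
    ContDiff ℝ ∞ (comp v j) :=
  (coordC j).contDiff.comp hv

theorem isFieldOn_comp {Ω : Domain} {v : E3 → E3} (hv : IsFieldOn Ω v) (j : Fin 3) :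
    IsFieldOn Ω (comp v j) := by
  cases Ω
  · trivial
  · intro i x
    simp only [comp, hv i x]

theorem pd_comp {v : E3 → E3} (hv : ContDiff ℝ ∞ v) (i j : Fin 3) (x : E3) :
    pd i (comp v j) x = coordC j (pd i v x) :=
  pd_clm_comp (coordC j) hv i x

theorem sum_coord_smul_single (x : E3) : ∑ i, x i • EuclideanSpace.single i (1 : ℝ) = x := by
  ext j
  simp [Finset.sum_apply, Pi.single_apply]

theorem coordC_fderiv_apply {v : E3 → E3} (hv : ContDiff ℝ ∞ v) (j : Fin 3) (x w : E3) :
    coordC j (fderiv ℝ v x w) = ∑ i, ((w i : ℝ) : ℂ) * pd i (comp v j) x := by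
  conv_lhs => rw [← sum_coord_smul_single w]
  simp only [map_sum, map_smul, pd_comp hv]
  simp [pd]

theorem coordC_laplacian {v : E3 → E3} (hv : ContDiff ℝ ∞ v) (j : Fin 3) (x : E3) :
    coordC j (Laplacian.laplacian v x) = ∑ i, pd i (pd i (comp v j)) x := by
  rw [InnerProductSpace.laplacian_eq_iteratedFDeriv_orthonormalBasis v
    (EuclideanSpace.basisFun (Fin 3) ℝ)]
  simp only [map_sum]
  refine Finset.sum_congr rfl fun i _ => ?_
  have h1 : pd i (comp v j) = fun y => coordC j (pd i v y) := funext fun y => pd_comp hv i j y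
  rw [h1, pd_clm_comp (coordC j) (contDiff_pd hv i)]
  congr 1
  have h2 : DifferentiableAt ℝ (fderiv ℝ v) x :=
    (hv.fderiv_right (m := ∞) (by simp)).differentiable (by simp) x
  simp only [iteratedFDeriv_two_apply, EuclideanSpace.basisFun_apply, Matrix.cons_val_zero,
    Matrix.cons_val_one]
  unfold pd
  rw [fderiv_clm_apply h2 (differentiableAt_const _)]
  simp

theorem coordC_gradient {q : E3 → ℝ} (hq : ContDiff ℝ ∞ q) (j : Fin 3) (x : E3) :
    coordC j (gradient q x) = pd j (fun y => ((q y : ℝ) : ℂ)) x := by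
  have h1 : pd j (fun y => ((q y : ℝ) : ℂ)) x = ((pd j q x : ℝ) : ℂ) :=
    pd_clm_comp Complex.ofRealCLM hq j x
  have h2 : fderiv ℝ q x = (InnerProductSpace.toDual ℝ E3) (gradient q x) := by
    simp [gradient]
  rw [h1, coordC_apply, pd, h2, InnerProductSpace.toDual_apply_apply,
    EuclideanSpace.inner_single_right, one_mul]
  rfl

namespace IsSmoothSolution

variable {Ω : Domain} {ν T : ℝ} {u : ℝ → E3 → E3} {p : ℝ → E3 → ℝ}

theorem contDiff_velocity (h : IsSmoothSolution Ω ν T u p) {t : ℝ} (ht : t ∈ Ioo 0 T) :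
    ContDiff ℝ ∞ (u t) := by
  rw [contDiff_iff_contDiffAt]
  intro x
  have h1 := h.velocity_smooth.contDiffAt
    ((isOpen_Ioo.prod isOpen_univ).mem_nhds (⟨ht, mem_univ x⟩ : (t, x) ∈ Ioo 0 T ×ˢ univ))
  exact h1.comp x (contDiffAt_const.prodMk contDiffAt_id)

theorem contDiff_pressure (h : IsSmoothSolution Ω ν T u p) {t : ℝ} (ht : t ∈ Ioo 0 T) :
    ContDiff ℝ ∞ (p t) := by
  rw [contDiff_iff_contDiffAt]
  intro x
  have h1 := h.pressure_smooth.contDiffAt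
    ((isOpen_Ioo.prod isOpen_univ).mem_nhds (⟨ht, mem_univ x⟩ : (t, x) ∈ Ioo 0 T ×ˢ univ))
  exact h1.comp x (contDiffAt_const.prodMk contDiffAt_id)

theorem hasDerivAt_velocity (h : IsSmoothSolution Ω ν T u p) {t : ℝ} (ht : t ∈ Ioo 0 T)
    (x : E3) : HasDerivAt (fun s => u s x)
      (fderiv ℝ (fun z : ℝ × E3 => u z.1 z.2) (t, x) (1, 0)) t := by
  have h1 := (h.velocity_smooth.contDiffAt
    ((isOpen_Ioo.prod isOpen_univ).mem_nhds
      (⟨ht, mem_univ x⟩ : (t, x) ∈ Ioo 0 T ×ˢ univ))).differentiableAt (by simp)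
  exact h1.hasFDerivAt.comp_hasDerivAt t ((hasDerivAt_id t).prodMk (hasDerivAt_const t x))

theorem continuousOn_deriv_velocity (h : IsSmoothSolution Ω ν T u p) :
    ContinuousOn (fun z : ℝ × E3 => fderiv ℝ (fun z : ℝ × E3 => u z.1 z.2) z (1, 0))
      (Ioo 0 T ×ˢ univ) :=
  (h.velocity_smooth.continuousOn_fderiv_of_isOpen (isOpen_Ioo.prod isOpen_univ)
    (by simp)).clm_apply continuousOn_const

theorem deriv_velocity (h : IsSmoothSolution Ω ν T u p) {t : ℝ} (ht : t ∈ Ioo 0 T) (x : E3)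
    (j : Fin 3) :
    coordC j (fderiv ℝ (fun z : ℝ × E3 => u z.1 z.2) (t, x) (1, 0)) =
      -(∑ i, comp (u t) i x * pd i (comp (u t) j) x) - pd j (fun y => ((p t y : ℝ) : ℂ)) x +
        ν * ∑ i, pd i (pd i (comp (u t) j)) x := by
  have hu := h.contDiff_velocity ht
  have h1 := congrArg (coordC j) (h.momentum t ht x)
  rw [(h.hasDerivAt_velocity ht x).deriv] at h1
  simp only [map_add, map_neg, map_smul, coordC_fderiv_apply hu, coordC_laplacian hu,
    coordC_gradient (h.contDiff_pressure ht), Complex.real_smul] at h1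
  have h2 := eq_sub_of_add_eq h1
  rw [h2]
  simp only [comp]
  ring

theorem sum_pd_comp (h : IsSmoothSolution Ω ν T u p) {t : ℝ} (ht : t ∈ Ioo 0 T) (x : E3) :
    ∑ i, pd i (comp (u t) i) x = 0 := by
  have h1 := h.incompressible t ht x
  simp only [pd_comp (h.contDiff_velocity ht), coordC_apply]
  rw [← Complex.ofReal_sum]
  exact_mod_cast h1

/-- Differentiation under the integral sign: the test function confines the integral to a compact
set, on which the time derivative is bounded for nearby times. No decay of the time derivative at
infinity is needed. -/
theorem hasDerivAt_integral_comp_mul (h : IsSmoothSolution Ω ν T u p) {t : ℝ} (ht : t ∈ Ioo 0 T)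
    (j : Fin 3) {φ : E3 → ℂ} (hφ : IsTest Ω φ) :
    HasDerivAt (fun s => ∫ x, comp (u s) j x * φ x ∂(vol Ω))
      (∫ x, coordC j (fderiv ℝ (fun z : ℝ × E3 => u z.1 z.2) (t, x) (1, 0)) * φ x ∂(vol Ω)) t := by
  obtain ⟨Q, hQ, hφQ⟩ := hφ.exists_isCompact
  obtain ⟨ε, hε, hball⟩ := Metric.nhds_basis_closedBall.mem_iff.1 (Ioo_mem_nhds ht.1 ht.2)
  have hsub : Metric.closedBall t ε ×ˢ Q ⊆ Ioo 0 T ×ˢ (univ : Set E3) :=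
    prod_mono hball (subset_univ Q)
  obtain ⟨M, hM⟩ := ((isCompact_closedBall t ε).prod hQ).exists_bound_of_continuousOn
    (f := fun z : ℝ × E3 => coordC j (fderiv ℝ (fun z : ℝ × E3 => u z.1 z.2) z (1, 0)))
    ((coordC j).continuous.comp_continuousOn (h.continuousOn_deriv_velocity.mono hsub))
  have hcont : ∀ s ∈ Ioo 0 T, Continuous (comp (u s) j) := fun s hs =>
    (contDiff_comp (h.contDiff_velocity hs) j).continuous
  have hcont' : Continuous fun x : E3 =>
      coordC j (fderiv ℝ (fun z : ℝ × E3 => u z.1 z.2) (t, x) (1, 0)) := by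
    refine (coordC j).continuous.comp ?_
    have : ContinuousOn (fun x : E3 => fderiv ℝ (fun z : ℝ × E3 => u z.1 z.2) (t, x) (1, 0))
        univ := h.continuousOn_deriv_velocity.comp (by fun_prop) fun x _ => ⟨ht, mem_univ x⟩
    exact continuousOn_univ.1 this
  refine (hasDerivAt_integral_of_dominated_loc_of_deriv_le (Metric.closedBall_mem_nhds t hε)
    (F := fun s x => comp (u s) j x * φ x)
    (F' := fun s x => coordC j (fderiv ℝ (fun z : ℝ × E3 => u z.1 z.2) (s, x) (1, 0)) * φ x)
    (bound := fun x => |M| * ‖φ x‖) ?_ (hφ.integrable_mul (hcont t ht)) ?_ ?_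
    (hφ.integrable.norm.const_mul _) ?_).2
  · filter_upwards [Ioo_mem_nhds ht.1 ht.2] with s hs
    exact (hφ.integrable_mul (hcont s hs)).aestronglyMeasurable
  · exact (hφ.integrable_mul hcont').aestronglyMeasurable
  · filter_upwards [hφQ] with x hx s hs
    by_cases hxQ : x ∈ Q
    · rw [norm_mul]
      gcongr
      exact (hM (s, x) ⟨hs, hxQ⟩).trans (le_abs_self M)
    · simp [hx hxQ]
  · refine Eventually.of_forall fun x s hs => ?_
    exact ((coordC j).hasFDerivAt.comp_hasDerivAt s
      (h.hasDerivAt_velocity (hball hs) x)).mul_const _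

/-- The weak form of the Navier–Stokes equations: the pressure drops out against divergence-free
test fields. -/
theorem weak_form (h : IsSmoothSolution Ω ν T u p) {t : ℝ} (ht : t ∈ Ioo 0 T)
    {φ : Fin 3 → E3 → ℂ} (hφ : ∀ j, IsTest Ω (φ j)) (hdiv : ∀ x, ∑ j, pd j (φ j) x = 0) :
    HasDerivAt (fun s => ∑ j, ∫ x, comp (u s) j x * φ j x ∂(vol Ω))
      (∑ j, (∑ i, ∫ x, comp (u t) i x * comp (u t) j x * pd i (φ j) x ∂(vol Ω) +
        ν * ∑ i, ∫ x, comp (u t) j x * pd i (pd i (φ j)) x ∂(vol Ω))) t := by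
  have hu : ∀ j, ContDiff ℝ ∞ (comp (u t) j) := fun j => contDiff_comp (h.contDiff_velocity ht) j
  have huΩ : ∀ j, IsFieldOn Ω (comp (u t) j) := fun j =>
    isFieldOn_comp (h.velocity_field t (Ioo_subset_Ico_self ht)) j
  set P : E3 → ℂ := fun y => ((p t y : ℝ) : ℂ) with hP
  have hPs : ContDiff ℝ ∞ P := Complex.ofRealCLM.contDiff.comp (h.contDiff_pressure ht)
  have hPΩ : IsFieldOn Ω P := by
    have := h.pressure_field t ht
    cases Ω
    · trivial
    · intro i x
      simp only [hP, this i x]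
  have h1 := HasDerivAt.fun_sum (u := Finset.univ)
    fun j _ => h.hasDerivAt_integral_comp_mul ht j (hφ j)
  convert! h1 using 1
  have hpress : ∑ j, ∫ x, pd j P x * φ j x ∂(vol Ω) = 0 := by
    simp only [integral_pd_mul_eq_neg hPs hPΩ (hφ _)]
    rw [Finset.sum_neg_distrib, ← integral_finsetSum _
      fun j _ => ((hφ j).pd j).integrable_mul hPs.continuous]
    simp only [← Finset.mul_sum, hdiv, mul_zero, integral_zero, neg_zero]
  -- By incompressibility `(u · ∇) u_j` equals `∑ ∂_i (u_i u_j)`; the derivative is then moved to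
  -- the test field.
  have htrans : ∀ j, ∑ i, ∫ x, comp (u t) i x * pd i (comp (u t) j) x * φ j x ∂(vol Ω) =
      -∑ i, ∫ x, comp (u t) i x * comp (u t) j x * pd i (φ j) x ∂(vol Ω) := by
    intro j
    have h2 : ∀ i, ∫ x, pd i (fun x => comp (u t) i x * comp (u t) j x) x * φ j x ∂(vol Ω) =
        -∫ x, comp (u t) i x * comp (u t) j x * pd i (φ j) x ∂(vol Ω) := fun i => by
      refine integral_pd_mul_eq_neg ((hu i).mul (hu j)) ?_ (hφ j) i
      cases Ω
      · trivial
      · intro k x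
        simp only [huΩ i k x, huΩ j k x]
    rw [← Finset.sum_neg_distrib]
    simp only [← h2, pd_mul (hu _) (hu _), add_mul]
    have hi1 : ∀ i, Integrable (fun x => pd i (comp (u t) i) x * comp (u t) j x * φ j x) (vol Ω) :=
      fun i => (hφ j).integrable_mul ((contDiff_pd (hu i) i).continuous.mul (hu j).continuous)
    have hi2 : ∀ i, Integrable (fun x => comp (u t) i x * pd i (comp (u t) j) x * φ j x) (vol Ω) :=
      fun i => (hφ j).integrable_mul ((hu i).continuous.mul (contDiff_pd (hu j) i).continuous)
    simp only [fun i => integral_add (hi1 i) (hi2 i)]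
    rw [Finset.sum_add_distrib, ← integral_finsetSum _ fun i _ => hi1 i]
    simp only [← Finset.sum_mul, h.sum_pd_comp ht, zero_mul, integral_zero, zero_add]
  have hvisc : ∀ i j, ∫ x, pd i (pd i (comp (u t) j)) x * φ j x ∂(vol Ω) =
      ∫ x, comp (u t) j x * pd i (pd i (φ j)) x ∂(vol Ω) := by
    intro i j
    have hf : IsFieldOn Ω (pd i (comp (u t) j)) := by
      cases Ω
      · trivial
      · exact pd_periodic (huΩ j) i
    rw [integral_pd_mul_eq_neg (contDiff_pd (hu j) i) hf (hφ j),
      integral_pd_mul_eq_neg (hu j) (huΩ j) ((hφ j).pd i), neg_neg]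
  have hexp : ∀ j, ∫ x, coordC j (fderiv ℝ (fun z : ℝ × E3 => u z.1 z.2) (t, x) (1, 0)) * φ j x
        ∂(vol Ω) =
      (∑ i, ∫ x, comp (u t) i x * comp (u t) j x * pd i (φ j) x ∂(vol Ω)) -
        ∫ x, pd j P x * φ j x ∂(vol Ω) +
        ν * ∑ i, ∫ x, comp (u t) j x * pd i (pd i (φ j)) x ∂(vol Ω) := by
    intro j
    have hi2 : ∀ i, Integrable (fun x => comp (u t) i x * pd i (comp (u t) j) x * φ j x) (vol Ω) :=
      fun i => (hφ j).integrable_mul ((hu i).continuous.mul (contDiff_pd (hu j) i).continuous)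
    have hi3 : ∀ i, Integrable (fun x => pd i (pd i (comp (u t) j)) x * φ j x) (vol Ω) :=
      fun i => (hφ j).integrable_mul (contDiff_pd (contDiff_pd (hu j) i) i).continuous
    have hi4 : Integrable (fun x => pd j P x * φ j x) (vol Ω) :=
      (hφ j).integrable_mul (contDiff_pd hPs j).continuous
    have h3 : ∀ x, coordC j (fderiv ℝ (fun z : ℝ × E3 => u z.1 z.2) (t, x) (1, 0)) * φ j x =
        -(∑ i, comp (u t) i x * pd i (comp (u t) j) x * φ j x) - pd j P x * φ j x +
          ν * ∑ i, pd i (pd i (comp (u t) j)) x * φ j x := by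
      intro x
      rw [h.deriv_velocity ht, ← Finset.sum_mul, ← Finset.sum_mul]
      ring
    simp only [h3]
    have hs2 := integrable_finsetSum Finset.univ fun i _ => hi2 i
    have hs3 := integrable_finsetSum Finset.univ fun i _ => hi3 i
    have hneg : Integrable (fun x => -∑ i, comp (u t) i x * pd i (comp (u t) j) x * φ j x)
      (vol Ω) := hs2.neg
    have hsub : Integrable (fun x => -(∑ i, comp (u t) i x * pd i (comp (u t) j) x * φ j x) -
      pd j P x * φ j x) (vol Ω) := hneg.sub hi4
    rw [integral_add hsub (hs3.const_mul _), integral_sub hneg hi4,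
      integral_neg, integral_const_mul, integral_finsetSum _ fun i _ => hi2 i,
      integral_finsetSum _ fun i _ => hi3 i, htrans j, neg_neg]
    simp only [hvisc]
  simp only [hexp, Finset.sum_add_distrib, Finset.sum_sub_distrib, hpress, sub_zero]

end IsSmoothSolution

end NavierStokes

/-! ### An abstract Fourier transform covering both domains. -/

namespace NavierStokes

open scoped ComplexConjugate

theorem inner_C3 (x y : C3) : (inner ℂ x y : ℂ) = ∑ i, conj (x i) * y i := by
  rw [PiLp.inner_apply]
  exact Finset.sum_congr rfl fun i _ => by rw [RCLike.inner_apply, mul_comm]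

theorem enorm_sq_C3 (x : C3) : ‖x‖ₑ ^ 2 = ∑ i, ‖x i‖ₑ ^ 2 := by
  simp only [← ofReal_norm, ← ENNReal.ofReal_pow (norm_nonneg _)]
  rw [← ENNReal.ofReal_sum_of_nonneg fun i _ => by positivity, EuclideanSpace.norm_sq_eq]

variable {K : Type*} [AddCommGroup K] [MeasurableSpace K]

/-- The plane wave `x ↦ exp(i ξ·x)`. -/
noncomputable def planeWave (ξ x : E3) : ℂ := Complex.exp (Complex.I * ((inner ℝ ξ x : ℝ) : ℂ))

theorem planeWave_add (ξ η x : E3) : planeWave (ξ + η) x = planeWave ξ x * planeWave η x := by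
  simp only [planeWave, inner_add_left, Complex.ofReal_add, mul_add, Complex.exp_add]

theorem norm_planeWave (ξ x : E3) : ‖planeWave ξ x‖ = 1 := by
  rw [planeWave, mul_comm, Complex.norm_exp_ofReal_mul_I]

theorem conj_planeWave (ξ x : E3) : conj (planeWave ξ x) = planeWave (-ξ) x := by
  rw [planeWave, ← Complex.exp_conj]
  simp [planeWave]

theorem contDiff_planeWave (ξ : E3) : ContDiff ℝ ∞ (planeWave ξ) := by
  have h : ContDiff ℝ ∞ fun x : E3 => ((inner ℝ ξ x : ℝ) : ℂ) :=
    Complex.ofRealCLM.contDiff.comp (contDiff_const.inner ℝ contDiff_id)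
  exact (contDiff_const.mul h).cexp

theorem pd_planeWave (i : Fin 3) (ξ x : E3) :
    pd i (planeWave ξ) x = Complex.I * ((ξ i : ℝ) : ℂ) * planeWave ξ x := by
  have h : HasFDerivAt (fun x : E3 => ((inner ℝ ξ x : ℝ) : ℂ))
      (Complex.ofRealCLM.comp (innerSL ℝ ξ)) x :=
    (Complex.ofRealCLM.comp (innerSL ℝ ξ)).hasFDerivAt
  have h2 := (h.const_mul Complex.I).cexp
  have h3 : fderiv ℝ (planeWave ξ) x = _ := h2.fderiv
  rw [pd, h3]
  simp [planeWave, EuclideanSpace.inner_single_right]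
  ring

/-- A Fourier transform `F` for functions on the domain `Ω`, with frequencies in `K`: the frequency
`k` is the wave vector `κ k`, and `lam` is the constant in Parseval's identity. -/
structure IsFourierModel (Ω : Domain) (μ : Measure K) (κ : K →+ E3) (F : (E3 → ℂ) → K → ℂ)
    (lam A : ℝ) : Prop where
  lam_pos : 0 < lam
  measurable_wave : Measurable κ
  planeWave_field : ∀ k, IsFieldOn Ω (planeWave (κ k))
  measurable : ∀ f, MemLp f 2 (vol Ω) → Measurable (F f)
  memLp : ∀ f, MemLp f 2 (vol Ω) → MemLp (F f) 2 μ
  parseval : ∀ f g, MemLp f 2 (vol Ω) → MemLp g 2 (vol Ω) →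
    ∫ x, conj (f x) * g x ∂(vol Ω) = lam * ∫ k, conj (F f k) * F g k ∂μ
  ae_eq_integral : ∀ f, MemLp f 2 (vol Ω) → Integrable f (vol Ω) →
    F f =ᵐ[μ] fun k => (lam : ℂ)⁻¹ * ∫ x, planeWave (-κ k) x * f x ∂(vol Ω)
  ae_eq_zero : ∀ h : K → ℂ, (∀ φ, IsTest Ω φ → Integrable (fun k => conj (h k) * F φ k) μ) →
    (∀ φ, IsTest Ω φ → ∫ k, conj (h k) * F φ k ∂μ = 0) → h =ᵐ[μ] 0
  ae_eq_zero_of_wave_eq_zero : ∀ h : K → ℂ,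
    (∀ φ, IsTest Ω φ → (∀ i x, pd i φ x = 0) → ∫ k, conj (h k) * F φ k ∂μ = 0) →
    ∀ᵐ k ∂μ, κ k = 0 → h k = 0
  spectral : ∀ W : E3 → ℝ≥0∞, Measurable W → ∀ f : E3 → E3, (∀ i, MemLp (comp f i) 2 (vol Ω)) →
    spectralIntegral Ω W f =
      ENNReal.ofReal lam * ∫⁻ k, W (κ k) * ∑ i, ‖F (comp f i) k‖ₑ ^ 2 ∂μ
  decay : ∫⁻ k, ENNReal.ofReal (((1 + ‖κ k‖ ^ 2) ^ 2)⁻¹) ∂μ < ⊤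
  low_pos : 0 < A
  low : ∀ r : ℝ, 0 ≤ r → ∫⁻ p in {p | ‖κ p‖ ≤ r}, ENNReal.ofReal ‖κ p‖⁻¹ ∂μ
    ≤ ENNReal.ofReal (A * r ^ 2)

theorem integrable_conj_mul {X : Type*} [MeasurableSpace X] {μ : Measure X} {f g : X → ℂ}
    (hf : MemLp f 2 μ) (hg : MemLp g 2 μ) : Integrable (fun x => conj (f x) * g x) μ := by
  have h := hf.star.integrable_mul hg
  exact h

theorem IsTest.conj {Ω : Domain} {φ : E3 → ℂ} (hφ : IsTest Ω φ) :
    IsTest Ω fun x => conj (φ x) where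
  contDiff := Complex.conjCLE.contDiff.comp hφ.contDiff
  field := by
    cases Ω
    · trivial
    · intro i x
      simp only [hφ.field i x]
  compact h := (hφ.compact h).comp_left (g := conj) (by simp)

theorem MemLp.planeWave_mul {ν : Measure E3} {f : E3 → ℂ} (hf : MemLp f 2 ν) (ξ : E3) :
    MemLp (fun x => planeWave ξ x * f x) 2 ν := by
  refine hf.of_le ((contDiff_planeWave ξ).continuous.aestronglyMeasurable.mul
    hf.aestronglyMeasurable) (Eventually.of_forall fun x => ?_)
  rw [norm_mul, norm_planeWave, one_mul]

namespace IsFourierModel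

variable {Ω : Domain} {μ : Measure K} {κ : K →+ E3} {F : (E3 → ℂ) → K → ℂ} {lam A : ℝ}

/-- The duality principle behind the general identities for `F` on `L²`. Neither linearity nor
compatibility with conjugation and modulation is part of the model; each is checked by moving the
operation to a test function, where the integral formula for `F` holds. -/
theorem ae_eq (M : IsFourierModel Ω μ κ F lam A) {h₁ h₂ : K → ℂ}
    (i₁ : ∀ φ, IsTest Ω φ → Integrable (fun k => conj (h₁ k) * F φ k) μ)
    (i₂ : ∀ φ, IsTest Ω φ → Integrable (fun k => conj (h₂ k) * F φ k) μ)
    (h : ∀ φ, IsTest Ω φ → ∫ k, conj (h₁ k) * F φ k ∂μ = ∫ k, conj (h₂ k) * F φ k ∂μ) :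
    h₁ =ᵐ[μ] h₂ := by
  have hsub : ∀ φ k, conj (h₁ k - h₂ k) * F φ k =
      conj (h₁ k) * F φ k - conj (h₂ k) * F φ k := by
    intro φ k; rw [map_sub, sub_mul]
  have := M.ae_eq_zero (fun k => h₁ k - h₂ k)
    (fun φ hφ => by simp only [hsub]; exact (i₁ φ hφ).sub (i₂ φ hφ))
    (fun φ hφ => by
      simp only [hsub]
      rw [integral_sub (i₁ φ hφ) (i₂ φ hφ), h φ hφ, sub_self])
  filter_upwards [this] with k hk
  exact sub_eq_zero.1 hk

theorem memLp_test (M : IsFourierModel Ω μ κ F lam A) {φ : E3 → ℂ} (hφ : IsTest Ω φ) :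
    MemLp (F φ) 2 μ :=
  M.memLp φ hφ.memLp_two

theorem integral_conj_mul (M : IsFourierModel Ω μ κ F lam A) {f g : E3 → ℂ}
    (hf : MemLp f 2 (vol Ω)) (hg : MemLp g 2 (vol Ω)) :
    ∫ k, conj (F f k) * F g k ∂μ = (lam : ℂ)⁻¹ * ∫ x, conj (f x) * g x ∂(vol Ω) := by
  have := M.lam_pos
  rw [M.parseval f g hf hg, inv_mul_cancel_left₀ (by exact_mod_cast this.ne')]

theorem sub (M : IsFourierModel Ω μ κ F lam A) {f g : E3 → ℂ}
    (hf : MemLp f 2 (vol Ω)) (hg : MemLp g 2 (vol Ω)) :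
    F (f - g) =ᵐ[μ] fun k => F f k - F g k := by
  have hsub : ∀ (h₁ h₂ : ℂ) c, conj (h₁ - h₂) * c = conj h₁ * c - conj h₂ * c := by
    intro h₁ h₂ c; rw [map_sub, sub_mul]
  refine M.ae_eq (fun φ hφ => integrable_conj_mul (M.memLp _ (hf.sub hg)) (M.memLp_test hφ))
    (fun φ hφ => integrable_conj_mul ((M.memLp _ hf).sub (M.memLp _ hg)) (M.memLp_test hφ))
    fun φ hφ => ?_
  simp only [hsub]
  rw [integral_sub (integrable_conj_mul (M.memLp _ hf) (M.memLp_test hφ))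
    (integrable_conj_mul (M.memLp _ hg) (M.memLp_test hφ)),
    M.integral_conj_mul (hf.sub hg) hφ.memLp_two, M.integral_conj_mul hf hφ.memLp_two,
    M.integral_conj_mul hg hφ.memLp_two, ← mul_sub,
    ← integral_sub (integrable_conj_mul hf hφ.memLp_two) (integrable_conj_mul hg hφ.memLp_two)]
  simp only [Pi.sub_apply, hsub]

theorem neg_test (M : IsFourierModel Ω μ κ F lam A) {φ : E3 → ℂ} (hφ : IsTest Ω φ) :
    F (fun x => -φ x) =ᵐ[μ] fun k => -F φ k := by
  filter_upwards [M.ae_eq_integral _ hφ.memLp_two hφ.integrable,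
    M.ae_eq_integral _ hφ.memLp_two.neg hφ.integrable.neg] with k h1 h2
  rw [h1]
  refine h2.trans ?_
  simp only [Pi.neg_apply, mul_neg, integral_neg]

theorem zero_test (M : IsFourierModel Ω μ κ F lam A) : F 0 =ᵐ[μ] 0 := by
  filter_upwards [M.ae_eq_integral 0 MemLp.zero (integrable_zero _ _ _)] with k h1
  rw [h1]
  simp

theorem pd_test (M : IsFourierModel Ω μ κ F lam A) {φ : E3 → ℂ} (hφ : IsTest Ω φ) (i : Fin 3) :
    F (pd i φ) =ᵐ[μ] fun k => Complex.I * ((κ k i : ℝ) : ℂ) * F φ k := by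
  filter_upwards [M.ae_eq_integral _ hφ.memLp_two hφ.integrable,
    M.ae_eq_integral _ (hφ.pd i).memLp_two (hφ.pd i).integrable] with k h1 h2
  rw [h1, h2]
  have h3 : IsFieldOn Ω (planeWave (-κ k)) := by
    rw [← map_neg]; exact M.planeWave_field _
  have h4 := integral_pd_mul_eq_neg (contDiff_planeWave (-κ k)) h3 hφ i
  rw [← neg_eq_iff_eq_neg] at h4
  rw [← h4]
  simp only [pd_planeWave, mul_assoc]
  rw [integral_const_mul, integral_const_mul]
  simp
  ring

theorem conj_test (M : IsFourierModel Ω μ κ F lam A) [MeasurableNeg K] [μ.IsNegInvariant]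
    {φ : E3 → ℂ} (hφ : IsTest Ω φ) :
    F (fun x => conj (φ x)) =ᵐ[μ] fun k => conj (F φ (-k)) := by
  have h0 := (Measure.measurePreserving_neg μ).quasiMeasurePreserving.ae
    (M.ae_eq_integral _ hφ.memLp_two hφ.integrable)
  filter_upwards [h0, M.ae_eq_integral _ hφ.conj.memLp_two hφ.conj.integrable] with k h1 h2
  rw [h1, h2, map_mul, ← integral_conj]
  simp only [map_mul, conj_planeWave, map_neg, neg_neg, map_inv₀, Complex.conj_ofReal]

/-- Parseval's identity moves the conjugation to the test function, where `conj_test` gives the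
reflection of the frequency. -/
theorem conj_symm (M : IsFourierModel Ω μ κ F lam A) [MeasurableNeg K] [μ.IsNegInvariant]
    {f : E3 → ℂ} (hf : MemLp f 2 (vol Ω)) (hreal : ∀ x, conj (f x) = f x) :
    (fun k => F f (-k)) =ᵐ[μ] fun k => conj (F f k) := by
  have hneg : MemLp (fun k => F f (-k)) 2 μ :=
    (M.memLp f hf).comp_measurePreserving (Measure.measurePreserving_neg μ)
  have hconj : MemLp (fun k => conj (F f (-k))) 2 μ := hneg.star
  have key : F f =ᵐ[μ] fun k => conj (F f (-k)) := by
    refine M.ae_eq (fun φ hφ => integrable_conj_mul (M.memLp f hf) (M.memLp_test hφ))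
      (fun φ hφ => integrable_conj_mul hconj (M.memLp_test hφ)) fun φ hφ => ?_
    calc ∫ k, conj (F f k) * F φ k ∂μ
        = (lam : ℂ)⁻¹ * ∫ x, conj (f x) * φ x ∂(vol Ω) := M.integral_conj_mul hf hφ.memLp_two
      _ = conj ((lam : ℂ)⁻¹ * ∫ x, conj (f x) * conj (φ x) ∂(vol Ω)) := by
        rw [map_mul, ← integral_conj]
        simp only [map_mul, Complex.conj_conj, hreal, map_inv₀, Complex.conj_ofReal]
      _ = conj (∫ k, conj (F f k) * F (fun x => conj (φ x)) k ∂μ) := by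
        rw [M.integral_conj_mul hf hφ.conj.memLp_two]
      _ = ∫ k, F f k * F φ (-k) ∂μ := by
        rw [← integral_conj]
        refine integral_congr_ae ?_
        filter_upwards [M.conj_test hφ] with k hk
        rw [hk, map_mul, Complex.conj_conj, Complex.conj_conj]
      _ = ∫ k, conj (conj (F f (-k))) * F φ k ∂μ := by
        rw [← integral_neg_eq_self]
        simp only [neg_neg, Complex.conj_conj]
  filter_upwards [key] with k hk
  rw [hk, Complex.conj_conj]

theorem planeWave_mul_test (M : IsFourierModel Ω μ κ F lam A) [MeasurableAdd₂ K] [MeasurableNeg K]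
    [μ.IsAddLeftInvariant] {φ : E3 → ℂ} (hφ : IsTest Ω φ) (l : K) :
    F (fun x => planeWave (κ l) x * φ x) =ᵐ[μ] fun k => F φ (k - l) := by
  have ht := hφ.mul_left (contDiff_planeWave (κ l)) (M.planeWave_field l)
  have h0 := (measurePreserving_sub_right μ l).quasiMeasurePreserving.ae
    (M.ae_eq_integral _ hφ.memLp_two hφ.integrable)
  filter_upwards [h0, M.ae_eq_integral _ ht.memLp_two ht.integrable] with k h1 h2
  rw [h1, h2]
  simp only [← mul_assoc, ← planeWave_add, map_sub]
  congr! 5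
  abel

/-- The conjugate plane wave is moved to the test function, which shifts its transform the opposite
way; invariance of `μ` returns the shift to `f`. -/
theorem planeWave_mul (M : IsFourierModel Ω μ κ F lam A) [MeasurableAdd₂ K] [MeasurableNeg K]
    [μ.IsAddLeftInvariant] {f : E3 → ℂ} (hf : MemLp f 2 (vol Ω)) (l : K) :
    F (fun x => planeWave (κ l) x * f x) =ᵐ[μ] fun k => F f (k - l) := by
  have hl : MemLp (fun k => F f (k - l)) 2 μ :=
    (M.memLp f hf).comp_measurePreserving (measurePreserving_sub_right μ l)
  have hf' := MemLp.planeWave_mul hf (κ l)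
  refine M.ae_eq (fun φ hφ => integrable_conj_mul (M.memLp _ hf') (M.memLp_test hφ))
    (fun φ hφ => integrable_conj_mul hl (M.memLp_test hφ)) fun φ hφ => ?_
  have h1 : ∫ k, conj (F f (k - l)) * F φ k ∂μ =
      ∫ k, conj (F f k) * F (fun x => planeWave (κ (-l)) x * φ x) k ∂μ := by
    rw [← integral_sub_right_eq_self (fun k => conj (F f k) * F _ k) l]
    refine integral_congr_ae ?_
    have h0 := (measurePreserving_sub_right μ l).quasiMeasurePreserving.ae
      (M.planeWave_mul_test hφ (-l))
    filter_upwards [h0] with k hk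
    rw [hk]
    simp
  have ht := hφ.mul_left (contDiff_planeWave (κ (-l))) (M.planeWave_field (-l))
  rw [h1, M.integral_conj_mul hf' hφ.memLp_two, M.integral_conj_mul hf ht.memLp_two]
  simp only [map_mul, conj_planeWave, map_neg]
  congr! 3
  ring

/-- The Fourier transform turns a product into a convolution. -/
theorem conj_mul (M : IsFourierModel Ω μ κ F lam A) [MeasurableAdd₂ K] [MeasurableNeg K]
    [μ.IsAddLeftInvariant] {f φ : E3 → ℂ} (hf : MemLp f 2 (vol Ω)) (hφ : IsTest Ω φ)
    (hfφ : MemLp (fun x => conj (f x) * φ x) 2 (vol Ω)) :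
    F (fun x => conj (f x) * φ x) =ᵐ[μ] fun l => ∫ k, conj (F f (k - l)) * F φ k ∂μ := by
  filter_upwards [M.ae_eq_integral _ hfφ (integrable_conj_mul hf hφ.memLp_two)] with l hl
  have h1 : ∫ k, conj (F f (k - l)) * F φ k ∂μ =
      ∫ k, conj (F (fun x => planeWave (κ l) x * f x) k) * F φ k ∂μ := by
    refine integral_congr_ae ?_
    filter_upwards [M.planeWave_mul hf l] with k hk
    rw [hk]
  rw [hl, h1, M.integral_conj_mul (MemLp.planeWave_mul hf _) hφ.memLp_two]
  simp only [map_mul, conj_planeWave, mul_assoc]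

end IsFourierModel

end NavierStokes

/-! ### Density of divergence-free test fields. -/

namespace NavierStokes

open scoped ComplexConjugate

/-- The componentwise Fourier transform. -/
noncomputable def hat {K : Type*} (F : (E3 → ℂ) → K → ℂ) (f : Fin 3 → E3 → ℂ) (k : K) : C3 :=
  WithLp.toLp 2 fun i => F (f i) k

@[simp] theorem hat_apply {K : Type*} (F : (E3 → ℂ) → K → ℂ) (f : Fin 3 → E3 → ℂ) (k : K)
    (i : Fin 3) : hat F f k i = F (f i) k := rfl

variable {K : Type*} [AddCommGroup K] [MeasurableSpace K]

/-- The Fourier transforms of divergence-free test fields. -/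
def testSpectra (Ω : Domain) (μ : Measure K) (F : (E3 → ℂ) → K → ℂ) : Set (Lp C3 2 μ) :=
  {Φ | ∃ φ : Fin 3 → E3 → ℂ, (∀ j, IsTest Ω (φ j)) ∧ (∀ x, ∑ j, pd j (φ j) x = 0) ∧
    Φ = toL2 μ (hat F φ)}

theorem pd_neg {f : E3 → ℂ} (i : Fin 3) (x : E3) :
    pd i (fun x => -f x) x = -pd i f x := by
  unfold pd
  rw [fderiv_fun_neg]
  rfl

theorem pd_pd_comm {f : E3 → ℂ} (hf : ContDiff ℝ ∞ f) (i j : Fin 3) (x : E3) :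
    pd i (pd j f) x = pd j (pd i f) x := by
  have h2 : DifferentiableAt ℝ (fderiv ℝ f) x :=
    (hf.fderiv_right (m := ∞) (by simp)).differentiable (by simp) x
  have h : ∀ a b : Fin 3, pd a (pd b f) x =
      fderiv ℝ (fderiv ℝ f) x (EuclideanSpace.single a 1) (EuclideanSpace.single b 1) := by
    intro a b
    unfold pd
    rw [fderiv_clm_apply h2 (differentiableAt_const _)]
    simp
  rw [h, h]
  exact (hf.contDiffAt.isSymmSndFDerivAt (by simp; exact WithTop.coe_le_coe.2 le_top)) _ _

namespace IsFourierModel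

variable {Ω : Domain} {μ : Measure K} {κ : K →+ E3} {F : (E3 → ℂ) → K → ℂ} {lam A : ℝ}

theorem memLp_hat (M : IsFourierModel Ω μ κ F lam A) {f : Fin 3 → E3 → ℂ}
    (hf : ∀ i, MemLp (f i) 2 (vol Ω)) : MemLp (hat F f) 2 μ := by
  rw [memLp_piLp_iff]
  exact fun i => M.memLp _ (hf i)

theorem measurable_hat (M : IsFourierModel Ω μ κ F lam A) {f : Fin 3 → E3 → ℂ}
    (hf : ∀ i, MemLp (f i) 2 (vol Ω)) : Measurable (hat F f) := by
  have := fun i => M.measurable _ (hf i)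
  unfold hat
  fun_prop

theorem integral_inner_hat (M : IsFourierModel Ω μ κ F lam A) (Ψ : Lp C3 2 μ)
    {φ : Fin 3 → E3 → ℂ} (hφ : ∀ j, MemLp (φ j) 2 (vol Ω)) :
    inner ℂ Ψ (toL2 μ (hat F φ)) = ∑ i, ∫ k, conj (Ψ k i) * F (φ i) k ∂μ := by
  rw [L2.inner_def, ← integral_finsetSum _ fun i _ =>
    integrable_conj_mul ((Lp.memLp Ψ).eval_piLp i) (M.memLp _ (hφ i))]
  refine integral_congr_ae ?_
  filter_upwards [coeFn_toL2 (M.memLp_hat hφ)] with k hk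
  rw [hk, inner_C3]
  simp only [hat_apply]

theorem memLp_wave_mul_test (M : IsFourierModel Ω μ κ F lam A) {φ : E3 → ℂ} (hφ : IsTest Ω φ)
    (i : Fin 3) : MemLp (fun k => ((κ k i : ℝ) : ℂ) * F φ k) 2 μ := by
  refine ((M.memLp_test (hφ.pd i)).const_mul (-Complex.I)).ae_eq ?_
  filter_upwards [M.pd_test hφ i] with k hk
  rw [hk, ← mul_assoc, ← mul_assoc]
  simp

/-- Testing with curl-type fields, which are divergence-free for every scalar `ψ`, forces `Ψ k` to
be parallel to the wave vector. -/
theorem wave_mul_eq (M : IsFourierModel Ω μ κ F lam A) {Ψ : Lp C3 2 μ}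
    (hΨ : ∀ Φ ∈ testSpectra Ω μ F, inner ℂ Ψ Φ = 0) {i j : Fin 3} (hij : i ≠ j) :
    ∀ᵐ k ∂μ, ((κ k j : ℝ) : ℂ) * Ψ k i = ((κ k i : ℝ) : ℂ) * Ψ k j := by
  have hi : ∀ (a b : Fin 3) ψ, IsTest Ω ψ →
      Integrable (fun k => conj (Ψ k a) * (((κ k b : ℝ) : ℂ) * F ψ k)) μ := fun a b ψ hψ =>
    integrable_conj_mul ((Lp.memLp Ψ).eval_piLp a) (M.memLp_wave_mul_test hψ b)
  have hform : ∀ (a b : Fin 3) ψ k, conj (((κ k b : ℝ) : ℂ) * Ψ k a) * F ψ k =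
      conj (Ψ k a) * (((κ k b : ℝ) : ℂ) * F ψ k) := by
    intro a b ψ k
    rw [map_mul, Complex.conj_ofReal]
    ring
  refine M.ae_eq (fun ψ hψ => by simpa only [hform] using hi i j ψ hψ)
    (fun ψ hψ => by simpa only [hform] using hi j i ψ hψ) fun ψ hψ => ?_
  simp only [hform]
  have hneg : IsTest Ω fun x => -ψ x := by
    simpa using hψ.mul_left (f := fun _ => -1) contDiff_const (by cases Ω <;> simp [IsFieldOn])
  -- The field `∂_j ψ e_i - ∂_i ψ e_j`; its divergence vanishes because mixed derivatives commute.
  set φ : Fin 3 → E3 → ℂ := fun l =>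
    if l = i then pd j ψ else if l = j then pd i (fun x => -ψ x) else 0 with hφ
  have h0 : IsTest Ω (0 : E3 → ℂ) :=
    ⟨contDiff_const, by cases Ω <;> simp [IsFieldOn], fun _ => HasCompactSupport.zero⟩
  have hφt : ∀ l, IsTest Ω (φ l) := by
    intro l
    simp only [hφ]
    split_ifs
    exacts [hψ.pd j, hneg.pd i, h0]
  have hpd0 : ∀ l x, pd l (0 : E3 → ℂ) x = 0 := by
    intro l x
    simp [pd]
  have hdiv : ∀ x, ∑ l, pd l (φ l) x = 0 := by
    intro x
    have h1 : ∀ l, pd l (φ l) x = (if l = i then pd i (pd j ψ) x else 0) +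
        (if l = j then -pd j (pd i ψ) x else 0) := by
      intro l
      simp only [hφ]
      split_ifs with h1 h2 h2
      · exact absurd (h1.symm.trans h2) hij
      · rw [h1, add_zero]
      · have : pd i (fun x => -ψ x) = fun x => -pd i ψ x := funext fun x => pd_neg i x
        rw [h2, this, pd_neg, zero_add]
      · rw [hpd0, add_zero]
    simp only [h1, Finset.sum_add_distrib, Finset.sum_ite_eq', Finset.mem_univ, if_true]
    rw [pd_pd_comm hψ.contDiff]
    ring
  have h1 := hΨ _ ⟨φ, hφt, hdiv, rfl⟩
  rw [M.integral_inner_hat Ψ fun l => (hφt l).memLp_two] at h1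
  have h2 : ∀ l, ∫ k, conj (Ψ k l) * F (φ l) k ∂μ =
      (if l = i then Complex.I * ∫ k, conj (Ψ k i) * (((κ k j : ℝ) : ℂ) * F ψ k) ∂μ else 0) +
      (if l = j then -(Complex.I * ∫ k, conj (Ψ k j) * (((κ k i : ℝ) : ℂ) * F ψ k) ∂μ)
        else 0) := by
    intro l
    simp only [hφ]
    split_ifs with h1 h2 h2
    · exact absurd (h1.symm.trans h2) hij
    · rw [add_zero, h1, ← integral_const_mul]
      refine integral_congr_ae ?_
      filter_upwards [M.pd_test hψ j] with k hk
      rw [hk]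
      ring
    · rw [zero_add, h2, ← integral_const_mul, ← integral_neg]
      refine integral_congr_ae ?_
      filter_upwards [M.pd_test hneg i, M.neg_test hψ] with k hk hk'
      rw [hk, hk']
      ring
    · rw [add_zero]
      refine integral_eq_zero_of_ae ?_
      filter_upwards [M.zero_test] with k hk
      rw [hk]
      simp
  simp only [h2, Finset.sum_add_distrib, Finset.sum_ite_eq', Finset.mem_univ, if_true,
    ← mul_neg, ← mul_add] at h1
  exact add_neg_eq_zero.1 ((mul_eq_zero.1 h1).resolve_left Complex.I_ne_zero)

/-- By the double orthogonal complement, it is enough that any `Ψ` orthogonal to the test spectra is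
orthogonal to `f`. Away from zero wave vectors `Ψ` is parallel to `κ`, hence orthogonal to `f`.
Where `κ` vanishes the divergence condition is empty, and there `Ψ` itself must vanish. -/
theorem dense_testSpectra (M : IsFourierModel Ω μ κ F lam A) {f : Lp C3 2 μ}
    (hf : f ∈ divFree μ κ) :
    f ∈ closure (Submodule.span ℂ (testSpectra Ω μ F) : Set (Lp C3 2 μ)) := by
  rw [← Submodule.topologicalClosure_coe, SetLike.mem_coe,
    ← Submodule.orthogonal_orthogonal_eq_closure, Submodule.mem_orthogonal]
  intro Ψ hΨ
  have hΨ' : ∀ Φ ∈ testSpectra Ω μ F, inner ℂ Ψ Φ = 0 := fun Φ hΦ =>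
    inner_eq_zero_symm.1 (hΨ Φ (Submodule.subset_span hΦ))
  have hcross : ∀ᵐ k ∂μ, ∀ i j : Fin 3,
      ((κ k j : ℝ) : ℂ) * Ψ k i = ((κ k i : ℝ) : ℂ) * Ψ k j := by
    rw [ae_all_iff]; intro i
    rw [ae_all_iff]; intro j
    rcases eq_or_ne i j with rfl | hij
    · exact Eventually.of_forall fun k => rfl
    · exact M.wave_mul_eq hΨ' hij
  have hzero : ∀ᵐ k ∂μ, κ k = 0 → ∀ i, Ψ k i = 0 := by
    have : ∀ i, ∀ᵐ k ∂μ, κ k = 0 → Ψ k i = 0 := by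
      intro i
      refine M.ae_eq_zero_of_wave_eq_zero (fun k => Ψ k i) fun φ hφ hpd => ?_
      have h0 : IsTest Ω (0 : E3 → ℂ) :=
        ⟨contDiff_const, by cases Ω <;> simp [IsFieldOn], fun _ => HasCompactSupport.zero⟩
      have ht : ∀ l, IsTest Ω (if l = i then φ else 0) := by
        intro l
        split_ifs
        exacts [hφ, h0]
      have h1 := hΨ' _ ⟨fun l => if l = i then φ else 0, ht, fun x => by
        refine Finset.sum_eq_zero fun l _ => ?_
        change pd l (if l = i then φ else 0) x = 0
        split_ifs
        · exact hpd l x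
        · simp [pd], rfl⟩
      rw [M.integral_inner_hat Ψ fun l => (ht l).memLp_two, Finset.sum_eq_single i] at h1
      · simpa using h1
      · intro l _ hl
        refine integral_eq_zero_of_ae ?_
        filter_upwards [M.zero_test] with k hk
        simp [hl, hk]
      · simp
    filter_upwards [ae_all_iff.2 this] with k hk h i using hk i h
  rw [L2.inner_def]
  refine integral_eq_zero_of_ae ?_
  have hf' : ∀ᵐ k ∂μ, inner ℂ (f k) (cpx (κ k)) = 0 := hf
  filter_upwards [hcross, hzero, hf'] with k hk h0 hfk
  rw [Pi.zero_apply]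
  by_cases hκ : κ k = 0
  · rw [inner_C3]
    simp [h0 hκ]
  · obtain ⟨j, hj⟩ : ∃ j, κ k j ≠ 0 := by
      by_contra! h
      exact hκ (by ext j; simpa using h j)
    rw [← inner_eq_zero_symm]
    have h2 : ((κ k j : ℝ) : ℂ) * inner ℂ (f k) (Ψ k) = 0 := by
      rw [inner_C3] at hfk ⊢
      calc ((κ k j : ℝ) : ℂ) * ∑ i, conj (f k i) * Ψ k i
          = (∑ i, conj (f k i) * cpx (κ k) i) * Ψ k j := by
            rw [Finset.mul_sum, Finset.sum_mul]
            refine Finset.sum_congr rfl fun i _ => ?_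
            rw [cpx_apply, mul_left_comm, hk i j, mul_assoc]
        _ = 0 := by rw [hfk, zero_mul]
    exact (mul_eq_zero.1 h2).resolve_left (by exact_mod_cast hj)

end IsFourierModel

end NavierStokes

/-! ### The amplitude of a smooth solution. -/

namespace NavierStokes

open scoped ComplexConjugate

variable {K : Type*} [AddCommGroup K] [MeasurableSpace K]

theorem memLp_comp_of_spectralIntegral_lt_top {Ω : Domain} {W : E3 → ℝ≥0∞} {f : E3 → E3}
    (h : spectralIntegral Ω W f < ⊤) (i : Fin 3) : MemLp (comp f i) 2 (vol Ω) := by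
  cases Ω
  · by_contra hn
    have : ¬ ∀ i, MemLp (comp f i) 2 (volume : Measure E3) := fun h => hn (h i)
    simp [spectralIntegral, this] at h
  · by_contra hn
    have : ¬ ∀ i, MemLp (comp f i) 2 ((volume : Measure E3).restrict box) := fun h => hn (h i)
    simp [spectralIntegral, this] at h

theorem rpow_half_lt_top {x : ℝ≥0∞} : x ^ (1 / 2 : ℝ) < ⊤ ↔ x < ⊤ :=
  ENNReal.rpow_lt_top_iff_of_pos (by norm_num)

theorem comp_sub (f g : E3 → E3) (i : Fin 3) : comp (f - g) i = comp f i - comp g i := by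
  ext x
  simp [comp]

theorem memLp_comp {ν : Measure E3} {f : E3 → E3} (hf : MemLp f 2 ν) (i : Fin 3) :
    MemLp (comp f i) 2 ν :=
  (hf.eval_piLp i).ofReal

namespace IsSmoothSolution

variable {Ω : Domain} {ν T : ℝ} {u : ℝ → E3 → E3} {p : ℝ → E3 → ℝ}

theorem memLp_comp (h : IsSmoothSolution Ω ν T u p) {t : ℝ} (ht : t ∈ Ico 0 T) (i : Fin 3) :
    MemLp (comp (u t) i) 2 (vol Ω) := by
  rcases eq_or_lt_of_le ht.1 with rfl | h0
  · exact NavierStokes.memLp_comp h.initial_energy i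
  · exact memLp_comp_of_spectralIntegral_lt_top
      (rpow_half_lt_top.1 (h.sobolev_finite t ⟨h0, ht.2⟩ 0)) i

end IsSmoothSolution

namespace IsFourierModel

variable {Ω : Domain} {μ : Measure K} {κ : K →+ E3} {F : (E3 → ℂ) → K → ℂ} {lam A : ℝ}
variable {ν T : ℝ} {u : ℝ → E3 → E3} {p : ℝ → E3 → ℝ}

theorem spectralIntegral_eq (M : IsFourierModel Ω μ κ F lam A) {W : E3 → ℝ≥0∞} (hW : Measurable W)
    {f : E3 → E3} (hf : ∀ i, MemLp (comp f i) 2 (vol Ω)) :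
    spectralIntegral Ω W f =
      ENNReal.ofReal lam * ∫⁻ k, W (κ k) * ‖hat F (comp f) k‖ₑ ^ 2 ∂μ := by
  simp only [enorm_sq_C3, hat_apply]
  exact M.spectral W hW f hf

theorem hat_sub (M : IsFourierModel Ω μ κ F lam A) {f g : E3 → E3}
    (hf : ∀ i, MemLp (comp f i) 2 (vol Ω)) (hg : ∀ i, MemLp (comp g i) 2 (vol Ω)) :
    hat F (comp (f - g)) =ᵐ[μ] fun k => hat F (comp f) k - hat F (comp g) k := by
  have : ∀ i, ∀ᵐ k ∂μ, F (comp (f - g) i) k = F (comp f i) k - F (comp g i) k := fun i => by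
    rw [comp_sub]
    exact M.sub (hf i) (hg i)
  filter_upwards [ae_all_iff.2 this] with k hk
  ext i
  simpa using hk i

/-- Pairing `κ · û` with the transform of a test function and integrating by parts gives the
integral of the divergence against the test function. -/
theorem inner_hat_eq_zero (M : IsFourierModel Ω μ κ F lam A) (h : IsSmoothSolution Ω ν T u p)
    {t : ℝ} (ht : t ∈ Ioo 0 T) : ∀ᵐ k ∂μ, inner ℂ (hat F (comp (u t)) k) (cpx (κ k)) = 0 := by
  have hmem : ∀ i, MemLp (comp (u t) i) 2 (vol Ω) := h.memLp_comp (Ioo_subset_Ico_self ht)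
  have hi : ∀ i φ, IsTest Ω φ →
      Integrable (fun k => conj (F (comp (u t) i) k) * (((κ k i : ℝ) : ℂ) * F φ k)) μ :=
    fun i φ hφ => integrable_conj_mul (M.memLp _ (hmem i)) (M.memLp_wave_mul_test hφ i)
  have hform : ∀ φ k, conj (∑ i, ((κ k i : ℝ) : ℂ) * F (comp (u t) i) k) * F φ k =
      ∑ i, conj (F (comp (u t) i) k) * (((κ k i : ℝ) : ℂ) * F φ k) := by
    intro φ k
    rw [map_sum, Finset.sum_mul]
    refine Finset.sum_congr rfl fun i _ => ?_
    rw [map_mul, Complex.conj_ofReal]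
    ring
  have h0 := M.ae_eq_zero (fun k => ∑ i, ((κ k i : ℝ) : ℂ) * F (comp (u t) i) k)
    (fun φ hφ => by
      simp only [hform]
      exact integrable_finsetSum _ fun i _ => hi i φ hφ)
    (fun φ hφ => by
      simp only [hform]
      rw [integral_finsetSum _ fun i _ => hi i φ hφ]
      have h1 : ∀ i, ∫ k, conj (F (comp (u t) i) k) * (((κ k i : ℝ) : ℂ) * F φ k) ∂μ =
          Complex.I * (lam : ℂ)⁻¹ * ∫ x, pd i (comp (u t) i) x * φ x ∂(vol Ω) := by
        intro i
        have h2 : ∫ k, conj (F (comp (u t) i) k) * (((κ k i : ℝ) : ℂ) * F φ k) ∂μ =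
            -Complex.I * ∫ k, conj (F (comp (u t) i) k) * F (pd i φ) k ∂μ := by
          rw [← integral_const_mul]
          refine integral_congr_ae ?_
          filter_upwards [M.pd_test hφ i] with k hk
          rw [hk]
          linear_combination (conj (F (comp (u t) i) k) * (((κ k i : ℝ) : ℂ) * F φ k)) *
            Complex.I_sq
        rw [h2, M.integral_conj_mul (hmem i) (hφ.pd i).memLp_two,
          integral_pd_mul_eq_neg (contDiff_comp (h.contDiff_velocity ht) i)
          (isFieldOn_comp (h.velocity_field t (Ioo_subset_Ico_self ht)) i) hφ]
        simp only [comp, Complex.conj_ofReal]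
        ring
      simp only [h1]
      rw [← Finset.mul_sum, ← integral_finsetSum _ fun i _ => hφ.integrable_mul
        (contDiff_pd (contDiff_comp (h.contDiff_velocity ht) i) i).continuous]
      simp only [← Finset.sum_mul, h.sum_pd_comp ht, zero_mul, integral_zero, mul_zero])
  filter_upwards [h0] with k hk
  rw [inner_C3]
  have h1 := congrArg conj hk
  simp only [Pi.zero_apply, map_zero, map_sum, map_mul, Complex.conj_ofReal] at h1
  rw [← h1]
  exact Finset.sum_congr rfl fun i _ => by rw [hat_apply, cpx_apply, mul_comm]

/-- `IsAmplitude` asks for its identities at every frequency, while the transform satisfies them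
almost everywhere; a suitable representative is chosen. -/
theorem exists_amplitude [MeasurableNeg K] [μ.IsNegInvariant]
    (M : IsFourierModel Ω μ κ F lam A) (h : IsSmoothSolution Ω ν T u p)
    (t : ℝ) : ∃ a : K → C3, (t ∈ Ico 0 T → a =ᵐ[μ] hat F (comp (u t))) ∧
      (t ∈ Ioo 0 T → IsAmplitude μ κ a) := by
  by_cases ht : t ∈ Ioo 0 T
  swap
  · exact ⟨hat F (comp (u t)), fun _ => EventuallyEq.rfl, fun h => absurd h ht⟩
  have hmem : ∀ i, MemLp (comp (u t) i) 2 (vol Ω) := h.memLp_comp (Ioo_subset_Ico_self ht)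
  set b := hat F (comp (u t)) with hb
  have hbm : Measurable b := M.measurable_hat hmem
  have hκ := M.measurable_wave
  -- Both conditions are imposed at `k` and `-k`, so that `G` is symmetric and setting the amplitude
  -- to zero off `G` keeps the conjugation symmetry.
  set G : Set K := {k | inner ℂ (b k) (cpx (κ k)) = 0 ∧ inner ℂ (b (-k)) (cpx (κ (-k))) = 0 ∧
    ∀ i, b (-k) i = conj (b k i)} with hG
  have hc : Measurable fun k => inner ℂ (b k) (cpx (κ k)) :=
    hbm.inner (measurable_cpx.comp hκ)
  have hGm : MeasurableSet G := by
    refine (hc (measurableSet_singleton 0)).inter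
      (((hc.comp measurable_neg) (measurableSet_singleton 0)).inter ?_)
    have : {k | ∀ i, b (-k) i = conj (b k i)} = ⋂ i, {k | b (-k) i = conj (b k i)} := by
      ext k; simp
    change MeasurableSet {k | ∀ i, b (-k) i = conj (b k i)}
    rw [this]
    refine MeasurableSet.iInter fun i => measurableSet_eq_fun ?_ ?_
    · fun_prop
    · exact Complex.continuous_conj.measurable.comp (by fun_prop)
  have hGneg : ∀ k, k ∈ G → -k ∈ G := by
    rintro k ⟨h1, h2, h3⟩
    refine ⟨h2, by rwa [neg_neg], fun i => ?_⟩
    rw [neg_neg, h3 i, Complex.conj_conj]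
  have hGae : ∀ᵐ k ∂μ, k ∈ G := by
    have h1 := M.inner_hat_eq_zero h ht
    have h2 := (Measure.measurePreserving_neg μ).quasiMeasurePreserving.ae h1
    have h3 : ∀ i, ∀ᵐ k ∂μ, b (-k) i = conj (b k i) := fun i =>
      M.conj_symm (hmem i) fun x => Complex.conj_ofReal _
    filter_upwards [h1, h2, ae_all_iff.2 h3] with k h1 h2 h3 using ⟨h1, h2, h3⟩
  have hae : G.indicator b =ᵐ[μ] b := by
    filter_upwards [hGae] with k hk using indicator_of_mem hk b
  refine ⟨G.indicator b, fun _ => hae, fun _ => ⟨hbm.indicator hGm, fun k => ?_, fun k i => ?_,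
    fun m => ?_⟩⟩
  · by_cases hk : k ∈ G
    · rw [indicator_of_mem hk, hk.1]
    · rw [indicator_of_notMem hk, inner_zero_left]
  · by_cases hk : k ∈ G
    · rw [indicator_of_mem hk, indicator_of_mem (hGneg k hk), hk.2.2 i]
    · have hk' : -k ∉ G := fun h => hk (by simpa using hGneg _ h)
      rw [indicator_of_notMem hk, indicator_of_notMem hk']
      simp
  · have h1 := rpow_half_lt_top.1 (h.sobolev_finite t ht m)
    rw [M.spectralIntegral_eq (by fun_prop) hmem] at h1
    have h2 : ∫⁻ k, ENNReal.ofReal ((1 + ‖κ k‖ ^ 2) ^ m) * ‖b k‖ₑ ^ 2 ∂μ < ⊤ := by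
      refine lt_top_iff_ne_top.2 fun h3 => ?_
      rw [h3, ENNReal.mul_top (by simpa using M.lam_pos)] at h1
      exact absurd h1 (lt_irrefl _)
    refine lt_of_le_of_lt (lintegral_mono_ae ?_) h2
    filter_upwards [hae] with k hk
    rw [hk]

end IsFourierModel

end NavierStokes

/-! ### Transfer of norms and of the weak equation to the Fourier side. -/

namespace NavierStokes

open scoped ComplexConjugate

variable {K : Type*} [AddCommGroup K] [MeasurableSpace K]

theorem sobolevNorm_sq (Ω : Domain) (m : ℕ) (f : E3 → E3) : sobolevNorm Ω m f ^ 2 =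
    spectralIntegral Ω (fun ξ => ENNReal.ofReal ((1 + ‖ξ‖ ^ 2) ^ m)) f := by
  rw [sobolevNorm, ← ENNReal.rpow_natCast, ← ENNReal.rpow_mul]
  norm_num

theorem ofReal_integral_norm_sq {X : Type*} [MeasurableSpace X] {μ : Measure X} {g : X → ℂ}
    (hg : MemLp g 2 μ) : ∫⁻ x, ‖g x‖ₑ ^ 2 ∂μ = ENNReal.ofReal (∫ x, conj (g x) * g x ∂μ).re := by
  have h1 : ∀ x, conj (g x) * g x = ((‖g x‖ ^ 2 : ℝ) : ℂ) := by
    intro x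
    rw [mul_comm, Complex.mul_conj, Complex.normSq_eq_norm_sq]
  simp only [h1]
  rw [integral_complex_ofReal, Complex.ofReal_re,
    ofReal_integral_eq_lintegral_ofReal ((memLp_two_iff_integrable_sq_norm hg.1).1 hg)
      (Eventually.of_forall fun x => by positivity)]
  simp only [ENNReal.ofReal_pow (norm_nonneg _), ofReal_norm]

namespace IsFourierModel

variable {Ω : Domain} {μ : Measure K} {κ : K →+ E3} {F : (E3 → ℂ) → K → ℂ} {lam A : ℝ}
variable {ν T : ℝ} {u : ℝ → E3 → E3} {p : ℝ → E3 → ℝ}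

theorem lintegral_enorm_sq (M : IsFourierModel Ω μ κ F lam A) {f : E3 → E3}
    (hf : ∀ i, MemLp (comp f i) 2 (vol Ω)) :
    ∫⁻ x, ‖f x‖ₑ ^ 2 ∂(vol Ω) = ENNReal.ofReal lam * ∫⁻ k, ‖hat F (comp f) k‖ₑ ^ 2 ∂μ := by
  have h1 : ∀ x, ‖f x‖ₑ ^ 2 = ∑ i, ‖comp f i x‖ₑ ^ 2 := by
    intro x
    rw [← enorm_sq_C3 (WithLp.toLp 2 fun i => comp f i x)]
    congr 1
    simp only [← ofReal_norm]
    rw [← norm_cpx]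
    rfl
  have h2 : ∀ i, ∫⁻ x, ‖comp f i x‖ₑ ^ 2 ∂(vol Ω) =
      ENNReal.ofReal lam * ∫⁻ k, ‖F (comp f i) k‖ₑ ^ 2 ∂μ := by
    intro i
    rw [ofReal_integral_norm_sq (hf i), ofReal_integral_norm_sq (M.memLp _ (hf i)),
      ← ENNReal.ofReal_mul M.lam_pos.le, M.parseval _ _ (hf i) (hf i), Complex.re_ofReal_mul]
  simp only [h1, enorm_sq_C3, hat_apply]
  rw [lintegral_finsetSum' _ fun i _ => (hf i).1.enorm.pow_const 2,
    lintegral_finsetSum _ fun i _ => (M.measurable _ (hf i)).enorm.pow_const 2, Finset.mul_sum]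
  exact Finset.sum_congr rfl fun i _ => h2 i

theorem lintegral_enorm_sub_sq (M : IsFourierModel Ω μ κ F lam A) {f g : E3 → E3} {a b : K → C3}
    (hf : ∀ i, MemLp (comp f i) 2 (vol Ω)) (hg : ∀ i, MemLp (comp g i) 2 (vol Ω))
    (ha : a =ᵐ[μ] hat F (comp f)) (hb : b =ᵐ[μ] hat F (comp g)) :
    ∫⁻ x, ‖f x - g x‖ₑ ^ 2 ∂(vol Ω) =
      ENNReal.ofReal (lam * ‖toL2 μ a - toL2 μ b‖ ^ 2) := by
  have hfg : ∀ i, MemLp (comp (f - g) i) 2 (vol Ω) := fun i => by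
    rw [comp_sub]; exact (hf i).sub (hg i)
  have ha2 : MemLp a 2 μ := (memLp_congr_ae ha).2 (M.memLp_hat hf)
  have hb2 : MemLp b 2 μ := (memLp_congr_ae hb).2 (M.memLp_hat hg)
  rw [toL2_sub ha2 hb2, ENNReal.ofReal_mul M.lam_pos.le, norm_toL2_sq (ha2.sub hb2)]
  refine (M.lintegral_enorm_sq hfg).trans ?_
  congr 1
  refine lintegral_congr_ae ?_
  filter_upwards [M.hat_sub hf hg, ha, hb] with k h1 h2 h3
  rw [h1, Pi.sub_apply, h2, h3]

theorem spectralIntegral_sub_eq (M : IsFourierModel Ω μ κ F lam A) {W : E3 → ℝ≥0∞}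
    (hW : Measurable W) {f g : E3 → E3} {a b : K → C3}
    (hf : ∀ i, MemLp (comp f i) 2 (vol Ω)) (hg : ∀ i, MemLp (comp g i) 2 (vol Ω))
    (ha : a =ᵐ[μ] hat F (comp f)) (hb : b =ᵐ[μ] hat F (comp g)) :
    spectralIntegral Ω W (f - g) =
      ENNReal.ofReal lam * ∫⁻ k, W (κ k) * ‖a k - b k‖ₑ ^ 2 ∂μ := by
  have hfg : ∀ i, MemLp (comp (f - g) i) 2 (vol Ω) := fun i => by
    rw [comp_sub]; exact (hf i).sub (hg i)
  rw [M.spectralIntegral_eq hW hfg]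
  congr 1
  refine lintegral_congr_ae ?_
  filter_upwards [M.hat_sub hf hg, ha, hb] with k h1 h2 h3
  rw [h1, h2, h3]

theorem inner_toL2_hat (M : IsFourierModel Ω μ κ F lam A) {f : E3 → E3} {a : K → C3}
    (hf : ∀ i, MemLp (comp f i) 2 (vol Ω)) (ha : a =ᵐ[μ] hat F (comp f)) {φ : Fin 3 → E3 → ℂ}
    (hφ : ∀ j, IsTest Ω (φ j)) :
    inner ℂ (toL2 μ a) (toL2 μ (hat F φ)) =
      (lam : ℂ)⁻¹ * ∑ j, ∫ x, comp f j x * φ j x ∂(vol Ω) := by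
  have ha2 : MemLp a 2 μ := (memLp_congr_ae ha).2 (M.memLp_hat hf)
  rw [M.integral_inner_hat _ fun j => (hφ j).memLp_two, Finset.mul_sum]
  refine Finset.sum_congr rfl fun j _ => ?_
  have h1 := M.integral_conj_mul (hf j) (hφ j).memLp_two
  simp only [comp, Complex.conj_ofReal] at h1
  rw [show ∫ x, comp f j x * φ j x ∂(vol Ω) = ∫ x, ((f x j : ℝ) : ℂ) * φ j x ∂(vol Ω) from rfl,
    ← h1]
  refine integral_congr_ae ?_
  filter_upwards [coeFn_toL2 ha2, ha] with k h2 h3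
  rw [h2, h3]
  rfl

variable [MeasurableAdd₂ K] [MeasurableNeg K] [SFinite μ] [μ.IsAddLeftInvariant]

/-- Parseval's identity and the convolution theorem. The product is formed between the velocity and
a derivative of the test field, so it is again a test function and its transform is unproblematic.
-/
theorem weakRHS_eq (M : IsFourierModel Ω μ κ F lam A) (h : IsSmoothSolution Ω ν T u p) {t : ℝ}
    (ht : t ∈ Ioo 0 T) {a : K → C3} (ha : IsAmplitude μ κ a) (hau : a =ᵐ[μ] hat F (comp (u t)))
    {φ : Fin 3 → E3 → ℂ} (hφ : ∀ j, IsTest Ω (φ j)) :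
    weakRHS μ κ ν a (hat F φ) = (lam : ℂ)⁻¹ *
      ∑ j, (∑ i, ∫ x, comp (u t) i x * comp (u t) j x * pd i (φ j) x ∂(vol Ω) +
        ν * ∑ i, ∫ x, comp (u t) j x * pd i (pd i (φ j)) x ∂(vol Ω)) := by
  have hmem : ∀ i, MemLp (comp (u t) i) 2 (vol Ω) := h.memLp_comp (Ioo_subset_Ico_self ht)
  have hφ2 : ∀ j, MemLp (φ j) 2 (vol Ω) := fun j => (hφ j).memLp_two
  have hconj : ∀ i x, conj (comp (u t) i x) = comp (u t) i x := fun i x => Complex.conj_ofReal _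
  have hcont : ∀ i, Continuous (comp (u t) i) := fun i =>
    (contDiff_comp (h.contDiff_velocity ht) i).continuous
  have hprod : ∀ i j, IsTest Ω (fun x => comp (u t) j x * pd i (φ j) x) := fun i j =>
    ((hφ j).pd i).mul_left (contDiff_comp (h.contDiff_velocity ht) j)
      (isFieldOn_comp (h.velocity_field t (Ioo_subset_Ico_self ht)) j)
  have haF : ∀ i, (fun k => a k i) =ᵐ[μ] F (comp (u t) i) := fun i => by
    filter_upwards [hau] with k hk
    rw [hk, hat_apply]
  have hvisc : ∫ k, ((‖κ k‖ ^ 2 : ℝ) : ℂ) * inner ℂ (a k) (hat F φ k) ∂μ =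
      -((lam : ℂ)⁻¹ * ∑ j, ∑ i, ∫ x, comp (u t) j x * pd i (pd i (φ j)) x ∂(vol Ω)) := by
    have h1 : ∀ᵐ k ∂μ, ((‖κ k‖ ^ 2 : ℝ) : ℂ) * inner ℂ (a k) (hat F φ k) =
        -∑ j, ∑ i, conj (F (comp (u t) j) k) * F (pd i (pd i (φ j))) k := by
      have h2 : ∀ᵐ k ∂μ, ∀ j i, F (pd i (pd i (φ j))) k =
          -(((κ k i : ℝ) : ℂ) ^ 2 * F (φ j) k) := by
        refine ae_all_iff.2 fun j => ae_all_iff.2 fun i => ?_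
        filter_upwards [M.pd_test ((hφ j).pd i) i, M.pd_test (hφ j) i] with k h3 h4
        rw [h3, h4]
        linear_combination (((κ k i : ℝ) : ℂ) ^ 2 * F (φ j) k) * Complex.I_sq
      filter_upwards [h2, hau] with k h2 h3
      simp only [h2, h3, inner_C3, hat_apply, mul_neg, Finset.sum_neg_distrib, neg_neg]
      rw [EuclideanSpace.norm_sq_eq, Finset.mul_sum]
      refine Finset.sum_congr rfl fun j _ => ?_
      simp only [Real.norm_eq_abs, sq_abs, Complex.ofReal_sum, Complex.ofReal_pow, Finset.sum_mul]
      exact Finset.sum_congr rfl fun i _ => by ring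
    have hi : ∀ j i, Integrable (fun k => conj (F (comp (u t) j) k) * F (pd i (pd i (φ j))) k) μ :=
      fun j i => integrable_conj_mul (M.memLp _ (hmem j)) (M.memLp_test (((hφ j).pd i).pd i))
    rw [integral_congr_ae h1, integral_neg, integral_finsetSum _ fun j _ =>
      integrable_finsetSum _ fun i _ => hi j i, Finset.mul_sum]
    congr 1
    refine Finset.sum_congr rfl fun j _ => ?_
    rw [integral_finsetSum _ fun i _ => hi j i, Finset.mul_sum]
    refine Finset.sum_congr rfl fun i _ => ?_
    rw [M.integral_conj_mul (hmem j) (((hφ j).pd i).pd i).memLp_two]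
    simp only [hconj]
  have htrans : ∫ z, transportIntegrand κ a (hat F φ) z ∂(μ.prod μ) =
      (lam : ℂ)⁻¹ * ∑ j, ∑ i, ∫ x, comp (u t) i x * comp (u t) j x * pd i (φ j) x ∂(vol Ω) := by
    have hfin : ∫⁻ k, ‖hat F φ k‖ₑ ^ 2 ∂μ < ⊤ := by
      rw [← norm_toL2_sq (M.memLp_hat hφ2)]; exact ENNReal.ofReal_lt_top
    -- Integrating first over the output frequency turns the inner integral into the convolution of
    -- `conj_mul`; Parseval then treats the outer one.
    rw [integral_prod _ (integrable_transportIntegrand M.measurable_wave ha M.decay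
      (M.measurable_hat hφ2) hfin)]
    have h1 : ∀ᵐ l ∂μ, ∫ k, transportIntegrand κ a (hat F φ) (l, k) ∂μ =
        ∑ j, ∑ i, conj (F (comp (u t) i) l) * F (fun x => comp (u t) j x * pd i (φ j) x) l := by
      have h2 : ∀ᵐ l ∂μ, ∀ j i, F (fun x => comp (u t) j x * pd i (φ j) x) l =
          ∫ k, conj (F (comp (u t) j) (k - l)) * F (pd i (φ j)) k ∂μ := by
        refine ae_all_iff.2 fun j => ae_all_iff.2 fun i => ?_
        have h3 := M.conj_mul (hmem j) ((hφ j).pd i)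
        simp only [hconj] at h3
        exact h3 (hprod i j).memLp_two
      filter_upwards [h2, hau] with l h2 h3
      have hshift : ∀ j, MemLp (fun k => F (comp (u t) j) (k - l)) 2 μ := fun j =>
        (M.memLp _ (hmem j)).comp_measurePreserving (measurePreserving_sub_right μ l)
      have hi : ∀ j i, Integrable
          (fun k => conj (F (comp (u t) j) (k - l)) * F (pd i (φ j)) k) μ := fun j i =>
        integrable_conj_mul (hshift j) (M.memLp_test ((hφ j).pd i))
      have h4 : ∀ᵐ k ∂μ, transportIntegrand κ a (hat F φ) (l, k) =
          ∑ j, ∑ i, conj (F (comp (u t) i) l) *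
            (conj (F (comp (u t) j) (k - l)) * F (pd i (φ j)) k) := by
        have h5 : ∀ᵐ k ∂μ, ∀ j i, F (pd i (φ j)) k =
            Complex.I * ((κ k i : ℝ) : ℂ) * F (φ j) k :=
          ae_all_iff.2 fun j => ae_all_iff.2 fun i => M.pd_test (hφ j) i
        have h6 := (measurePreserving_sub_right μ l).quasiMeasurePreserving.ae hau
        filter_upwards [h5, h6] with k h5 h6
        simp only [transportIntegrand, h3, h6, inner_C3, hat_apply, cpx_apply, h5]
        rw [mul_comm (∑ i, _) (∑ i, _), Finset.sum_mul, Finset.mul_sum]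
        refine Finset.sum_congr rfl fun j _ => ?_
        rw [Finset.mul_sum, Finset.mul_sum]
        refine Finset.sum_congr rfl fun i _ => ?_
        ring
      rw [integral_congr_ae h4, integral_finsetSum _ fun j _ =>
        integrable_finsetSum _ fun i _ => (hi j i).const_mul _]
      refine Finset.sum_congr rfl fun j _ => ?_
      rw [integral_finsetSum _ fun i _ => (hi j i).const_mul _]
      refine Finset.sum_congr rfl fun i _ => ?_
      rw [integral_const_mul, h2]
    have hi : ∀ j i, Integrable (fun l => conj (F (comp (u t) i) l) *
        F (fun x => comp (u t) j x * pd i (φ j) x) l) μ := fun j i =>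
      integrable_conj_mul (M.memLp _ (hmem i)) (M.memLp_test (hprod i j))
    rw [integral_congr_ae h1, integral_finsetSum _ fun j _ =>
      integrable_finsetSum _ fun i _ => hi j i, Finset.mul_sum]
    refine Finset.sum_congr rfl fun j _ => ?_
    rw [integral_finsetSum _ fun i _ => hi j i, Finset.mul_sum]
    refine Finset.sum_congr rfl fun i _ => ?_
    rw [M.integral_conj_mul (hmem i) (hprod i j).memLp_two]
    simp only [hconj, mul_assoc]
  rw [weakRHS, htrans, hvisc, Finset.sum_add_distrib, ← Finset.mul_sum]
  ring

end IsFourierModel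

end NavierStokes

/-! ### From smooth solutions to evolutions on the Fourier side. -/

namespace NavierStokes

open scoped ComplexConjugate

variable {K : Type*} [AddCommGroup K] [MeasurableSpace K]

theorem enorm_add_sq_le {E : Type*} [SeminormedAddCommGroup E] (x y : E) :
    ‖x + y‖ₑ ^ 2 ≤ 2 * ‖x‖ₑ ^ 2 + 2 * ‖y‖ₑ ^ 2 := by
  simp only [← ofReal_norm, ← ENNReal.ofReal_pow (norm_nonneg _)]
  rw [← ENNReal.ofReal_ofNat 2, ← ENNReal.ofReal_mul (by norm_num),
    ← ENNReal.ofReal_mul (by norm_num), ← ENNReal.ofReal_add (by positivity) (by positivity)]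
  apply ENNReal.ofReal_le_ofReal
  have h1 := norm_add_le x y
  have h2 : ‖x + y‖ ^ 2 ≤ (‖x‖ + ‖y‖) ^ 2 := by gcongr
  nlinarith [sq_nonneg (‖x‖ - ‖y‖)]

theorem enorm_sub_sq_le {E : Type*} [SeminormedAddCommGroup E] (x y : E) :
    ‖x - y‖ₑ ^ 2 ≤ 2 * ‖x‖ₑ ^ 2 + 2 * ‖y‖ₑ ^ 2 := by
  rw [sub_eq_add_neg]
  simpa using enorm_add_sq_le x (-y)

theorem lintegral_mul_sq_le {X E : Type*} [MeasurableSpace X] {μ : Measure X}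
    [SeminormedAddCommGroup E] {W : X → ℝ≥0∞} (hW : Measurable W) {f g h : X → E}
    (hf : AEStronglyMeasurable f μ)
    (hle : ∀ k, ‖h k‖ₑ ^ 2 ≤ 2 * ‖f k‖ₑ ^ 2 + 2 * ‖g k‖ₑ ^ 2) :
    ∫⁻ k, W k * ‖h k‖ₑ ^ 2 ∂μ ≤
      2 * ∫⁻ k, W k * ‖f k‖ₑ ^ 2 ∂μ + 2 * ∫⁻ k, W k * ‖g k‖ₑ ^ 2 ∂μ := by
  have hm : AEMeasurable (fun k => W k * ‖f k‖ₑ ^ 2) μ :=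
    hW.aemeasurable.mul (hf.enorm.pow_const 2)
  rw [← lintegral_const_mul'' _ hm, ← lintegral_const_mul' _ _ (by norm_num),
    ← lintegral_add_left' (hm.const_mul 2)]
  refine lintegral_mono fun k => ?_
  calc W k * ‖h k‖ₑ ^ 2 ≤ W k * (2 * ‖f k‖ₑ ^ 2 + 2 * ‖g k‖ₑ ^ 2) := by gcongr; exact hle k
    _ = _ := by ring

theorem tendsto_of_tendsto_ofReal_mul_sq {ι E : Type*} [SeminormedAddCommGroup E] {l : Filter ι}
    {f : ι → E} {y : E} {c : ℝ} (hc : 0 < c)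
    (h : Tendsto (fun s => ENNReal.ofReal (c * ‖f s - y‖ ^ 2)) l (𝓝 0)) : Tendsto f l (𝓝 y) := by
  rw [tendsto_iff_norm_sub_tendsto_zero]
  have h1 := (ENNReal.tendsto_toReal ENNReal.zero_ne_top).comp h
  have h2 : ∀ s, (ENNReal.ofReal (c * ‖f s - y‖ ^ 2)).toReal = c * ‖f s - y‖ ^ 2 := fun s =>
    ENNReal.toReal_ofReal (by positivity)
  simp only [Function.comp_def, h2, ENNReal.toReal_zero] at h1
  have h3 := (h1.const_mul c⁻¹).sqrt
  simpa [← mul_assoc, hc.ne'] using h3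

theorem eLpNorm_two_sq {X E : Type*} [MeasurableSpace X] {μ : Measure X}
    [NormedAddCommGroup E] (f : X → E) : eLpNorm f 2 μ ^ 2 = ∫⁻ x, ‖f x‖ₑ ^ 2 ∂μ := by
  rw [eLpNorm_eq_lintegral_rpow_enorm_toReal two_ne_zero ENNReal.ofNat_ne_top,
    ← ENNReal.rpow_natCast, ← ENNReal.rpow_mul]
  norm_num

namespace IsFourierModel

variable {Ω : Domain} {μ : Measure K} {κ : K →+ E3} {F : (E3 → ℂ) → K → ℂ} {lam A : ℝ}
variable {ν T : ℝ} {u : ℝ → E3 → E3} {p : ℝ → E3 → ℝ}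
-- Bookkeeping of constants: squaring the norm produces Parseval's factor `lam`, hence the constant
-- `√(lam / (36A))` in the theorem.
theorem lintegral_lt_of_homSobolevNorm_lt (M : IsFourierModel Ω μ κ F lam A) {f : E3 → E3}
    {a : K → C3} (hf : ∀ i, MemLp (comp f i) 2 (vol Ω)) (ha : a =ᵐ[μ] hat F (comp f)) {s : ℝ}
    (hs : 0 < s) (hν : 0 < ν)
    (h : homSobolevNorm Ω (3 / 2) f < ENNReal.ofReal (√(lam / (36 * A)) * √ν / √s)) :
    ∫⁻ k, ENNReal.ofReal (‖κ k‖ ^ 3) * ‖a k‖ₑ ^ 2 ∂μ < ENNReal.ofReal (ν / (36 * A * s)) := by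
  have hA := M.low_pos
  have hl := M.lam_pos
  have h1 : homSobolevNorm Ω (3 / 2) f ^ 2 < ENNReal.ofReal (lam * (ν / (36 * A * s))) := by
    have h2 : ENNReal.ofReal (lam * (ν / (36 * A * s))) =
        ENNReal.ofReal (√(lam / (36 * A)) * √ν / √s) ^ 2 := by
      rw [← ENNReal.ofReal_pow (by positivity), div_pow, mul_pow, Real.sq_sqrt (by positivity),
        Real.sq_sqrt hν.le, Real.sq_sqrt hs.le]
      congr 1
      field_simp
    rw [h2]
    exact ENNReal.pow_lt_pow_left two_ne_zero h
  have h3 : homSobolevNorm Ω (3 / 2) f ^ 2 =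
      ENNReal.ofReal lam * ∫⁻ k, ENNReal.ofReal (‖κ k‖ ^ 3) * ‖a k‖ₑ ^ 2 ∂μ := by
    rw [homSobolevNorm, ← ENNReal.rpow_natCast, ← ENNReal.rpow_mul, M.spectralIntegral_eq
      (by fun_prop) hf]
    norm_num
    congr 1
    refine lintegral_congr_ae ?_
    filter_upwards [ha] with k hk
    rw [hk]
  rw [h3, ENNReal.ofReal_mul hl.le] at h1
  exact lt_of_mul_lt_mul_left' h1

variable [MeasurableAdd₂ K] [MeasurableNeg K] [SFinite μ] [μ.IsAddLeftInvariant] [μ.IsNegInvariant]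

/-- The Fourier transform of a smooth solution solves the weak form of the Navier–Stokes
equations on the Fourier side. -/
theorem exists_isEvolution (M : IsFourierModel Ω μ κ F lam A) (h : IsSmoothSolution Ω ν T u p) :
    ∃ a : ℝ → K → C3, (∀ t ∈ Ico 0 T, a t =ᵐ[μ] hat F (comp (u t))) ∧
      IsEvolution μ κ ν T (testSpectra Ω μ F) a := by
  choose a hau hamp using M.exists_amplitude h
  have hκ := M.measurable_wave
  have hmem : ∀ t ∈ Ico 0 T, ∀ i, MemLp (comp (u t) i) 2 (vol Ω) := fun t ht => h.memLp_comp ht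
  have hmemL : ∀ t ∈ Ico 0 T, MemLp (a t) 2 μ := fun t ht =>
    (memLp_congr_ae (hau t ht)).2 (M.memLp_hat (hmem t ht))
  have hlt : ∀ t ∈ Ioo 0 T, Tendsto (fun s => spectralIntegral Ω
      (fun ξ => ENNReal.ofReal ((1 + ‖ξ‖ ^ 2) ^ 0)) (u s - u t)) (𝓝 t) (𝓝 0) := fun t ht => by
    have := (ENNReal.continuous_pow 2).continuousAt.tendsto.comp (h.sobolev_continuous t ht 0)
    simpa only [Function.comp_def, sobolevNorm_sq, zero_pow two_ne_zero] using this
  refine ⟨a, hau, hmemL, hamp, ?_, ?_, ?_, fun f hf => M.dense_testSpectra hf⟩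
  · intro t ht
    set W : E3 → ℝ≥0∞ := fun ξ => ENNReal.ofReal ((1 + ‖ξ‖ ^ 2) ^ 2) with hW
    have hWm : Measurable W := by fun_prop
    set X := (2 * ENNReal.ofReal lam⁻¹ + 2 * ∫⁻ k, W (κ k) * ‖a t k‖ₑ ^ 2 ∂μ) with hX
    have hXtop : X ≠ ⊤ := by
      have := (hamp t ht).sobolev 2
      exact ENNReal.add_ne_top.2 ⟨ENNReal.mul_ne_top (by norm_num) ENNReal.ofReal_ne_top,
        ENNReal.mul_ne_top (by norm_num) this.ne⟩
    refine ⟨X.toReal, ?_⟩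
    rw [ENNReal.ofReal_toReal hXtop]
    -- Near `t` the `H²` distance to `u t` is at most `1`, which bounds the `H²` norm locally
    -- uniformly.
    filter_upwards [(h.sobolev_continuous t ht 2).eventually_le_const (zero_lt_one (α := ℝ≥0∞)),
      Ioo_mem_nhds ht.1 ht.2] with s hs1 hs
    have hs' := Ioo_subset_Ico_self hs
    have ht' := Ioo_subset_Ico_self ht
    have h1 : sobolevNorm Ω 2 (u s - u t) ^ 2 ≤ 1 := pow_le_one₀ zero_le hs1
    rw [sobolevNorm_sq, M.spectralIntegral_sub_eq hWm (hmem s hs') (hmem t ht') (hau s hs')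
      (hau t ht')] at h1
    have h2 : ∫⁻ k, W (κ k) * ‖a s k - a t k‖ₑ ^ 2 ∂μ ≤ ENNReal.ofReal lam⁻¹ := by
      rw [ENNReal.ofReal_inv_of_pos M.lam_pos]
      exact ENNReal.le_inv_iff_mul_le.2 (by rwa [mul_comm])
    refine (lintegral_mul_sq_le (hWm.comp hκ) (f := fun k => a s k - a t k) (g := a t)
      ((hmemL s hs').sub (hmemL t ht')).1 fun k => ?_).trans
      (add_le_add (mul_le_mul' le_rfl h2) le_rfl)
    simpa using enorm_add_sq_le (a s k - a t k) (a t k)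
  · intro t ht
    rcases eq_or_lt_of_le ht.1 with rfl | h0
    -- At the initial time only the `L²` attainment of the data is available; at later times
    -- continuity in `H⁰` is used.
    · have h1 : ContinuousWithinAt (fun t => toL2 μ (a t)) (Ioi 0) 0 := by
        refine tendsto_of_tendsto_ofReal_mul_sq M.lam_pos ?_
        have h2 := (ENNReal.continuous_pow 2).continuousAt.tendsto.comp h.initial_attained
        simp only [Function.comp_def, eLpNorm_two_sq, zero_pow two_ne_zero] at h2
        refine h2.congr' ?_
        filter_upwards [Ioo_mem_nhdsGT ht.2] with s hs
        have hs' := Ioo_subset_Ico_self hs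
        exact M.lintegral_enorm_sub_sq (hmem s hs') (hmem 0 ht) (hau s hs') (hau 0 ht)
      exact (continuousWithinAt_Ioi_iff_Ici.1 h1).mono Ico_subset_Ici_self
    · have ht' : t ∈ Ioo 0 T := ⟨h0, ht.2⟩
      refine ContinuousAt.continuousWithinAt ?_
      refine tendsto_of_tendsto_ofReal_mul_sq M.lam_pos ?_
      refine (hlt t ht').congr' ?_
      filter_upwards [Ioo_mem_nhds h0 ht.2] with s hs
      have hs' := Ioo_subset_Ico_self hs
      rw [M.spectralIntegral_sub_eq (by fun_prop) (hmem s hs') (hmem t ht) (hau s hs')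
        (hau t ht), ← M.lintegral_enorm_sub_sq (hmem s hs') (hmem t ht) (hau s hs') (hau t ht)]
      have := M.lintegral_enorm_sub_sq (hmem s hs') (hmem t ht) (hau s hs') (hau t ht)
      rw [this, toL2_sub (hmemL s hs') (hmemL t ht), ENNReal.ofReal_mul M.lam_pos.le,
        norm_toL2_sq ((hmemL s hs').sub (hmemL t ht))]
      simp
  · rintro _ ⟨φ, hφ, hdiv, rfl⟩ t ht
    have h1 := (h.weak_form ht hφ hdiv).const_mul (lam : ℂ)⁻¹
    rw [← M.weakRHS_eq h ht (hamp t ht) (hau t (Ioo_subset_Ico_self ht)) hφ,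
      ← weakRHS_congr (coeFn_toL2 (M.memLp_hat fun j => (hφ j).memLp_two))] at h1
    refine h1.congr_of_eventuallyEq ?_
    filter_upwards [Ioo_mem_nhds ht.1 ht.2] with s hs
    have hs' := Ioo_subset_Ico_self hs
    exact M.inner_toL2_hat (hmem s hs') (hau s hs') hφ

end IsFourierModel

end NavierStokes

/-! ### The limit at the time `T`. -/

namespace NavierStokes

open scoped ComplexConjugate

variable {K : Type*} [AddCommGroup K] [MeasurableSpace K]

theorem memLp_of_comp {ν : Measure E3} {f : E3 → E3} (hf : ∀ i, MemLp (comp f i) 2 ν) :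
    MemLp f 2 ν := by
  rw [memLp_piLp_iff]
  exact fun i => (hf i).re

/-- Fatou's lemma for weighted `L²` bounds. -/
theorem lintegral_mul_enorm_sq_le_of_tendsto {X : Type*} [MeasurableSpace X] {μ : Measure X}
    {a : ℕ → X → C3} {b : X → C3} (ha : ∀ n, MemLp (a n) 2 μ) (hb : MemLp b 2 μ)
    (hlim : Tendsto (fun n => toL2 μ (a n)) atTop (𝓝 (toL2 μ b))) {W : X → ℝ≥0∞}
    (hW : Measurable W) {S : ℝ≥0∞} (hS : ∀ n, ∫⁻ k, W k * ‖a n k‖ₑ ^ 2 ∂μ ≤ S)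
    (hWtop : ∀ k, W k ≠ ⊤) :
    ∫⁻ k, W k * ‖b k‖ₑ ^ 2 ∂μ ≤ S := by
  have h1 : TendstoInMeasure μ (fun n => (toL2 μ (a n) : X → C3)) atTop (toL2 μ b) :=
    tendstoInMeasure_of_tendsto_Lp hlim
  obtain ⟨ns, -, hns⟩ := h1.exists_seq_tendsto_ae
  have h2 : ∀ᵐ k ∂μ, ∀ n, toL2 μ (a n) k = a n k := ae_all_iff.2 fun n => coeFn_toL2 (ha n)
  calc ∫⁻ k, W k * ‖b k‖ₑ ^ 2 ∂μ
      = ∫⁻ k, liminf (fun n => W k * ‖a (ns n) k‖ₑ ^ 2) atTop ∂μ := by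
        refine lintegral_congr_ae ?_
        filter_upwards [hns, h2, coeFn_toL2 hb] with k h3 h4 h5
        simp only [h4, h5] at h3
        refine (Tendsto.liminf_eq ?_).symm
        refine ENNReal.Tendsto.const_mul ?_ (Or.inr (hWtop k))
        exact ((ENNReal.continuous_pow 2).tendsto _).comp h3.enorm
    _ ≤ liminf (fun n => ∫⁻ k, W k * ‖a (ns n) k‖ₑ ^ 2 ∂μ) atTop :=
        lintegral_liminf_le' fun n => hW.aemeasurable.mul ((ha _).1.enorm.pow_const 2)
    _ ≤ S := by
        refine (liminf_le_liminf (v := fun _ => S) (Eventually.of_forall fun n => hS _)).trans ?_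
        simp

namespace IsFourierModel

variable {Ω : Domain} {μ : Measure K} {κ : K →+ E3} {F : (E3 → ℂ) → K → ℂ} {lam A : ℝ}
variable {ν T : ℝ} {u : ℝ → E3 → E3} {p : ℝ → E3 → ℝ}

/-- A curve that is Lipschitz in `L²` and bounded in every `Hᵐ` up to the time `T` extends
regularly to the time `T`. -/
theorem staysRegularUpTo (M : IsFourierModel Ω μ κ F lam A) {t₁ : ℝ} (ht₁ : t₁ < T)
    (hmem : ∀ t ∈ Ioo t₁ T, ∀ i, MemLp (comp (u t) i) 2 (vol Ω)) {a : ℝ → K → C3}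
    (hau : ∀ t ∈ Ioo t₁ T, a t =ᵐ[μ] hat F (comp (u t)))
    (hbd : ∀ m : ℕ, ∃ S : ℝ, ∀ t ∈ Ioo t₁ T,
      ∫⁻ k, ENNReal.ofReal ((1 + ‖κ k‖ ^ 2) ^ m) * ‖a t k‖ₑ ^ 2 ∂μ ≤ ENNReal.ofReal S)
    {C : ℝ} (hC : ∀ s ∈ Ioo t₁ T, ∀ t ∈ Ioo t₁ T,
      ‖toL2 μ (a s) - toL2 μ (a t)‖ ≤ C * |s - t|) : StaysRegularUpTo Ω u T := by
  have hκ := M.measurable_wave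
  have hl := M.lam_pos
  have hmemL : ∀ t ∈ Ioo t₁ T, MemLp (a t) 2 μ := fun t ht =>
    (memLp_congr_ae (hau t ht)).2 (M.memLp_hat (hmem t ht))
  have huL : ∀ t ∈ Ioo t₁ T, MemLp (u t) 2 (vol Ω) := fun t ht => memLp_of_comp (hmem t ht)
  obtain ⟨τ, -, hτ, hτlim⟩ := exists_seq_strictMono_tendsto' ht₁
  -- The limit is taken in physical space, by completeness of `L²` there, since the model does not
  -- assert that `F` is onto.
  set v : ℕ → Lp E3 2 (vol Ω) := fun n => (huL (τ n) (hτ n)).toLp (u (τ n)) with hv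
  have hdist : ∀ m n, dist (v m) (v n) =
      √lam * ‖toL2 μ (a (τ m)) - toL2 μ (a (τ n))‖ := by
    intro m n
    have h1 := M.lintegral_enorm_sub_sq (hmem _ (hτ m)) (hmem _ (hτ n)) (hau _ (hτ m))
      (hau _ (hτ n))
    have h2 : eLpNorm (u (τ m) - u (τ n)) 2 (vol Ω) =
        ENNReal.ofReal (√lam * ‖toL2 μ (a (τ m)) - toL2 μ (a (τ n))‖) := by
      refine (ENNReal.pow_right_strictMono two_ne_zero).injective ?_
      rw [eLpNorm_two_sq, ← ENNReal.ofReal_pow (by positivity), mul_pow, Real.sq_sqrt hl.le]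
      exact h1
    rw [Lp.dist_def, eLpNorm_congr_ae ((huL _ (hτ m)).coeFn_toLp.sub (huL _ (hτ n)).coeFn_toLp),
      h2, ENNReal.toReal_ofReal (by positivity)]
  have hcauchy : CauchySeq v := by
    refine Metric.cauchySeq_iff'.2 fun ε hε => ?_
    have h1 := Metric.cauchySeq_iff'.1 hτlim.cauchySeq (ε / (√lam * (|C| + 1))) (by positivity)
    obtain ⟨N, hN⟩ := h1
    refine ⟨N, fun n hn => ?_⟩
    have h2 := hN n hn
    rw [Real.dist_eq, lt_div_iff₀ (by positivity)] at h2
    rw [hdist]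
    calc √lam * ‖toL2 μ (a (τ n)) - toL2 μ (a (τ N))‖
        ≤ √lam * ((|C| + 1) * |τ n - τ N|) := by
          gcongr
          refine (hC _ (hτ n) _ (hτ N)).trans ?_
          gcongr
          linarith [le_abs_self C]
      _ = |τ n - τ N| * (√lam * (|C| + 1)) := by ring
      _ < ε := h2
  obtain ⟨w, hw⟩ := cauchySeq_tendsto_of_complete hcauchy
  have hwmem : ∀ i, MemLp (comp w i) 2 (vol Ω) := memLp_comp (Lp.memLp w)
  set b := hat F (comp w) with hb
  have hbL : MemLp b 2 μ := M.memLp_hat hwmem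
  have hlimb : Tendsto (fun n => toL2 μ (a (τ n))) atTop (𝓝 (toL2 μ b)) := by
    refine tendsto_of_tendsto_ofReal_mul_sq hl ?_
    have h1 : Tendsto (fun n => eLpNorm (fun x => u (τ n) x - w x) 2 (vol Ω)) atTop (𝓝 0) := by
      have := (Lp.tendsto_Lp_iff_tendsto_eLpNorm' v w).1 hw
      refine this.congr fun n => ?_
      exact eLpNorm_congr_ae ((huL _ (hτ n)).coeFn_toLp.sub EventuallyEq.rfl)
    have h2 := ((ENNReal.continuous_pow 2).tendsto 0).comp h1
    simp only [Function.comp_def, eLpNorm_two_sq, zero_pow two_ne_zero] at h2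
    refine h2.congr fun n => ?_
    exact M.lintegral_enorm_sub_sq (hmem _ (hτ n)) hwmem (hau _ (hτ n)) EventuallyEq.rfl
  -- Letting `n → ∞` in the Lipschitz bound upgrades convergence along `τ` to convergence as `t →
  -- T`.
  have hrate : ∀ t ∈ Ioo t₁ T, ‖toL2 μ (a t) - toL2 μ b‖ ≤ C * (T - t) := by
    intro t ht
    have h1 := (tendsto_const_nhds (x := toL2 μ (a t))).sub hlimb |>.norm
    have h2 : Tendsto (fun n => C * |t - τ n|) atTop (𝓝 (C * |t - T|)) :=
      ((tendsto_const_nhds.sub hτlim).abs).const_mul C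
    have h3 := le_of_tendsto_of_tendsto' h1 h2 fun n => hC t ht _ (hτ n)
    rwa [abs_sub_comm, abs_of_pos (sub_pos.2 ht.2)] at h3
  have hbS : ∀ m : ℕ, ∃ S : ℝ, (∀ t ∈ Ioo t₁ T,
      ∫⁻ k, ENNReal.ofReal ((1 + ‖κ k‖ ^ 2) ^ m) * ‖a t k‖ₑ ^ 2 ∂μ ≤ ENNReal.ofReal S) ∧
      ∫⁻ k, ENNReal.ofReal ((1 + ‖κ k‖ ^ 2) ^ m) * ‖b k‖ₑ ^ 2 ∂μ ≤ ENNReal.ofReal S := by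
    intro m
    obtain ⟨S, hS⟩ := hbd m
    exact ⟨S, hS, lintegral_mul_enorm_sq_le_of_tendsto (fun n => hmemL _ (hτ n)) hbL hlimb
      (by fun_prop) (fun n => hS _ (hτ n)) fun _ => ENNReal.ofReal_ne_top⟩
  refine ⟨w, fun m => ⟨?_, ?_⟩⟩
  · obtain ⟨S, -, hS⟩ := hbS m
    refine rpow_half_lt_top.2 ?_
    rw [M.spectralIntegral_eq (by fun_prop) hwmem]
    exact ENNReal.mul_lt_top ENNReal.ofReal_lt_top (hS.trans_lt ENNReal.ofReal_lt_top)
  · obtain ⟨S, hSa, hSb⟩ := hbS (2 * m)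
    set Q : ℝ≥0∞ := ENNReal.ofReal lam ^ 2 * (2 * ENNReal.ofReal S + 2 * ENNReal.ofReal S) with hQ
    have hQtop : Q ≠ ⊤ := by
      simp [hQ, ENNReal.mul_eq_top, ENNReal.pow_eq_top_iff]
    -- Interpolation: by Cauchy–Schwarz the fourth power of the `Hᵐ` norm is at most the product of
    -- the squared `H^{2m}` and `L²` norms. The former stays bounded and the latter tends to zero.
    have hfour : ∀ t ∈ Ioo t₁ T, sobolevNorm Ω m (u t - w) ^ 4 ≤
        Q * ENNReal.ofReal ((C * (T - t)) ^ 2) := by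
      intro t ht
      have h1 := M.spectralIntegral_sub_eq (W := fun ξ => ENNReal.ofReal ((1 + ‖ξ‖ ^ 2) ^ m))
        (by fun_prop) (hmem t ht) hwmem (hau t ht) EventuallyEq.rfl
      rw [show 4 = 2 * 2 from rfl, pow_mul, sobolevNorm_sq, h1, mul_pow, hQ, mul_assoc]
      gcongr
      have hd : MemLp (fun k => a t k - b k) 2 μ := (hmemL t ht).sub hbL
      have h2 := sq_lintegral_mul_le μ
        (f := fun k => ENNReal.ofReal ((1 + ‖κ k‖ ^ 2) ^ m) * ‖a t k - b k‖ₑ)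
        (g := fun k => ‖a t k - b k‖ₑ)
        ((by fun_prop : Measurable fun k =>
          ENNReal.ofReal ((1 + ‖κ k‖ ^ 2) ^ m)).aemeasurable.mul hd.1.enorm) hd.1.enorm
      simp only [mul_assoc, ← pow_two, mul_pow] at h2
      refine h2.trans ?_
      gcongr
      · have h3 : ∀ k, ENNReal.ofReal ((1 + ‖κ k‖ ^ 2) ^ m) ^ 2 =
            ENNReal.ofReal ((1 + ‖κ k‖ ^ 2) ^ (2 * m)) := by
          intro k
          rw [← ENNReal.ofReal_pow (by positivity), ← pow_mul, mul_comm]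
        simp only [h3]
        exact (lintegral_mul_sq_le (by fun_prop) (hmemL t ht).1
          fun k => enorm_sub_sq_le _ _).trans 
            (add_le_add (mul_le_mul' le_rfl (hSa t ht)) (mul_le_mul' le_rfl hSb))
      · have h4 : ∫⁻ k, ‖a t k - b k‖ₑ ^ 2 ∂μ =
            ENNReal.ofReal (‖toL2 μ (a t) - toL2 μ b‖ ^ 2) := by
          rw [toL2_sub (hmemL t ht) hbL]
          exact (norm_toL2_sq hd).symm
        rw [h4]
        exact ENNReal.ofReal_le_ofReal (pow_le_pow_left₀ (norm_nonneg _) (hrate t ht) 2)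
    have hlim4 : Tendsto (fun t => sobolevNorm Ω m (u t - w) ^ 4) (𝓝[<] T) (𝓝 0) := by
      have h1 : Tendsto (fun t => Q * ENNReal.ofReal ((C * (T - t)) ^ 2)) (𝓝 T) (𝓝 0) := by
        have h2 : Tendsto (fun t => ENNReal.ofReal ((C * (T - t)) ^ 2)) (𝓝 T) (𝓝 0) := by
          have : Continuous fun t : ℝ => ENNReal.ofReal ((C * (T - t)) ^ 2) :=
            ENNReal.continuous_ofReal.comp (by fun_prop)
          simpa using this.tendsto T
        simpa using ENNReal.Tendsto.const_mul h2 (Or.inr hQtop)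
      refine tendsto_of_tendsto_of_tendsto_of_le_of_le' tendsto_const_nhds
        (h1.mono_left nhdsWithin_le_nhds) (Eventually.of_forall fun _ => zero_le) ?_
      filter_upwards [Ioo_mem_nhdsLT ht₁] with t ht using hfour t ht
    have h5 := ((ENNReal.continuous_rpow_const (y := 1 / 4)).tendsto 0).comp hlim4
    have h6 : (0 : ℝ≥0∞) ^ (1 / 4 : ℝ) = 0 := ENNReal.zero_rpow_of_pos (by norm_num)
    rw [h6] at h5
    refine h5.congr fun t => ?_
    simp only [Function.comp_apply]
    rw [← ENNReal.rpow_natCast, ← ENNReal.rpow_mul]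
    norm_num

variable [MeasurableAdd₂ K] [MeasurableNeg K] [SFinite μ] [μ.IsAddLeftInvariant] [μ.IsNegInvariant]

theorem le_homSobolevNorm (M : IsFourierModel Ω μ κ F lam A) (hν : 0 < ν)
    (h : IsSmoothSolution Ω ν T u p) (hloss : LosesRegularityAt Ω u T) {t : ℝ}
    (ht : t ∈ Ico 0 T) :
    ENNReal.ofReal (√(lam / (36 * A)) * √ν / √(T - t)) ≤ homSobolevNorm Ω (3 / 2) (u t) := by
  by_contra! hlt
  obtain ⟨a, hau, ha⟩ := M.exists_isEvolution h
  obtain ⟨t₁, ht₁, hbd, C, hC⟩ := ha.exists_bounds M.measurable_wave hν M.decay M.low_pos M.low ht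
    (M.lintegral_lt_of_homSobolevNorm_lt (h.memLp_comp ht) (hau t ht) (sub_pos.2 ht.2) hν hlt)
  have hsub : ∀ s ∈ Ioo t₁ T, s ∈ Ico 0 T := fun s hs => ⟨(ht₁.1.trans hs.1).le, hs.2⟩
  exact hloss (M.staysRegularUpTo ht₁.2 (fun s hs => h.memLp_comp (hsub s hs))
    (fun s hs => hau s (hsub s hs)) hbd hC)

end IsFourierModel

end NavierStokes

namespace NavierStokes

open scoped ComplexConjugate

/-! ### Radial integrals -/

/-- The constant in `∫_{‖x‖ ≤ r} ‖x‖⁻¹ = lowConst r²`. -/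
noncomputable def lowConst : ℝ := 3 / 2 * (volume : Measure E3).real (Metric.ball 0 1)

theorem lowConst_pos : 0 < lowConst := by
  have h : 0 < (volume : Measure E3).real (Metric.ball 0 1) :=
    ENNReal.toReal_pos (Metric.measure_ball_pos _ _ one_pos).ne' measure_ball_lt_top.ne
  unfold lowConst
  positivity

/-- Polar coordinates: the radial density `y²` times `y⁻¹` integrates to `r²/2`, and the sphere
contributes three times the volume of the unit ball. -/
theorem lintegral_inv_norm_le {r : ℝ} (hr : 0 ≤ r) :
    ∫⁻ x in {x : E3 | ‖x‖ ≤ r}, ENNReal.ofReal ‖x‖⁻¹ ≤ ENNReal.ofReal (lowConst * r ^ 2) := by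
  set f : ℝ → ℝ := (Iic r).indicator fun y => y⁻¹ with hf
  have hfr : ∀ y ∈ Ioi (0 : ℝ), y ^ (Module.finrank ℝ E3 - 1) • f y =
      (Ioc 0 r).indicator (fun y => y) y := by
    intro y hy
    have hy' : y ≠ 0 := (mem_Ioi.1 hy).ne'
    by_cases h : y ≤ r
    · rw [hf, indicator_of_mem (show y ∈ Iic r from h),
        indicator_of_mem (show y ∈ Ioc 0 r from ⟨hy, h⟩)]
      simp only [finrank_euclideanSpace_fin, smul_eq_mul]
      field_simp
    · rw [hf, indicator_of_notMem (show y ∉ Iic r from h),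
        indicator_of_notMem fun h' => h h'.2, smul_zero]
  have hint : Integrable (fun x : E3 => f ‖x‖) volume := by
    rw [integrable_fun_norm_addHaar, integrableOn_congr_fun hfr measurableSet_Ioi]
    refine Integrable.integrableOn ?_
    rw [integrable_indicator_iff measurableSet_Ioc]
    exact (continuous_id.integrableOn_Icc (a := 0) (b := r)).mono_set Ioc_subset_Icc_self
  have hval : ∫ x : E3, f ‖x‖ = lowConst * r ^ 2 := by
    rw [integral_fun_norm_addHaar, setIntegral_congr_fun measurableSet_Ioi hfr,
      setIntegral_indicator measurableSet_Ioc, inter_eq_self_of_subset_right Ioc_subset_Ioi_self,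
      ← intervalIntegral.integral_of_le hr, integral_id, lowConst]
    simp only [finrank_euclideanSpace_fin, smul_eq_mul, nsmul_eq_mul]
    push_cast
    ring
  have hms : MeasurableSet {x : E3 | ‖x‖ ≤ r} := measurableSet_le measurable_norm measurable_const
  have h0 : 0 ≤ᵐ[volume] fun x : E3 => f ‖x‖ := Eventually.of_forall fun x => by
    by_cases h : ‖x‖ ≤ r
    · simp [hf, h]
    · simp [hf, h]
  rw [← hval, ofReal_integral_eq_lintegral_ofReal hint h0, ← lintegral_indicator hms]
  refine lintegral_mono fun x => ?_
  by_cases h : ‖x‖ ≤ r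
  · rw [indicator_of_mem (show x ∈ {x : E3 | ‖x‖ ≤ r} from h), hf,
      indicator_of_mem (show ‖x‖ ∈ Iic r from h)]
  · rw [indicator_of_notMem (show x ∉ {x : E3 | ‖x‖ ≤ r} from h)]
    exact zero_le

theorem lintegral_decay_lt_top :
    ∫⁻ x : E3, ENNReal.ofReal (((1 + ‖x‖ ^ 2) ^ 2)⁻¹) < ⊤ := by
  have h := integrable_rpow_neg_one_add_norm_sq (E := E3) (μ := volume) (r := 4)
    (by simp only [finrank_euclideanSpace_fin]; norm_num)
  have h2 := h.lintegral_lt_top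
  refine lt_of_le_of_lt (lintegral_mono fun x => ?_) h2
  apply ENNReal.ofReal_le_ofReal
  rw [show (-4 / 2 : ℝ) = -((2 : ℕ) : ℝ) by norm_num, Real.rpow_neg (by positivity),
    Real.rpow_natCast]

/-! ### The Fourier model of the whole space -/

theorem planeWave_smul_two_pi (k x : E3) :
    planeWave ((2 * Real.pi) • k) x = (Real.fourierChar (inner ℝ x k) : ℂ) := by
  rw [planeWave, Real.fourierChar_apply, inner_smul_left, real_inner_comm]
  congr 1
  simp
  ring

theorem integral_planeWave_mul_eq_fourier (f : E3 → ℂ) (k : E3) :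
    ∫ x, planeWave (-((2 * Real.pi) • k)) x * f x = 𝓕 f k := by
  rw [Real.fourier_eq]
  refine integral_congr_ae (Eventually.of_forall fun x => ?_)
  simp only [← smul_neg, planeWave_smul_two_pi, inner_neg_right, Circle.smul_def, smul_eq_mul]

theorem integral_fourier_mul {f g : E3 → ℂ} (hf : Integrable f) (hg : Integrable g) :
    ∫ k, 𝓕 f k * g k = ∫ x, f x * 𝓕 g x := by
  have := VectorFourier.integral_fourierIntegral_smul_eq_flip (L := innerₗ E3)
    Real.continuous_fourierChar continuous_inner hf hg
  simpa using! this

theorem ae_eq_of_integral_schwartz_mul {f g : E3 → ℂ} (hf : LocallyIntegrable f)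
    (hg : LocallyIntegrable g) (h : ∀ θ : SchwartzMap E3 ℂ, ∫ x, θ x * f x = ∫ x, θ x * g x) :
    f =ᵐ[volume] g := by
  refine ae_eq_of_integral_contDiff_smul_eq hf hg fun θ hθ hθc => ?_
  have hc : HasCompactSupport fun x => ((θ x : ℝ) : ℂ) := hθc.comp_left (g := Complex.ofReal) rfl
  exact h (hc.toSchwartzMap (Complex.ofRealCLM.contDiff.comp hθ))

/-- Every Schwartz function is a Fourier transform `𝓕 η`, and `∫ 𝓕 η · G = ∫ η · 𝓕 G`. -/
theorem ae_eq_zero_of_fourier_eq_zero {G : E3 → ℂ} (hG : Integrable G) (h : ∀ x, 𝓕 G x = 0) :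
    G =ᵐ[volume] 0 := by
  refine ae_eq_of_integral_schwartz_mul hG.locallyIntegrable
    (locallyIntegrable_const (0 : ℂ)) fun θ => ?_
  obtain ⟨η, rfl⟩ : ∃ η : SchwartzMap E3 ℂ, 𝓕 η = θ := ⟨𝓕⁻ θ, by simp⟩
  have h1 := integral_fourier_mul hG η.integrable
  simp only [h, zero_mul, integral_zero] at h1
  simp only [Pi.zero_apply, mul_zero, integral_zero]
  rw [h1]
  refine integral_congr_ae (Eventually.of_forall fun x => ?_)
  simp only [SchwartzMap.fourier_coe, mul_comm]

open Classical in
/-- The Fourier transform of a square integrable function, as a function. -/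
noncomputable def spaceFourier (f : E3 → ℂ) : E3 → ℂ :=
  if h : MemLp f 2 (volume : Measure E3) then fourierL2 f h else 0

theorem spaceFourier_eq {f : E3 → ℂ} (h : MemLp f 2 (volume : Measure E3)) :
    spaceFourier f = fourierL2 f h := dif_pos h

/-- The `L²` transform and the integral define the same tempered distribution, and both are locally
integrable. -/
theorem spaceFourier_ae_eq {f : E3 → ℂ} (h2 : MemLp f 2 (volume : Measure E3))
    (h1 : Integrable f) : spaceFourier f =ᵐ[volume] 𝓕 f := by
  rw [spaceFourier_eq h2]
  refine ae_eq_of_integral_schwartz_mul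
    ((Lp.memLp (fourierL2 f h2)).locallyIntegrable (by norm_num)) ?_ fun θ => ?_
  · have : Continuous (𝓕 f) := VectorFourier.fourierIntegral_continuous
      Real.continuous_fourierChar continuous_inner h1
    exact this.locallyIntegrable
  · have h3 := DFunLike.congr_fun (Lp.fourier_toTemperedDistribution_eq (h2.toLp f)) θ
    rw [TemperedDistribution.fourier_apply, Lp.toTemperedDistribution_apply,
      Lp.toTemperedDistribution_apply] at h3
    simp only [smul_eq_mul] at h3
    refine h3.symm.trans ?_
    have h4 := integral_fourier_mul h1 θ.integrable
    calc ∫ x, (𝓕 θ) x * h2.toLp f x = ∫ x, f x * 𝓕 (θ : E3 → ℂ) x := by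
          refine integral_congr_ae ?_
          filter_upwards [h2.coeFn_toLp] with x hx
          rw [hx, mul_comm, SchwartzMap.fourier_coe]
      _ = ∫ x, 𝓕 f x * θ x := h4.symm
      _ = _ := by simp only [mul_comm]

end NavierStokes

namespace NavierStokes

open scoped ComplexConjugate

/-- The wave vector of a frequency on the whole space. -/
noncomputable def spaceWave : E3 →+ E3 := DistribSMul.toAddMonoidHom E3 (2 * Real.pi)

theorem spaceWave_apply (k : E3) : spaceWave k = (2 * Real.pi) • k := rfl

theorem norm_le_norm_spaceWave (k : E3) : ‖k‖ ≤ ‖spaceWave k‖ := by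
  rw [spaceWave_apply, norm_smul, Real.norm_of_nonneg (by positivity)]
  exact le_mul_of_one_le_left (norm_nonneg _) (by linarith [Real.pi_gt_three])

theorem IsTest.planeWave_mul_space {φ : E3 → ℂ} (hφ : IsTest Domain.space φ) (ξ : E3) :
    IsTest Domain.space fun x => planeWave ξ x * φ x :=
  hφ.mul_left (contDiff_planeWave ξ) trivial

theorem IsTest.comp_add_space {φ : E3 → ℂ} (hφ : IsTest Domain.space φ) (y : E3) :
    IsTest Domain.space fun x => φ (x + y) where
  contDiff := hφ.contDiff.comp (contDiff_id.add contDiff_const)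
  field := trivial
  compact h := (hφ.compact h).comp_homeomorph (Homeomorph.addRight y)

theorem IsTest.spaceFourier_ae_eq {φ : E3 → ℂ} (hφ : IsTest Domain.space φ) :
    spaceFourier φ =ᵐ[volume] 𝓕 φ :=
  NavierStokes.spaceFourier_ae_eq hφ.memLp_two hφ.integrable

theorem fourier_comp_add (f : E3 → ℂ) (y k : E3) :
    𝓕 (fun x => f (x + y)) k = (Real.fourierChar (inner ℝ y k) : ℂ) * 𝓕 f k := by
  rw [Real.fourier_eq, Real.fourier_eq, ← integral_const_mul,
    ← integral_add_right_eq_self (fun v => _ * _) y]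
  refine integral_congr_ae (Eventually.of_forall fun x => ?_)
  simp only [Circle.smul_def, smul_eq_mul, ← mul_assoc, ← Circle.coe_mul, ← AddChar.map_add_eq_mul,
    inner_add_left]
  congr 4
  ring

theorem fourier_planeWave_mul (f : E3 → ℂ) (l k : E3) :
    𝓕 (fun x => planeWave (spaceWave l) x * f x) k = 𝓕 f (k - l) := by
  rw [← integral_planeWave_mul_eq_fourier, ← integral_planeWave_mul_eq_fourier]
  refine integral_congr_ae (Eventually.of_forall fun x => ?_)
  simp only [← mul_assoc, ← planeWave_add, spaceWave_apply]
  congr 2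
  module

/-- Translating a test function multiplies its transform by a character, so the hypothesis says that
the integrable function `conj h · 𝓕 φ` has zero Fourier transform. Hence the product vanishes almost
everywhere for each `φ`, and it remains to choose `φ` with `𝓕 φ` nonzero near a given point. -/
theorem ae_eq_zero_of_integral_conj_mul_spaceFourier {h : E3 → ℂ}
    (hi : ∀ φ, IsTest Domain.space φ → Integrable (fun k => conj (h k) * spaceFourier φ k))
    (h0 : ∀ φ, IsTest Domain.space φ → ∫ k, conj (h k) * spaceFourier φ k = 0) :
    h =ᵐ[volume] 0 := by
  have key : ∀ φ, IsTest Domain.space φ → ∀ᵐ k : E3, conj (h k) * 𝓕 φ k = 0 := by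
    intro φ hφ
    have hcongr : ∀ ψ, IsTest Domain.space ψ →
        (fun k => conj (h k) * spaceFourier ψ k) =ᵐ[volume] fun k => conj (h k) * 𝓕 ψ k := by
      intro ψ hψ
      filter_upwards [hψ.spaceFourier_ae_eq] with k hk
      rw [hk]
    refine ae_eq_zero_of_fourier_eq_zero ((hi φ hφ).congr (hcongr φ hφ)) fun y => ?_
    have h1 := h0 _ (hφ.comp_add_space (-y))
    rw [integral_congr_ae (hcongr _ (hφ.comp_add_space (-y)))] at h1
    rw [Real.fourier_eq, ← h1]
    refine integral_congr_ae (Eventually.of_forall fun k => ?_)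
    simp only [fourier_comp_add, inner_neg_left, Circle.smul_def, smul_eq_mul]
    rw [real_inner_comm]
    ring
  let bump : ContDiffBump (0 : E3) := ⟨1, 2, one_pos, one_lt_two⟩
  set ψ : E3 → ℂ := fun x => ((bump x : ℝ) : ℂ) with hψ
  have hψt : IsTest Domain.space ψ :=
    ⟨Complex.ofRealCLM.contDiff.comp bump.contDiff, trivial,
      fun _ => bump.hasCompactSupport.comp_left (g := Complex.ofReal) rfl⟩
  have hcont : Continuous (𝓕 ψ) := VectorFourier.fourierIntegral_continuous
    Real.continuous_fourierChar continuous_inner hψt.integrable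
  have hne : 𝓕 ψ 0 ≠ 0 := by
    rw [Real.fourier_eq]
    simp only [inner_zero_right, neg_zero, AddChar.map_zero_eq_one, one_smul, hψ]
    rw [integral_complex_ofReal]
    exact_mod_cast (bump.integral_pos (μ := volume)).ne'
  obtain ⟨δ, hδ, hball⟩ := Metric.mem_nhds_iff.1 (hcont.continuousAt.eventually_ne hne)
  -- Modulating one bump by a dense sequence of frequencies moves the ball on which its transform is
  -- nonzero over all of space, using countably many null sets.
  have hall : ∀ᵐ k : E3, ∀ n : ℕ,
      conj (h k) * 𝓕 ψ (k - TopologicalSpace.denseSeq E3 n) = 0 := by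
    refine ae_all_iff.2 fun n => ?_
    have := key _ (hψt.planeWave_mul_space (spaceWave (TopologicalSpace.denseSeq E3 n)))
    simpa only [fourier_planeWave_mul] using this
  filter_upwards [hall] with k hk
  obtain ⟨n, hn⟩ := (TopologicalSpace.denseRange_denseSeq E3).exists_dist_lt k hδ
  have h1 : 𝓕 ψ (k - TopologicalSpace.denseSeq E3 n) ≠ 0 := hball (by
    rwa [mem_ball_zero_iff, ← dist_eq_norm])
  have h2 := (mul_eq_zero.1 (hk n)).resolve_right h1
  simpa using h2

/-- The wave vector is `2πk` but the measure is `dk`. For `decay` and `low` the crude comparison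
`|k| ≤ |2πk|` suffices, at the price of a smaller final constant. -/
theorem isFourierModel_space :
    IsFourierModel Domain.space (volume : Measure E3) spaceWave spaceFourier 1 lowConst where
  lam_pos := one_pos
  measurable_wave := by
    have : Continuous fun k : E3 => (2 * Real.pi) • k := by fun_prop
    exact this.measurable
  planeWave_field _ := trivial
  measurable f hf := by
    have hf' : MemLp f 2 (volume : Measure E3) := hf
    rw [spaceFourier_eq hf']
    exact (Lp.stronglyMeasurable _).measurable
  memLp f hf := by
    have hf' : MemLp f 2 (volume : Measure E3) := hf
    rw [spaceFourier_eq hf']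
    exact Lp.memLp _
  parseval f g hf hg := by
    have hf' : MemLp f 2 (volume : Measure E3) := hf
    have hg' : MemLp g 2 (volume : Measure E3) := hg
    rw [spaceFourier_eq hf', spaceFourier_eq hg']
    have h1 := Lp.inner_fourier_eq (hf'.toLp f) (hg'.toLp g)
    rw [L2.inner_def, L2.inner_def] at h1
    simp only [RCLike.inner_apply] at h1
    rw [Complex.ofReal_one, one_mul]
    change ∫ x, conj (f x) * g x = _
    calc ∫ x, conj (f x) * g x = ∫ x, hg'.toLp g x * conj (hf'.toLp f x) := by
          refine integral_congr_ae ?_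
          filter_upwards [hf'.coeFn_toLp, hg'.coeFn_toLp] with x h2 h3
          rw [h2, h3, mul_comm]
      _ = _ := h1.symm
      _ = _ := by
          refine integral_congr_ae (Eventually.of_forall fun x => ?_)
          simp only [fourierL2, mul_comm]
  ae_eq_integral f h2 h1 := by
    filter_upwards [spaceFourier_ae_eq h2 h1] with k hk
    rw [hk, Complex.ofReal_one, inv_one, one_mul]
    exact (integral_planeWave_mul_eq_fourier f k).symm
  ae_eq_zero h hi h0 := ae_eq_zero_of_integral_conj_mul_spaceFourier hi h0
  ae_eq_zero_of_wave_eq_zero h _ := by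
    have h1 : ∀ᵐ k : E3, k ≠ 0 := by simp [ae_iff]
    filter_upwards [h1] with k hk h2
    rw [spaceWave_apply] at h2
    exact absurd ((smul_eq_zero.1 h2).resolve_left (by positivity)) hk
  spectral W hW f hf := by
    have hf' : ∀ i, MemLp (comp f i) 2 (volume : Measure E3) := hf
    simp only [spectralIntegral, dif_pos hf', ENNReal.ofReal_one, one_mul, spaceFourier_eq (hf' _),
      Finset.mul_sum]
    rw [lintegral_finsetSum]
    · rfl
    · intro i _
      refine (hW.comp (measurable_const_smul (2 * Real.pi))).mul ?_
      exact (Lp.stronglyMeasurable _).measurable.enorm.pow_const 2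
  decay := by
    refine lt_of_le_of_lt (lintegral_mono fun k => ?_) lintegral_decay_lt_top
    apply ENNReal.ofReal_le_ofReal
    have := norm_le_norm_spaceWave k
    gcongr
  low_pos := lowConst_pos
  low r hr := by
    refine le_trans ?_ (lintegral_inv_norm_le hr)
    refine (lintegral_mono_set (t := {p : E3 | ‖p‖ ≤ r}) fun p hp =>
      (norm_le_norm_spaceWave p).trans hp).trans (lintegral_mono fun p => ?_)
    apply ENNReal.ofReal_le_ofReal
    rcases eq_or_ne p 0 with rfl | hp
    · simp
    · have h1 := norm_le_norm_spaceWave p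
      have h2 := norm_pos_iff.2 hp
      gcongr

end NavierStokes

/-! ### Fourier series on the period cell. -/

namespace NavierStokes

open scoped ComplexConjugate

noncomputable section FourierSeries

/-- The measure on `ℝ / ℤ`, normalised to have total volume `1`. -/
local instance : MeasureSpace UnitAddCircle := ⟨AddCircle.haarAddCircle⟩

/-- The parametrisation of the period cell by the unit torus. -/
def toCell (x : UnitAddTorus (Fin 3)) : E3 :=
  WithLp.toLp 2 fun i => 2 * Real.pi * (AddCircle.equivIoc 1 0 (x i) : ℝ)

theorem measurable_toCell : Measurable toCell := by
  have h : ∀ i : Fin 3, Measurable fun x : UnitAddTorus (Fin 3) =>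
      (AddCircle.equivIoc 1 0 (x i) : ℝ) := fun i =>
    measurable_subtype_coe.comp ((AddCircle.measurableEquivIoc 1 0).measurable.comp
      (measurable_pi_apply i))
  unfold toCell
  fun_prop

theorem toCell_coe {x : Fin 3 → ℝ} (hx : ∀ i, x i ∈ Ioc (0 : ℝ) (0 + 1)) :
    toCell (fun i => (x i : UnitAddCircle)) = WithLp.toLp 2 ((2 * Real.pi) • x) := by
  unfold toCell
  congr 1
  ext i
  change 2 * Real.pi * ((AddCircle.equivIoc 1 0 (x i : UnitAddCircle)) : ℝ) = 2 * Real.pi * x i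
  rw [AddCircle.equivIoc_coe_of_mem (hx i)]

/-- The half-open unit cube parametrises the unit torus and scaling by `2π` carries it onto `box`.
The normalised measure of the torus accounts for the factor `(2π)⁻³`. -/
theorem map_toCell : Measure.map toCell volume =
    ENNReal.ofReal ((2 * Real.pi) ^ 3)⁻¹ • (volume : Measure E3).restrict box := by
  ext S hS
  have hpi : 0 < 2 * Real.pi := by positivity
  have hSb := hS.inter measurableSet_box
  have hpre := measurable_toCell hS
  rw [Measure.map_apply measurable_toCell hS, Measure.smul_apply, Measure.restrict_apply hS,
    ← lintegral_indicator_one hpre, UnitAddTorus.lintegral_preimage _ 0, smul_eq_mul,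
    ← (PiLp.volume_preserving_toLp (Fin 3)).measure_preimage hSb.nullMeasurableSet]
  have hI : MeasurableSet {x : Fin 3 → ℝ | ∀ i, x i ∈
       Ioc ((0 : Fin 3 → ℝ) i) ((0 : Fin 3 → ℝ) i + 1)} :=
    MeasurableSet.univ_pi' fun i => measurableSet_Ioc
  have h2 := Measure.addHaar_preimage_smul (volume : Measure (Fin 3 → ℝ)) hpi.ne'
    (WithLp.toLp 2 ⁻¹' (S ∩ box))
  rw [Module.finrank_fin_fun, abs_of_pos (by positivity)] at h2
  have hT : MeasurableSet ((fun x : Fin 3 → ℝ => (2 * Real.pi) • x) ⁻¹'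
      (WithLp.toLp 2 ⁻¹' (S ∩ box))) :=
    (measurable_const_smul _) ((PiLp.volume_preserving_toLp (Fin 3)).measurable hSb)
  rw [← h2, ← lintegral_indicator_one hT, ← lintegral_indicator hI]
  refine lintegral_congr fun x => ?_
  by_cases hx : ∀ i, x i ∈ Ioc (0 : ℝ) (0 + 1)
  · have hb : WithLp.toLp 2 ((2 * Real.pi) • x) ∈ box := by
      intro i
      have h3 := hx i
      rw [zero_add] at h3
      exact ⟨mul_pos hpi h3.1, mul_le_of_le_one_right hpi.le h3.2⟩
    rw [indicator_of_mem (by exact hx)]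
    by_cases hs : WithLp.toLp 2 ((2 * Real.pi) • x) ∈ S
    · rw [indicator_of_mem (by rw [mem_preimage, toCell_coe hx]; exact hs),
        indicator_of_mem (show x ∈ (fun x => (2 * Real.pi) • x) ⁻¹' (WithLp.toLp 2 ⁻¹' (S ∩ box))
          from ⟨hs, hb⟩)]
      rfl
    · rw [indicator_of_notMem (by rw [mem_preimage, toCell_coe hx]; exact hs),
        indicator_of_notMem fun h => hs h.1]
  · rw [indicator_of_notMem (by exact hx), indicator_of_notMem]
    intro h
    refine hx fun i => ?_
    have h3 := h.2 i
    change 2 * Real.pi * x i ∈ Ioc 0 (2 * Real.pi) at h3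
    rw [zero_add]
    exact ⟨pos_of_mul_pos_right h3.1 hpi.le, by nlinarith [h3.2]⟩

theorem mFourier_toCell (n : Fin 3 → ℤ) (x : UnitAddTorus (Fin 3)) :
    UnitAddTorus.mFourier n x = planeWave (wave n) (toCell x) := by
  have hx : ∀ i, x i = ((AddCircle.equivIoc 1 0 (x i) : ℝ) : UnitAddCircle) := fun i =>
    ((AddCircle.equivIoc 1 0).symm_apply_apply (x i)).symm
  have h1 : UnitAddTorus.mFourier n x = ∏ i, fourier (n i) (x i) := rfl
  rw [h1, planeWave, PiLp.inner_apply, Complex.ofReal_sum, Finset.mul_sum, Complex.exp_sum]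
  refine Finset.prod_congr rfl fun i _ => ?_
  conv_lhs => rw [hx i, fourier_coe_apply]
  congr 1
  simp [toCell, wave]
  ring

theorem memLp_comp_toCell {f : E3 → ℂ} (hf : MemLp f 2 ((volume : Measure E3).restrict box)) :
    MemLp (f ∘ toCell) 2 volume := by
  refine (memLp_map_measure_iff ?_ measurable_toCell.aemeasurable).1 ?_
  · rw [map_toCell]
    exact hf.1.smul_measure _
  · rw [map_toCell]
    exact hf.smul_measure ENNReal.ofReal_ne_top

theorem integral_comp_toCell {f : E3 → ℂ}
    (hf : AEStronglyMeasurable f ((volume : Measure E3).restrict box)) :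
    ∫ x, f (toCell x) = (((2 * Real.pi) ^ 3 : ℝ) : ℂ)⁻¹ * ∫ x in box, f x := by
  rw [← integral_map measurable_toCell.aemeasurable (by rw [map_toCell]; exact hf.smul_measure _),
    map_toCell, integral_smul_measure, ENNReal.toReal_ofReal (by positivity), Complex.real_smul,
    Complex.ofReal_inv]

theorem wave_neg (n : Fin 3 → ℤ) : wave (-n) = -wave n := by
  ext i; simp [wave]

theorem fourierCoeffBox_eq (f : E3 → ℂ) (n : Fin 3 → ℤ) :
    fourierCoeffBox f n =
      (((2 * Real.pi) ^ 3 : ℝ) : ℂ)⁻¹ * ∫ x in box, planeWave (-wave n) x * f x := by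
  rw [fourierCoeffBox]
  congr 1
  · push_cast
    rw [inv_pow]
  · refine integral_congr_ae (Eventually.of_forall fun x => ?_)
    simp only [planeWave, inner_neg_left, Complex.ofReal_neg, mul_neg, mul_comm]

theorem mFourierCoeff_comp_toCell {f : E3 → ℂ}
    (hf : MemLp f 2 ((volume : Measure E3).restrict box)) (n : Fin 3 → ℤ) :
    UnitAddTorus.mFourierCoeff ((memLp_comp_toCell hf).toLp _) n = fourierCoeffBox f n := by
  rw [fourierCoeffBox_eq, ← integral_comp_toCell (f := fun x => planeWave (-wave n) x * f x)
    ((contDiff_planeWave _).continuous.aestronglyMeasurable.mul hf.1)]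
  refine integral_congr_ae ?_
  filter_upwards [(memLp_comp_toCell hf).coeFn_toLp] with x hx
  rw [hx, mFourier_toCell, wave_neg, smul_eq_mul]
  rfl

/-- Parseval's identity on the torus. -/
theorem hasSum_conj_mul_fourierCoeffBox {f g : E3 → ℂ}
    (hf : MemLp f 2 ((volume : Measure E3).restrict box))
    (hg : MemLp g 2 ((volume : Measure E3).restrict box)) :
    HasSum (fun n => conj (fourierCoeffBox f n) * fourierCoeffBox g n)
      ((((2 * Real.pi) ^ 3 : ℝ) : ℂ)⁻¹ * ∫ x in box, conj (f x) * g x) := by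
  have h := UnitAddTorus.hasSum_prod_mFourierCoeff ((memLp_comp_toCell hf).toLp _)
    ((memLp_comp_toCell hg).toLp _)
  simp only [mFourierCoeff_comp_toCell hf, mFourierCoeff_comp_toCell hg] at h
  convert! h using 1
  rw [← integral_comp_toCell (f := fun x => conj (f x) * g x)
    ((Complex.continuous_conj.comp_aestronglyMeasurable hf.1).mul hg.1)]
  refine integral_congr_ae ?_
  filter_upwards [(memLp_comp_toCell hf).coeFn_toLp, (memLp_comp_toCell hg).coeFn_toLp]
    with x h1 h2
  rw [h1, h2]
  rfl

end FourierSeries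

end NavierStokes

namespace NavierStokes

open scoped ComplexConjugate

/-! ### Sums over the integer lattice -/

/-- The open unit cubes at the lattice points are disjoint and have volume `1`. -/
theorem tsum_le_lintegral {f : (Fin 3 → ℤ) → ℝ≥0∞} {g : E3 → ℝ≥0∞}
    (h : ∀ (k : Fin 3 → ℤ) (x : E3), (∀ i, x i ∈ Ioo (k i : ℝ) (k i + 1)) → f k ≤ g x) :
    ∑' k, f k ≤ ∫⁻ x, g x := by
  set cube : (Fin 3 → ℤ) → Set E3 := fun k => {x | ∀ i, x i ∈ Ioo (k i : ℝ) (k i + 1)} with hcube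
  have hm : ∀ k, MeasurableSet (cube k) := by
    intro k
    have : cube k = ⋂ i : Fin 3, (fun x : E3 => x i) ⁻¹' Ioo (k i : ℝ) (k i + 1) := by
      ext x; simp [hcube]
    rw [this]
    refine MeasurableSet.iInter fun i => ?_
    have h : Measurable fun x : E3 => x i := by fun_prop
    exact h measurableSet_Ioo
  have hvol : ∀ k, volume (cube k) = 1 := by
    intro k
    rw [← (PiLp.volume_preserving_toLp (Fin 3)).measure_preimage (hm k).nullMeasurableSet]
    have : WithLp.toLp 2 ⁻¹' cube k =
        Set.pi univ fun i : Fin 3 => Ioo (k i : ℝ) (k i + 1) := by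
      ext x; simp [hcube]
    rw [this, Real.volume_pi_Ioo]
    simp
  have hd : Pairwise (Function.onFun Disjoint cube) := by
    intro k l hkl
    refine Set.disjoint_left.2 fun x hk hl => hkl (funext fun i => ?_)
    have h1 : (k i : ℝ) < l i + 1 := (hk i).1.trans (hl i).2
    have h2 : (l i : ℝ) < k i + 1 := (hl i).1.trans (hk i).2
    have h1' : k i < l i + 1 := by exact_mod_cast h1
    have h2' : l i < k i + 1 := by exact_mod_cast h2
    omega
  calc ∑' k, f k = ∑' k, ∫⁻ _x in cube k, f k := by
        simp only [setLIntegral_const, hvol, mul_one]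
    _ ≤ ∑' k, ∫⁻ x in cube k, g x :=
        ENNReal.tsum_le_tsum fun k => setLIntegral_mono' (hm k) fun x hx => h k x hx
    _ = ∫⁻ x in ⋃ k, cube k, g x := (lintegral_iUnion hm hd _).symm
    _ ≤ ∫⁻ x, g x := setLIntegral_le_lintegral _ _

theorem norm_le_norm_wave_add_two {k : Fin 3 → ℤ} {x : E3}
    (hx : ∀ i, x i ∈ Ioo (k i : ℝ) (k i + 1)) : ‖x‖ ≤ ‖wave k‖ + 2 := by
  have h1 : ‖x - wave k‖ ≤ 2 := by
    rw [EuclideanSpace.norm_eq, Real.sqrt_le_left (by norm_num)]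
    calc ∑ i, ‖(x - wave k) i‖ ^ 2 ≤ ∑ _i : Fin 3, (1 : ℝ) := by
          refine Finset.sum_le_sum fun i _ => ?_
          have h2 := hx i
          have h3 : (x - wave k) i = x i - k i := rfl
          rw [h3, Real.norm_eq_abs, sq_abs]
          nlinarith [h2.1, h2.2]
      _ ≤ 2 ^ 2 := by norm_num
  calc ‖x‖ = ‖wave k + (x - wave k)‖ := by rw [add_sub_cancel]
    _ ≤ ‖wave k‖ + 2 := (norm_add_le _ _).trans (by gcongr)

theorem one_le_norm_wave {k : Fin 3 → ℤ} (hk : k ≠ 0) : 1 ≤ ‖wave k‖ := by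
  obtain ⟨i, hi⟩ := Function.ne_iff.1 hk
  have h1 : (1 : ℝ) ≤ |(k i : ℝ)| := by exact_mod_cast Int.one_le_abs hi
  exact h1.trans (PiLp.norm_apply_le (wave k) i)

theorem tsum_decay_lt_top :
    ∑' k : Fin 3 → ℤ, ENNReal.ofReal (((1 + ‖wave k‖ ^ 2) ^ 2)⁻¹) < ⊤ := by
  refine (tsum_le_lintegral
    (g := fun x => ENNReal.ofReal 81 * ENNReal.ofReal (((1 + ‖x‖ ^ 2) ^ 2)⁻¹))
    fun k x hx => ?_).trans_lt ?_
  · rw [← ENNReal.ofReal_mul (by norm_num)]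
    apply ENNReal.ofReal_le_ofReal
    have h1 := norm_le_norm_wave_add_two hx
    -- This follows from `|x| ≤ |k| + 2`; squaring it gives the factor `81`.
    have h2 : 1 + ‖x‖ ^ 2 ≤ 9 * (1 + ‖wave k‖ ^ 2) := by
      nlinarith [norm_nonneg x, norm_nonneg (wave k), sq_nonneg (‖wave k‖ - 2)]
    rw [← div_eq_mul_inv, inv_eq_one_div, div_le_div_iff₀ (by positivity) (by positivity)]
    calc 1 * (1 + ‖x‖ ^ 2) ^ 2 ≤ 1 * (9 * (1 + ‖wave k‖ ^ 2)) ^ 2 := by gcongr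
      _ = _ := by ring
  · rw [lintegral_const_mul' _ _ ENNReal.ofReal_ne_top]
    exact ENNReal.mul_lt_top ENNReal.ofReal_lt_top lintegral_decay_lt_top

/-- For `k ≠ 0` one has `|k| ≥ 1`, so `|x| ≤ |k| + 2 ≤ 3|k|` on the cube at `k`. This costs a factor
`3` in the integrand and `3²` in the radius, which makes `27`. The term `k = 0` contributes nothing
because `0⁻¹ = 0`. -/
theorem tsum_low_le {r : ℝ} (hr : 0 ≤ r) :
    ∑' k : Fin 3 → ℤ, {k | ‖wave k‖ ≤ r}.indicator (fun k => ENNReal.ofReal ‖wave k‖⁻¹) k ≤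
      ENNReal.ofReal (27 * lowConst * r ^ 2) := by
  have hms : MeasurableSet {x : E3 | ‖x‖ ≤ 3 * r} :=
    measurableSet_le measurable_norm measurable_const
  refine (tsum_le_lintegral (g := {x : E3 | ‖x‖ ≤ 3 * r}.indicator
    fun x => ENNReal.ofReal 3 * ENNReal.ofReal ‖x‖⁻¹) fun k x hx => ?_).trans ?_
  · by_cases hk : ‖wave k‖ ≤ r
    swap
    · rw [indicator_of_notMem (by exact hk)]
      exact zero_le
    rcases eq_or_ne k 0 with rfl | hk0
    · have : wave 0 = 0 := by ext i; simp [wave]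
      rw [indicator_of_mem (by exact hk), this]
      simp
    have h1 := norm_le_norm_wave_add_two hx
    have h2 := one_le_norm_wave hk0
    have hx0 : 0 < ‖x‖ := by
      refine norm_pos_iff.2 fun h => ?_
      have h3 := hx 0
      rw [h] at h3
      have h4 : (k 0 : ℝ) < 0 := h3.1
      have h5 : (0 : ℝ) < k 0 + 1 := h3.2
      have h4' : k 0 < 0 := by exact_mod_cast h4
      have h5' : 0 < k 0 + 1 := by exact_mod_cast h5
      omega
    rw [indicator_of_mem (by exact hk),
      indicator_of_mem (show x ∈ {x : E3 | ‖x‖ ≤ 3 * r} from (by linarith : ‖x‖ ≤ 3 * r)),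
      ← ENNReal.ofReal_mul (by norm_num)]
    apply ENNReal.ofReal_le_ofReal
    rw [← div_eq_mul_inv, inv_eq_one_div, div_le_div_iff₀ (by linarith) hx0]
    linarith
  · rw [lintegral_indicator hms, lintegral_const_mul' _ _ ENNReal.ofReal_ne_top]
    refine (mul_le_mul' le_rfl (lintegral_inv_norm_le (by positivity))).trans_eq ?_
    rw [← ENNReal.ofReal_mul (by norm_num)]
    congr 1
    ring

/-! ### The Fourier model of the torus -/

/-- The wave vector of a frequency on the torus. -/
noncomputable def torusWave : (Fin 3 → ℤ) →+ E3 where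
  toFun := wave
  map_zero' := by ext i; simp [wave]
  map_add' k l := by ext i; simp [wave]

theorem torusWave_apply (k : Fin 3 → ℤ) : torusWave k = wave k := rfl

theorem isFieldOn_planeWave_wave (k : Fin 3 → ℤ) :
    IsFieldOn Domain.torus (planeWave (wave k)) := by
  intro i x
  have h1 : (inner ℝ (wave k) (x + EuclideanSpace.single i (2 * Real.pi)) : ℝ) =
      inner ℝ (wave k) x + k i * (2 * Real.pi) := by
    rw [inner_add_right, EuclideanSpace.inner_single_right]
    simp [wave, mul_comm]
  rw [planeWave, planeWave, h1, Complex.ofReal_add, mul_add, Complex.exp_add]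
  have h2 : Complex.I * ((k i * (2 * Real.pi) : ℝ) : ℂ) =
      (k i : ℂ) * (2 * Real.pi * Complex.I) := by
    push_cast
    ring
  rw [h2, Complex.exp_int_mul_two_pi_mul_I, mul_one]

theorem isTest_planeWave_wave (k : Fin 3 → ℤ) : IsTest Domain.torus (planeWave (wave k)) :=
  ⟨contDiff_planeWave _, isFieldOn_planeWave_wave k, fun h => by cases h⟩

theorem planeWave_zero (x : E3) : planeWave 0 x = 1 := by simp [planeWave]

theorem integral_box_one : ∫ _x in box, (1 : ℂ) = (((2 * Real.pi) ^ 3 : ℝ) : ℂ) := by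
  rw [integral_box_eq, setIntegral_const, Measure.real, Real.volume_pi_Ioc]
  simp [ENNReal.toReal_ofReal Real.pi_pos.le]

/-- Orthogonality of distinct plane waves: a nonconstant plane wave is a multiple of its own partial
derivative, whose integral over a period vanishes. -/
theorem fourierCoeffBox_planeWave (l k : Fin 3 → ℤ) :
    fourierCoeffBox (planeWave (wave l)) k = if k = l then 1 else 0 := by
  have hpi : (((2 * Real.pi) ^ 3 : ℝ) : ℂ) ≠ 0 := by
    exact_mod_cast (by positivity : (2 * Real.pi) ^ 3 ≠ 0)
  rw [fourierCoeffBox_eq]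
  have h1 : ∀ x, planeWave (-wave k) x * planeWave (wave l) x = planeWave (wave (l - k)) x := by
    intro x
    rw [← planeWave_add, ← torusWave_apply, ← torusWave_apply, ← torusWave_apply, map_sub]
    congr 1
    abel
  simp only [h1]
  split_ifs with h
  · have h0 : wave (l - k) = 0 := by rw [h, sub_self]; exact map_zero torusWave
    simp only [h0, planeWave_zero]
    rw [integral_box_one, inv_mul_cancel₀ hpi]
  · obtain ⟨i, hi⟩ := Function.ne_iff.1 h
    have h2 := integral_pd_eq_zero (isTest_planeWave_wave (l - k)) i
    simp only [pd_planeWave] at h2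
    rw [integral_const_mul] at h2
    have h3 : Complex.I * ((wave (l - k) i : ℝ) : ℂ) ≠ 0 := by
      refine mul_ne_zero Complex.I_ne_zero ?_
      have : wave (l - k) i = ((l i - k i : ℤ) : ℝ) := rfl
      rw [this]
      exact_mod_cast sub_ne_zero.2 (Ne.symm hi)
    have h4 := (mul_eq_zero.1 h2).resolve_left h3
    have h5 : ∫ x in box, planeWave (wave (l - k)) x = 0 := h4
    rw [h5, mul_zero]

theorem memLp_fourierCoeffBox {f : E3 → ℂ}
    (hf : MemLp f 2 ((volume : Measure E3).restrict box)) :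
    MemLp (fourierCoeffBox f) 2 Measure.count := by
  rw [memLp_two_iff_integrable_sq_norm (by fun_prop), integrable_count_iff]
  refine (hasSum_conj_mul_fourierCoeffBox hf hf).summable.norm.congr fun n => ?_
  simp [pow_two]

theorem integral_count_mul_ite (g : (Fin 3 → ℤ) → ℂ) (l : Fin 3 → ℤ) :
    ∫ k, g k * (if k = l then 1 else 0) ∂Measure.count = g l := by
  rw [← setIntegral_eq_integral_of_forall_compl_eq_zero (s := {l})]
  · rw [integral_singleton]
    simp
  · intro k hk
    rw [if_neg (by simpa using hk), mul_zero]

/-- Plane waves are themselves test functions here, so each coefficient is isolated directly. The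
zero frequency has positive mass and is reached by the constant test function. -/
theorem isFourierModel_torus : IsFourierModel Domain.torus (Measure.count : Measure (Fin 3 → ℤ))
    torusWave fourierCoeffBox ((2 * Real.pi) ^ 3) (27 * lowConst) where
  lam_pos := by positivity
  measurable_wave := measurable_of_countable _
  planeWave_field := isFieldOn_planeWave_wave
  measurable f _ := measurable_of_countable _
  memLp f hf := memLp_fourierCoeffBox hf
  parseval f g hf hg := by
    have hpi : (((2 * Real.pi) ^ 3 : ℝ) : ℂ) ≠ 0 := by
      exact_mod_cast (by positivity : (2 * Real.pi) ^ 3 ≠ 0)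
    have hi := integrable_conj_mul (memLp_fourierCoeffBox hf) (memLp_fourierCoeffBox hg)
    rw [integral_countable hi]
    simp only [Measure.real, Measure.count_singleton, ENNReal.toReal_one, one_smul]
    rw [(hasSum_conj_mul_fourierCoeffBox hf hg).tsum_eq, mul_inv_cancel_left₀ hpi]
    rfl
  ae_eq_integral f _ _ := Eventually.of_forall fun k => fourierCoeffBox_eq f k
  ae_eq_zero h _ h0 := Eventually.of_forall fun l => by
    have h1 := h0 _ (isTest_planeWave_wave l)
    simp only [fourierCoeffBox_planeWave] at h1
    rw [integral_count_mul_ite] at h1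
    simpa using h1
  ae_eq_zero_of_wave_eq_zero h h0 := Eventually.of_forall fun l hl => by
    have h1 := h0 _ (isTest_planeWave_wave l) fun i x => by
      rw [pd_planeWave, ← torusWave_apply, hl]
      simp
    simp only [fourierCoeffBox_planeWave] at h1
    rw [integral_count_mul_ite] at h1
    simpa using h1
  spectral W _ f hf := by
    have hf' : ∀ i, MemLp (comp f i) 2 ((volume : Measure E3).restrict box) := hf
    simp only [spectralIntegral, if_pos hf', lintegral_count]
    rfl
  decay := by
    rw [lintegral_count]
    exact tsum_decay_lt_top
  low_pos := mul_pos (by norm_num) lowConst_pos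
  low r hr := by
    rw [← lintegral_indicator (by measurability), lintegral_count]
    exact tsum_low_le hr

end NavierStokes

theorem theorem2 :
    ∃ c : ℝ, 0 < c ∧
      ∀ (Ω : NavierStokes.Domain) (ν T : ℝ), 0 < ν → 0 < T →
        ∀ (u : ℝ → NavierStokes.E3 → NavierStokes.E3) (p : ℝ → NavierStokes.E3 → ℝ),
          NavierStokes.IsSmoothSolution Ω ν T u p →
          NavierStokes.LosesRegularityAt Ω u T →
          ∀ t : ℝ, 0 ≤ t → t < T →
            ENNReal.ofReal (c * √ν / √(T - t)) ≤ NavierStokes.homSobolevNorm Ω (3 / 2) (u t) := by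
  have hA := NavierStokes.lowConst_pos
  -- The two entries are `√(lam / (36A))` for the whole space (`lam = 1`) and for the torus (`lam =
  -- (2π)³`).
  refine ⟨min √(1 / (36 * NavierStokes.lowConst))
    √((2 * Real.pi) ^ 3 / (36 * (27 * NavierStokes.lowConst))),
    lt_min (Real.sqrt_pos.2 (by positivity)) (Real.sqrt_pos.2 (by positivity)), ?_⟩
  intro Ω ν T hν _ u p h hloss t ht0 ht
  cases Ω
  · refine le_trans (ENNReal.ofReal_le_ofReal ?_)
      (NavierStokes.isFourierModel_space.le_homSobolevNorm hν h hloss ⟨ht0, ht⟩)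
    gcongr
    exact min_le_left _ _
  · refine le_trans (ENNReal.ofReal_le_ofReal ?_)
      (NavierStokes.isFourierModel_torus.le_homSobolevNorm hν h hloss ⟨ht0, ht⟩)
    gcongr
    exact min_le_right _ _
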